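/- Let $(\xi_k)_{k\ge 1}$ be i.i.d. real random variables with symmetric law ($-\xi_1\overset{d}{=}\xi_1$) in the domain of attraction of a (non-degenerate) $\beta$-stable law, $\beta\in(0,2]$; that is, $(\xi_1+\dots+\xi_n-b_n)/a_n$ converges in distribution to a $\beta$-stable law for suitable $a_n>0$, $b_n\in\mathbb R$. Put $\hat\beta=\min\{1,\beta\}$, $S_0=0$, $S_n=\xi_1+\dots+\xi_n$, $L_n(S)=\sum_{k=1}^n|S_k-S_{k-1}|$, $\mathcal T=\min\{n>0: S_n>0\}$ (which is a.s. finite), and let $L_{\mathcal T}(S)$ be the first-ladder length. Then $L_{\mathcal T}(S)$ is in the domain of attraction of a $\hat\beta/2$-stable law. More precisely, put $$\Phi(1,0)=\exp\Big(\tfrac12\sum_{n\ge1}\tfrac1n\,\mathbb P(S_n=0)\Big),$$ where the series converges. If $\xi_1$ is integer-valued, then $$\Phi(1,0)=\exp\Big(-\frac1{2\pi}\int_0^\pi\ln\big[1-\phi_{\xi_1}(t)\big]\,dt\Big)$$ with a convergent integral, $\phi_{\xi_1}(t)=\mathbb E[e^{it\xi_1}]$; if the law of $\xi_1$ has no atoms,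 then $\Phi(1,0)=1$. If $\beta>1$, then $\mathbb E|\xi_1|<\infty$. Suppose that, for some $\nu>0$, $\phi_{\xi_1}(s)=1-\nu s^\beta+o(s^\beta)$ as $s\to0^+$. Then $$\mathbb P\big(L_{\mathcal T}(S)>x\big)\sim\frac{\sqrt{C}}{\Gamma(1-\hat\beta/2)}\,\Phi(1,0)\,x^{-\hat\beta/2}\qquad\text{as }x\to\infty,$$ where $$C=\begin{cases}\nu/\cos(\pi\beta/2)&\text{if }\beta\in(0,1),\\ \dfrac{2\nu}{\pi}\log x&\text{if }\beta=1,\\ \mathbb E|\xi_1|&\text{if }\beta\in(1,2].\end{cases}$$ -/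

import Mathlib

open MeasureTheory ProbabilityTheory Filter Topology Asymptotics

noncomputable section

namespace LadderLength

/-- `G` is a (non-degenerate) `α`-stable law on `ℝ`: for every `n ≥ 1`, the sum of `n` independent
copies of `X ~ G` has the law of `n ^ (1/α) * X + d` for some constant `d`. -/
structure IsStableLaw (α : ℝ) (G : Measure ℝ) : Prop where
  isProbabilityMeasure : IsProbabilityMeasure G
  nondegenerate : ∀ c : ℝ, G ≠ Measure.dirac c
  sum_eq : ∀ n : ℕ, 0 < n → ∃ d : ℝ,
    (Measure.pi (fun _ : Fin n => G)).map (fun x => ∑ i, x i)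
      = G.map (fun x => (n : ℝ) ^ (1 / α) * x + d)

/-- The probability law `μ` on `ℝ` is in the domain of attraction of an `α`-stable law: for some
`a n > 0` and `b n`, the normalized sums `(X₁ + ⋯ + Xₙ - b n) / a n` of i.i.d. variables with law
`μ` converge in distribution to some `α`-stable law `G`. -/
def InDomainOfAttraction (α : ℝ) (μ : Measure ℝ) : Prop :=
  ∃ (_ : IsProbabilityMeasure μ) (G : Measure ℝ) (_ : IsProbabilityMeasure G),
    IsStableLaw α G ∧ ∃ a b : ℕ → ℝ, (∀ n, 0 < a n) ∧
      TendstoInDistribution (fun (n : ℕ) (x : Fin n → ℝ) => (∑ i, x i - b n) / a n)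
        atTop (fun x : ℝ => x) (fun n => Measure.pi (fun _ : Fin n => μ)) G

variable {Ω : Type*}

/-- The walk `S n = ξ₁ + ⋯ + ξₙ`; the increment `ξₖ` of the text is `ξ (k - 1)` here. -/
def walk (ξ : ℕ → Ω → ℝ) (n : ℕ) (ω : Ω) : ℝ := ∑ k ∈ Finset.range n, ξ k ω

/-- The length `L n = ∑_{k=1}^n |S k - S (k-1)|` of the walk after `n` steps. -/
def walkLength (ξ : ℕ → Ω → ℝ) (n : ℕ) (ω : Ω) : ℝ :=
  ∑ k ∈ Finset.range n, |walk ξ (k + 1) ω - walk ξ k ω|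

/-- The first-ladder time `T = min {n > 0 : S n > 0}` (with value `0` where there is no such `n`;
the theorem asserts that this has probability zero). -/
def ladderTime (ξ : ℕ → Ω → ℝ) (ω : Ω) : ℕ := sInf {n : ℕ | 0 < n ∧ 0 < walk ξ n ω}

/-- The first-ladder length `L_T`. -/
def ladderLength (ξ : ℕ → Ω → ℝ) (ω : Ω) : ℝ := walkLength ξ (ladderTime ξ ω) ω

variable [MeasurableSpace Ω]

/-- `Φ(z, s) = exp (-(1/2π) ∫₀^π log (1 - z φ(t, s)) dt)`, where `φ(t, s) = E exp (i (t ξ + s η))`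
is the joint characteristic function of a pair `(ξ, η)` with `ξ` integer-valued. -/
def latticePhi (P : Measure Ω) (ξ η : Ω → ℝ) (z s : ℝ) : ℂ :=
  Complex.exp (-(1 / (2 * Real.pi)) * ∫ t in (0 : ℝ)..Real.pi,
    Complex.log (1 - z * ∫ ω, Complex.exp (Complex.I * ((t * ξ ω + s * η ω : ℝ) : ℂ)) ∂P))

/-- The value `Φ(1, 0)` for a general real-valued walk: `exp (1/2 ∑_{n ≥ 1} P(S n = 0) / n)`.
The theorem asserts that the series converges, that this is `latticePhi` at `(1, 0)` for an
integer-valued walk, and that it is `1` if the increments have no atoms. -/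
def phiOneZero (P : Measure Ω) (ξ : ℕ → Ω → ℝ) : ℝ :=
  Real.exp (1 / 2 * ∑' n : ℕ, P.real {ω | walk ξ (n + 1) ω = 0} / (n + 1))

/-- The constant `C` in the tail asymptotics; for `β = 1` it depends on `x` through `log x`.
The argument `m` stands for `E|ξ₁|`. -/
def lengthConst (β ν m x : ℝ) : ℝ :=
  if β < 1 then ν / Real.cos (Real.pi * β / 2)
  else if β = 1 then 2 * ν / Real.pi * Real.log x
  else m

end LadderLength

end

/-!
Write `μ` for the law of the increments, `T` for the first-ladder time, `L_n` for the length of the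
walk after `n` steps, `w s = E (1 - exp (-s |ξ₁|))` (`absExponent`), `h t = 1 - E exp (i t ξ₁)`
(`cosExponent`, real by symmetry).

*From the ladder length to one step.* A Sparre Andersen identity, proved by counting the cyclic
rotations of a finite sequence that make a given time a ladder epoch (`sum_rotations_inv_rank`),
expresses the Laplace transform of `L_T` through the discounted probabilities of `S_n > 0`
(`tsum_lintegral_discount_pos`). Symmetry replaces `S_n > 0` by half of `S_n ≠ 0`, and the sum over
`n` becomes a logarithm (`one_sub_ladderTransform`): `1 - E (exp (-s L_T); T < ∞)` is `√(w s)`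
times the exponential of half the discounted return series. Letting `s → 0` shows that `T` is almost
surely finite and that the Laplace exponent of `L_T` is asymptotic to `Φ(1, 0) √(w s)`
(`tendsto_laplaceExponent_ladderLaw_div`). The return series converges because
`P (S_n = 0) = O(n^(-1/2))` for any nondegenerate law (`exists_return_le`), and for lattice walks it
is evaluated by integrating `log (1 - φ)` term by term (`lattice_log_integral`).

*Regular variation of `w`.* Convergence of the normalized sums forces `n h (t / a n) → c t ^ β`, and
a Baire category argument adds the bound `n h (t / a n) ≤ K (1 + t²)` (`exists_normalization`). The
monotone function `U s = E (s² ξ₁² / (1 + s² ξ₁²))` is an exponential mixture of `h`, hence regularly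
varying with index `β`. For `β < 1` the function `w` is a Cauchy mixture of `h`, and a Potter bound
for `U` permits passing to the limit in it. For `β ≥ 1` the defect `l w s - w (l s)` is
at most a multiple of `U s`, which is negligible with respect to `w s`. So `w` has index `min 1 β`
(`regularlyVarying_absExponent`). Under the expansion `h s = ν s ^ β + o(s ^ β)`, the same mixture
(or, for `β > 1`, dominated convergence) gives the precise behaviour of `w`.

*Back to `L_T`.* A law on `[0, ∞)` whose Laplace exponent is regularly varying with index in
`(0, 1)` is in the domain of attraction of the stable law with that index, by the continuity theorem
for Laplace transforms (`inDomainOfAttraction_of_regularlyVarying`), and its tail is given by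
Karamata's Tauberian theorem (`tendsto_tail_div_laplaceExponent`).
-/

namespace LadderLength

/-! ### Ladder epochs of a real sequence -/

/-- The partial sum `x 0 + ⋯ + x (n - 1)`. -/
def partialSum (x : ℕ → ℝ) (n : ℕ) : ℝ := ∑ k ∈ Finset.range n, x k

/-- The length `|x 0| + ⋯ + |x (n - 1)|`. -/
def variationSum (x : ℕ → ℝ) (n : ℕ) : ℝ := ∑ k ∈ Finset.range n, |x k|

/-- The sequence `x` with its first `m` terms removed. -/
def shift (m : ℕ) (x : ℕ → ℝ) : ℕ → ℝ := fun k => x (m + k)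

/-- `n` is a strict ascending ladder epoch of the walk with steps `x`: the partial sum at `n` is
larger than all earlier ones. Time `0` counts as a ladder epoch. -/
def IsLadder (x : ℕ → ℝ) (n : ℕ) : Prop := ∀ i < n, partialSum x i < partialSum x n

open scoped Classical in
/-- The number of ladder epochs in `{1, …, n}`. -/
noncomputable def rank (x : ℕ → ℝ) (n : ℕ) : ℕ := ((Finset.Ioc 0 n).filter (IsLadder x)).card

lemma partialSum_add (x : ℕ → ℝ) (m k : ℕ) :
    partialSum x (m + k) = partialSum x m + partialSum (shift m x) k := by
  simp [partialSum, shift, Finset.sum_range_add]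

lemma variationSum_add (x : ℕ → ℝ) (m k : ℕ) :
    variationSum x (m + k) = variationSum x m + variationSum (shift m x) k := by
  simp [variationSum, shift, Finset.sum_range_add]

@[simp] lemma partialSum_zero (x : ℕ → ℝ) : partialSum x 0 = 0 := by simp [partialSum]

lemma partialSum_congr {x y : ℕ → ℝ} {n : ℕ} (h : ∀ k < n, x k = y k) :
    partialSum x n = partialSum y n :=
  Finset.sum_congr rfl fun k hk => h k (Finset.mem_range.1 hk)

lemma variationSum_congr {x y : ℕ → ℝ} {n : ℕ} (h : ∀ k < n, x k = y k) :
    variationSum x n = variationSum y n :=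
  Finset.sum_congr rfl fun k hk => by rw [h k (Finset.mem_range.1 hk)]

lemma isLadder_congr {x y : ℕ → ℝ} {n : ℕ} (h : ∀ k < n, x k = y k) :
    IsLadder x n ↔ IsLadder y n := by
  unfold IsLadder
  refine forall₂_congr fun i hi => ?_
  rw [partialSum_congr h, partialSum_congr fun k hk => h k (hk.trans hi)]

lemma rank_congr {x y : ℕ → ℝ} {n : ℕ} (h : ∀ k < n, x k = y k) : rank x n = rank y n := by
  classical
  unfold rank
  congr 1
  refine Finset.filter_congr fun k hk => isLadder_congr fun i hi => h i ?_
  exact hi.trans_le (Finset.mem_Ioc.1 hk).2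

lemma isLadder_shift_iff (y : ℕ → ℝ) (j k : ℕ) :
    IsLadder (shift j y) k ↔ ∀ i < k, partialSum y (j + i) < partialSum y (j + k) := by
  simp [IsLadder, partialSum_add]

/-! ### The cyclic lemma -/

section Cyclic

variable {y : ℕ → ℝ} {n : ℕ}

lemma partialSum_add_period (hy : ∀ k, y (k + n) = y k) (k : ℕ) :
    partialSum y (k + n) = partialSum y k + partialSum y n := by
  rw [add_comm k n, partialSum_add, add_comm]
  congr 1
  exact Finset.sum_congr rfl fun i _ => by simp [shift, add_comm n, hy]

lemma isLadder_shift_add_period (hy : ∀ k, y (k + n) = y k) (j : ℕ) :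
    IsLadder (shift (j + n) y) n ↔ IsLadder (shift j y) n := by
  rw [isLadder_shift_iff, isLadder_shift_iff]
  refine forall₂_congr fun i _ => ?_
  rw [add_right_comm j n i, partialSum_add_period hy, partialSum_add_period hy (j + n)]
  simp

lemma variationSum_shift_period (hy : ∀ k, y (k + n) = y k) (j : ℕ) :
    variationSum (shift j y) n = variationSum y n := by
  have h1 := variationSum_add y j n
  have h2 := variationSum_add y n j
  have h3 : variationSum (shift n y) j = variationSum y j :=
    Finset.sum_congr rfl fun i _ => by simp [shift, add_comm n, hy]
  rw [add_comm] at h2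
  linarith

/-- For a periodic step sequence, the ladder epochs after a window-record `j` are exactly the
window-records themselves. -/
lemma isLadder_shift_iff_record (hy : ∀ k, y (k + n) = y k) {j k : ℕ}
    (hj : IsLadder (shift j y) n) (hk0 : 0 < k) (hkn : k ≤ n) :
    IsLadder (shift j y) k ↔ IsLadder (shift (j + k) y) n := by
  rw [isLadder_shift_iff] at hj
  rw [isLadder_shift_iff, isLadder_shift_iff]
  have hp := partialSum_add_period hy
  constructor
  · intro h i hi
    rcases le_or_gt n (k + i) with hki | hki
    · have h1 := h (k + i - n) (by omega)
      have h2 := hp (j + (k + i - n))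
      rw [show j + (k + i - n) + n = j + k + i by omega] at h2
      rw [hp, h2]
      linarith
    · have h1 := hj (k + i) hki
      have h2 := h 0 hk0
      rw [hp] at h1 ⊢
      rw [add_zero] at h2
      rw [← add_assoc] at h1
      linarith
  · intro h i hi
    have h1 := h (n - k + i) (by omega)
    rw [show j + k + (n - k + i) = j + i + n by omega, hp, hp] at h1
    linarith

/-- A periodic sequence with positive sum over a period has a rotation for which the period is a
ladder epoch: start just after the first maximum of the walk over a period. -/
lemma exists_record (hy : ∀ k, y (k + n) = y k) (hpos : 0 < partialSum y n) :
    ∃ k < n, IsLadder (shift k y) n := by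
  have hn : 0 < n := by
    rcases Nat.eq_zero_or_pos n with rfl | h
    · simp at hpos
    · exact h
  have hp := partialSum_add_period hy
  -- the first epoch in `[n, 2n)` at which the maximum of the walk over `[n, 2n)` is attained
  have hex : ∃ m, n ≤ m ∧ m < n + n ∧ ∀ i, n ≤ i → i < n + n → partialSum y i ≤ partialSum y m := by
    obtain ⟨m, hm, hmax⟩ := Finset.exists_max_image (Finset.Ico n (n + n)) (partialSum y)
      ⟨n, by simp [hn]⟩
    rw [Finset.mem_Ico] at hm
    exact ⟨m, hm.1, hm.2, fun i h1 h2 => hmax i (Finset.mem_Ico.2 ⟨h1, h2⟩)⟩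
  classical
  obtain ⟨h1, h2, h3⟩ := Nat.find_spec hex
  set m := Nat.find hex with hm
  refine ⟨m - n, by omega, ?_⟩
  rw [isLadder_shift_iff]
  intro i hi
  rw [show m - n + n = m by omega]
  rcases le_or_gt n (m - n + i) with h | h
  · by_contra hcon
    push Not at hcon
    refine Nat.find_min hex (m := m - n + i) (by omega) ⟨h, by omega, fun l hl1 hl2 => ?_⟩
    exact (h3 l hl1 hl2).trans hcon
  · have := h3 (m - n + i + n) (by omega) (by omega)
    rw [hp] at this
    linarith

open scoped Classical ENNReal in
/-- The cyclic lemma: among the `n` rotations of a cycle with positive sum, those for which `n` is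
a ladder epoch all have the same rank, and their number is that rank. -/
lemma sum_rotations_inv_rank (hy : ∀ k, y (k + n) = y k) :
    ∑ j ∈ Finset.range n, (if IsLadder (shift j y) n then ((rank (shift j y) n : ℝ≥0∞))⁻¹ else 0)
      = if 0 < partialSum y n then 1 else 0 := by
  have hper : Function.Periodic (fun j => IsLadder (shift j y) n) n := fun j =>
    propext (isLadder_shift_add_period hy j)
  have hrank : ∀ j, IsLadder (shift j y) n →
      rank (shift j y) n = ((Finset.range n).filter (fun j => IsLadder (shift j y) n)).card := by
    intro j hj
    have h1 : rank (shift j y) n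
        = ((Finset.Ico (j + 1) (j + 1 + n)).filter (fun j => IsLadder (shift j y) n)).card := by
      unfold rank
      refine Finset.card_bij (fun k _ => j + k) ?_ ?_ ?_
      · intro k hk
        simp only [Finset.mem_filter, Finset.mem_Ioc, Finset.mem_Ico] at hk ⊢
        exact ⟨by omega, (isLadder_shift_iff_record hy hj hk.1.1 hk.1.2).1 hk.2⟩
      · intro a _ b _ h
        simpa using h
      · intro b hb
        simp only [Finset.mem_filter, Finset.mem_Ioc, Finset.mem_Ico] at hb ⊢
        refine ⟨b - j, ⟨by omega, ?_⟩, by omega⟩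
        rw [isLadder_shift_iff_record hy hj (by omega) (by omega),
          show j + (b - j) = b by omega]
        exact hb.2
    rw [h1, Nat.filter_Ico_card_eq_of_periodic _ _ _ hper, Nat.count_eq_card_filter_range]
  split_ifs with hpos
  · obtain ⟨k, hk, hlad⟩ := exists_record hy hpos
    rw [← Finset.sum_filter, Finset.sum_congr rfl fun j hj => by
      rw [hrank j (Finset.mem_filter.1 hj).2], Finset.sum_const, nsmul_eq_mul]
    refine ENNReal.mul_inv_cancel ?_ (ENNReal.natCast_ne_top _)
    simp only [ne_eq, Nat.cast_eq_zero, Finset.card_eq_zero]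
    exact Finset.Nonempty.ne_empty ⟨k, by simp [hk, hlad]⟩
  · refine Finset.sum_eq_zero fun j hj => if_neg fun hlad => hpos ?_
    rw [isLadder_shift_iff] at hlad
    have := hlad 0 (by have := Finset.mem_range.1 hj; omega)
    rw [partialSum_add_period hy] at this
    simpa using this

end Cyclic

/-! ### The law of the step sequence -/

open scoped ENNReal

/-- The law of a sequence of independent steps with law `μ`. -/
noncomputable def stepLaw (μ : Measure ℝ) : Measure (ℕ → ℝ) := Measure.infinitePi fun _ : ℕ => μ

instance (μ : Measure ℝ) [IsProbabilityMeasure μ] : IsProbabilityMeasure (stepLaw μ) := by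
  unfold stepLaw; infer_instance

@[fun_prop] lemma measurable_partialSum (n : ℕ) : Measurable fun x => partialSum x n := by
  unfold partialSum; fun_prop

@[fun_prop] lemma measurable_variationSum (n : ℕ) : Measurable fun x => variationSum x n := by
  unfold variationSum; fun_prop

@[fun_prop] lemma measurable_shift (m : ℕ) : Measurable (shift m) :=
  measurable_pi_iff.2 fun k => measurable_pi_apply (m + k)

lemma measurableSet_isLadder (n : ℕ) : MeasurableSet {x | IsLadder x n} := by
  have : {x : ℕ → ℝ | IsLadder x n}
      = ⋂ i ∈ Finset.range n, {x | partialSum x i < partialSum x n} := by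
    ext x; simp [IsLadder]
  rw [this]
  exact Finset.measurableSet_biInter _ fun i _ =>
    measurableSet_lt (measurable_partialSum i) (measurable_partialSum n)

@[fun_prop] lemma measurable_rank (n : ℕ) : Measurable fun x => rank x n := by
  classical
  have : (fun x => rank x n) = fun x => ∑ k ∈ Finset.Ioc 0 n, if IsLadder x k then 1 else 0 := by
    ext x; simp [rank]
  rw [this]
  exact Finset.measurable_sum _ fun k _ =>
    Measurable.ite (measurableSet_isLadder k) measurable_const measurable_const

section

variable (μ : Measure ℝ) [IsProbabilityMeasure μ]

lemma stepLaw_map_comp {f : ℕ → ℕ} (hf : Function.Injective f) :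
    (stepLaw μ).map (fun x k => x (f k)) = stepLaw μ :=
  Measure.map_infinitePi_infinitePi_of_inj (P := fun _ : ℕ => μ) hf

lemma lintegral_stepLaw_comp {f : ℕ → ℕ} (hf : Function.Injective f) {F : (ℕ → ℝ) → ℝ≥0∞}
    (hF : Measurable F) : ∫⁻ x, F (fun k => x (f k)) ∂stepLaw μ = ∫⁻ x, F x ∂stepLaw μ := by
  conv_rhs => rw [← stepLaw_map_comp μ hf]
  rw [lintegral_map hF (measurable_pi_iff.2 fun k => measurable_pi_apply (f k))]

/-- The first `m` steps are independent of the later ones, which have the law of the whole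
sequence. -/
lemma lintegral_mul_shift {m : ℕ} {F G : (ℕ → ℝ) → ℝ≥0∞} (hF : Measurable F) (hG : Measurable G)
    (hloc : ∀ x y : ℕ → ℝ, (∀ k < m, x k = y k) → F x = F y) :
    ∫⁻ x, F x * G (shift m x) ∂stepLaw μ = (∫⁻ x, F x ∂stepLaw μ) * ∫⁻ x, G x ∂stepLaw μ := by
  let c : ℕ → MeasurableSpace (ℕ → ℝ) := fun k => MeasurableSpace.comap (fun x => x k) inferInstance
  have hle : ∀ k, c k ≤ (inferInstance : MeasurableSpace (ℕ → ℝ)) := fun k =>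
    (measurable_pi_apply k).comap_le
  have hind : iIndep c (stepLaw μ) :=
    iIndepFun_infinitePi (P := fun _ : ℕ => μ) (X := fun _ x => x) (fun _ => measurable_id)
  have hdisj : Disjoint (Set.Iio m) (Set.Ici m) :=
    Set.disjoint_left.2 fun k hk hk' => absurd (Set.mem_Iio.1 hk) (not_lt.2 (Set.mem_Ici.1 hk'))
  have h := indep_iSup_of_disjoint hle hind hdisj
  have hshift : ∫⁻ x, G (shift m x) ∂stepLaw μ = ∫⁻ x, G x ∂stepLaw μ :=
    lintegral_stepLaw_comp μ (f := fun k => m + k) (fun a b => by simp) hG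
  have hcoord : ∀ (S : Set ℕ) (k : ℕ), k ∈ S →
      Measurable[⨆ k ∈ S, c k] fun x : ℕ → ℝ => x k := fun S k hk =>
    (Measurable.of_comap_le le_rfl).mono (le_iSup₂ (f := fun k (_ : k ∈ S) => c k) k hk) le_rfl
  rw [← hshift]
  refine lintegral_mul_eq_lintegral_mul_lintegral_of_independent_measurableSpace
    (iSup₂_le fun k _ => hle k) (iSup₂_le fun k _ => hle k) h ?_ ?_
  · have : F = F ∘ fun x k => if k < m then x k else 0 := by
      ext x
      exact hloc _ _ fun k hk => by simp [hk]
    rw [this]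
    refine hF.comp (@measurable_pi_lambda _ _ _ (_) _ _ fun k => ?_)
    by_cases hk : k < m
    · simpa [hk] using hcoord (Set.Iio m) k hk
    · simp only [hk, if_false]
      exact @measurable_const _ _ _ (_) _
  · refine hG.comp (@measurable_pi_lambda _ _ _ (_) _ _ fun k => ?_)
    exact hcoord (Set.Ici m) (m + k) (by simp)

/-! ### The identity of Sparre Andersen -/

/-- The discount `exp (-s L n)`. -/
noncomputable def discount (s : ℝ) (n : ℕ) (x : ℕ → ℝ) : ℝ≥0∞ :=
  ENNReal.ofReal (Real.exp (-(s * variationSum x n)))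

@[fun_prop] lemma measurable_discount (s : ℝ) (n : ℕ) : Measurable (discount s n) := by
  unfold discount; fun_prop

lemma discount_add (s : ℝ) (m k : ℕ) (x : ℕ → ℝ) :
    discount s (m + k) x = discount s m x * discount s k (shift m x) := by
  unfold discount
  rw [← ENNReal.ofReal_mul (Real.exp_nonneg _), ← Real.exp_add, variationSum_add]
  ring_nf

open scoped Classical in
/-- The discount `exp (-s L n)` on the event that `n` is the `r`-th ladder epoch, and `0`
otherwise. -/
noncomputable def ladderTerm (s : ℝ) (r n : ℕ) (x : ℕ → ℝ) : ℝ≥0∞ :=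
  if IsLadder x n ∧ rank x n = r then discount s n x else 0

@[fun_prop] lemma measurable_ladderTerm (s : ℝ) (r n : ℕ) : Measurable (ladderTerm s r n) :=
  Measurable.ite ((measurableSet_isLadder n).inter (measurable_rank n (measurableSet_singleton r)))
    (measurable_discount s n) measurable_const

lemma rank_pos {x : ℕ → ℝ} {n : ℕ} (hn : 0 < n) (h : IsLadder x n) : 0 < rank x n := by
  classical
  exact Finset.card_pos.2 ⟨n, Finset.mem_filter.2 ⟨Finset.mem_Ioc.2 ⟨hn, le_rfl⟩, h⟩⟩

lemma isLadder_add_iff {x : ℕ → ℝ} {m : ℕ} (hm : IsLadder x m) (k : ℕ) :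
    IsLadder x (m + k) ↔ IsLadder (shift m x) k := by
  rw [isLadder_shift_iff]
  refine ⟨fun h i hi => h _ (by omega), fun h i hi => ?_⟩
  rcases le_or_gt m i with h1 | h1
  · have := h (i - m) (by omega)
    rwa [show m + (i - m) = i by omega] at this
  · rcases Nat.eq_zero_or_pos k with rfl | hk
    · exact hm i h1
    · exact (hm i h1).trans (by simpa using h 0 hk)

lemma rank_add {x : ℕ → ℝ} {m : ℕ} (hm : IsLadder x m) (k : ℕ) :
    rank x (m + k) = rank x m + rank (shift m x) k := by
  classical
  unfold rank
  have : Finset.Ioc 0 (m + k) = Finset.Ioc 0 m ∪ Finset.Ioc m (m + k) := by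
    rw [Finset.Ioc_union_Ioc_eq_Ioc (by omega) (by omega)]
  rw [this, Finset.filter_union, Finset.card_union_of_disjoint]
  · congr 1
    symm
    refine Finset.card_bij (fun i _ => m + i) ?_ (fun a _ b _ h => by simpa using h) ?_
    · intro i hi
      simp only [Finset.mem_filter, Finset.mem_Ioc] at hi ⊢
      exact ⟨by omega, (isLadder_add_iff hm i).2 hi.2⟩
    · intro b hb
      simp only [Finset.mem_filter, Finset.mem_Ioc] at hb ⊢
      refine ⟨b - m, ⟨by omega, ?_⟩, by omega⟩
      rw [← isLadder_add_iff hm, show m + (b - m) = b by omega]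
      exact hb.2
  · refine Finset.disjoint_filter_filter (Finset.disjoint_left.2 fun i h1 h2 => ?_)
    simp only [Finset.mem_Ioc] at h1 h2
    omega

lemma exists_rank_eq_one {x : ℕ → ℝ} {n : ℕ} (h : 0 < rank x n) :
    ∃ m ≤ n, IsLadder x m ∧ rank x m = 1 := by
  classical
  have hex : ∃ m, 0 < m ∧ m ≤ n ∧ IsLadder x m := by
    obtain ⟨m, hm⟩ := Finset.card_pos.1 h
    simp only [Finset.mem_filter, Finset.mem_Ioc] at hm
    exact ⟨m, hm.1.1, hm.1.2, hm.2⟩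
  obtain ⟨h1, h2, h3⟩ := Nat.find_spec hex
  refine ⟨Nat.find hex, h2, h3, Finset.card_eq_one.2 ⟨Nat.find hex, ?_⟩⟩
  ext k
  simp only [Finset.mem_filter, Finset.mem_Ioc, Finset.mem_singleton]
  refine ⟨fun hk => ?_, fun hk => by rw [hk]; exact ⟨⟨h1, le_rfl⟩, h3⟩⟩
  by_contra hne
  exact Nat.find_min hex (lt_of_le_of_ne hk.1.2 hne) ⟨hk.1.1, hk.1.2.trans h2, hk.2⟩

lemma eq_of_rank_eq_one {x : ℕ → ℝ} {m n : ℕ} (hm : IsLadder x m) (hn : IsLadder x n)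
    (hm1 : rank x m = 1) (hn1 : rank x n = 1) : m = n := by
  wlog h : m < n generalizing m n
  · rcases lt_trichotomy m n with h1 | h1 | h1
    · exact this hm hn hm1 hn1 h1
    · exact h1
    · exact (this hn hm hn1 hm1 h1).symm
  have h1 := rank_add hm (n - m)
  rw [show m + (n - m) = n by omega, hm1, hn1] at h1
  have h2 := rank_pos (by omega : 0 < n - m) ((isLadder_add_iff hm (n - m)).1
    (by rwa [show m + (n - m) = n by omega]))
  omega

/-- Decomposition of a walk at its first ladder epoch. -/
lemma tsum_ladderTerm_succ (s : ℝ) (r : ℕ) (x : ℕ → ℝ) :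
    ∑' n, ladderTerm s (r + 1) n x
      = ∑' m, ladderTerm s 1 m x * ∑' k, ladderTerm s r k (shift m x) := by
  by_cases hex : ∃ m, IsLadder x m ∧ rank x m = 1
  · obtain ⟨m, hm, hm1⟩ := hex
    have h0 : ∀ m' ≠ m, ladderTerm s 1 m' x * ∑' k, ladderTerm s r k (shift m' x) = 0 := by
      intro m' hne
      rw [ladderTerm, if_neg fun h => hne (eq_of_rank_eq_one h.1 hm h.2 hm1), zero_mul]
    rw [tsum_eq_single m h0,
      ← (add_right_injective m).tsum_eq (f := fun n => ladderTerm s (r + 1) n x),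
      ← ENNReal.tsum_mul_left]
    · refine tsum_congr fun k => ?_
      have hiff : (IsLadder x (m + k) ∧ rank x (m + k) = r + 1)
          ↔ (IsLadder (shift m x) k ∧ rank (shift m x) k = r) := by
        rw [isLadder_add_iff hm, rank_add hm, hm1, add_comm 1, Nat.succ_inj]
      simp only [ladderTerm, hm, hm1, discount_add, and_self, if_true, mul_ite, mul_zero]
      by_cases h : IsLadder (shift m x) k ∧ rank (shift m x) k = r
      · rw [if_pos h, if_pos (hiff.2 h)]
      · rw [if_neg h, if_neg fun h' => h (hiff.1 h')]
    · intro n hn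
      rw [Function.mem_support, ladderTerm] at hn
      have hn' : IsLadder x n ∧ rank x n = r + 1 := by
        by_contra hc; exact hn (if_neg hc)
      refine ⟨n - m, ?_⟩
      obtain ⟨m', hle, h1, h2⟩ := exists_rank_eq_one (x := x) (n := n) (by omega)
      have := eq_of_rank_eq_one h1 hm h2 hm1
      simp only; omega
  · push Not at hex
    have h1 : ∀ m, ladderTerm s 1 m x = 0 := fun m => if_neg fun h => hex m h.1 h.2
    have h2 : ∀ n, ladderTerm s (r + 1) n x = 0 := fun n => if_neg fun h => by
      obtain ⟨m', hle, h1, h2⟩ := exists_rank_eq_one (x := x) (n := n) (by omega)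
      exact hex m' h1 h2
    simp [h1, h2]

lemma tsum_ladderTerm_zero (s : ℝ) (x : ℕ → ℝ) : ∑' n, ladderTerm s 0 n x = 1 := by
  rw [tsum_eq_single 0]
  · simp [ladderTerm, IsLadder, rank, discount, variationSum]
  · intro n hn
    refine if_neg fun h => ?_
    have := rank_pos (Nat.pos_of_ne_zero hn) h.1
    omega

lemma ladderTerm_congr (s : ℝ) (r : ℕ) {x y : ℕ → ℝ} {n : ℕ} (h : ∀ k < n, x k = y k) :
    ladderTerm s r n x = ladderTerm s r n y := by
  classical
  unfold ladderTerm discount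
  rw [rank_congr h, variationSum_congr h]
  simp only [isLadder_congr h]

/-- The transform `E exp (-s L)` of the length at the `r`-th ladder epoch. -/
noncomputable def ladderTransform (s : ℝ) (r : ℕ) : ℝ≥0∞ :=
  ∫⁻ x, ∑' n, ladderTerm s r n x ∂stepLaw μ

lemma ladderTransform_succ (s : ℝ) (r : ℕ) :
    ladderTransform μ s (r + 1) = ladderTransform μ s 1 * ladderTransform μ s r := by
  unfold ladderTransform
  have hG : Measurable fun x => ∑' k, ladderTerm s r k x :=
    Measurable.tsum fun k => measurable_ladderTerm s r k
  simp_rw [tsum_ladderTerm_succ s r]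
  rw [lintegral_tsum fun m => by fun_prop, lintegral_tsum fun m => by fun_prop,
    ← ENNReal.tsum_mul_right]
  exact tsum_congr fun m => lintegral_mul_shift μ (measurable_ladderTerm s 1 m) hG
    fun x y h => ladderTerm_congr s 1 h

lemma ladderTransform_eq_pow (s : ℝ) (r : ℕ) :
    ladderTransform μ s r = ladderTransform μ s 1 ^ r := by
  induction r with
  | zero => simp [ladderTransform, tsum_ladderTerm_zero]
  | succ r ih => rw [ladderTransform_succ, ih, pow_succ']

/-- Averaging the cyclic lemma over the law of the steps. -/
lemma lintegral_discount_pos (s : ℝ) (n : ℕ) :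
    ∫⁻ x in {x | 0 < partialSum x n}, discount s n x ∂stepLaw μ
      = n * ∑' r : ℕ, ((r + 1 : ℕ) : ℝ≥0∞)⁻¹ * ∫⁻ x, ladderTerm s (r + 1) n x ∂stepLaw μ := by
  classical
  rcases Nat.eq_zero_or_pos n with rfl | hn
  · simp
  -- the contribution of one rotation of the first `n` steps
  let F : (ℕ → ℝ) → ℝ≥0∞ := fun x =>
    (if IsLadder x n then ((rank x n : ℝ≥0∞))⁻¹ else 0) * discount s n x
  have hFm : Measurable F := by
    refine Measurable.mul (Measurable.ite (measurableSet_isLadder n) ?_ measurable_const)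
      (measurable_discount s n)
    exact (measurable_from_top.comp (measurable_rank n) :
      Measurable ((fun k : ℕ => ((k : ℝ≥0∞))⁻¹) ∘ fun x => rank x n))
  have hFloc : ∀ x y : ℕ → ℝ, (∀ k < n, x k = y k) → F x = F y := fun x y h => by
    simp only [F, isLadder_congr h, rank_congr h, discount, variationSum_congr h]
  have hFsum : ∀ x, F x = ∑' r : ℕ, ((r + 1 : ℕ) : ℝ≥0∞)⁻¹ * ladderTerm s (r + 1) n x := by
    intro x
    by_cases h : IsLadder x n
    · have hr := rank_pos hn h
      rw [tsum_eq_single (rank x n - 1)]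
      · have : rank x n - 1 + 1 = rank x n := by omega
        simp [F, ladderTerm, h, this]
      · intro r hne
        rw [ladderTerm, if_neg fun h' => hne (by omega), mul_zero]
    · simp [F, ladderTerm, h]
  let rot : ℕ → ℕ → ℕ := fun j k => if k < n then (j + k) % n else k
  have hrot : ∀ j, Function.Injective (rot j) := by
    intro j a b hab
    simp only [rot] at hab
    split_ifs at hab with h1 h2 h2
    · have : j + a ≡ j + b [MOD n] := hab
      exact (Nat.ModEq.add_left_cancel' j this).eq_of_lt_of_lt h1 h2
    · have := Nat.mod_lt (j + a) hn; omega
    · have := Nat.mod_lt (j + b) hn; omega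
    · exact hab
  have hpt : ∀ x : ℕ → ℝ, ({x | 0 < partialSum x n}.indicator (discount s n) x)
      = ∑ j ∈ Finset.range n, F (fun k => x (rot j k)) := by
    intro x
    let y : ℕ → ℝ := fun k => x (k % n)
    have hy : ∀ k, y (k + n) = y k := fun k => by simp [y]
    have hxy : ∀ k < n, x k = y k := fun k hk => by simp [y, Nat.mod_eq_of_lt hk]
    have hF : ∀ j, F (fun k => x (rot j k)) = F (shift j y) := fun j =>
      hFloc _ _ fun k hk => by simp [rot, hk, shift, y]
    simp_rw [hF]
    have hd : ∀ j, discount s n (shift j y) = discount s n x := fun j => by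
      rw [discount, discount, variationSum_shift_period hy, variationSum_congr hxy]
    simp only [F, hd]
    rw [← Finset.sum_mul, sum_rotations_inv_rank hy, ← partialSum_congr hxy, Set.indicator_apply]
    simp [ite_mul]
  have hset : MeasurableSet {x : ℕ → ℝ | 0 < partialSum x n} :=
    measurableSet_lt measurable_const (measurable_partialSum n)
  rw [← lintegral_indicator hset]
  simp_rw [hpt]
  have hcomp : ∀ j, Measurable fun x : ℕ → ℝ => F fun k => x (rot j k) := fun j =>
    hFm.comp (measurable_pi_iff.2 fun k => measurable_pi_apply (rot j k))
  rw [lintegral_finsetSum _ fun j _ => hcomp j]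
  simp_rw [lintegral_stepLaw_comp μ (hrot _) hFm]
  rw [Finset.sum_const, Finset.card_range, nsmul_eq_mul]
  congr 1
  simp_rw [hFsum]
  rw [lintegral_tsum fun r => by fun_prop]
  exact tsum_congr fun r => lintegral_const_mul _ (measurable_ladderTerm s (r + 1) n)

/-- The identity of Sparre Andersen, before taking the logarithm. -/
lemma tsum_lintegral_discount_pos (s : ℝ) :
    ∑' n : ℕ, ((n + 1 : ℕ) : ℝ≥0∞)⁻¹ *
        ∫⁻ x in {x | 0 < partialSum x (n + 1)}, discount s (n + 1) x ∂stepLaw μ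
      = ∑' r : ℕ, ((r + 1 : ℕ) : ℝ≥0∞)⁻¹ * ladderTransform μ s 1 ^ (r + 1) := by
  simp_rw [lintegral_discount_pos μ s, ← mul_assoc, ENNReal.inv_mul_cancel
    (Nat.cast_ne_zero.2 (Nat.succ_ne_zero _)) (ENNReal.natCast_ne_top _), one_mul]
  rw [ENNReal.tsum_comm]
  refine tsum_congr fun r => ?_
  rw [ENNReal.tsum_mul_left, ← ladderTransform_eq_pow, ladderTransform,
    lintegral_tsum fun n => (measurable_ladderTerm s (r + 1) n).aemeasurable]
  congr 1
  -- time `0` has rank `0` and does not contribute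
  have h0 : ∀ x, ladderTerm s (r + 1) 0 x = 0 := fun x => by simp [ladderTerm, rank]
  rw [tsum_eq_zero_add' (f := fun n => ∫⁻ x, ladderTerm s (r + 1) n x ∂stepLaw μ)
    ENNReal.summable]
  simp [h0]

end

/-! ### Discounted symmetric walks -/

/-- The function `s ↦ E (1 - exp (-s |X|))` for `X` with law `μ`. -/
noncomputable def absExponent (μ : Measure ℝ) (s : ℝ) : ℝ := ∫ x, (1 - Real.exp (-(s * |x|))) ∂μ

lemma one_sub_exp_mem {a : ℝ} (ha : 0 ≤ a) : 0 ≤ 1 - Real.exp (-a) ∧ 1 - Real.exp (-a) ≤ 1 :=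
  ⟨by linarith [Real.exp_le_one_iff.2 (neg_nonpos.2 ha)], by linarith [Real.exp_pos (-a)]⟩

/-- The logarithmic series, in `ℝ≥0∞`. -/
lemma tsum_inv_mul_pow_succ {q : ℝ≥0∞} (hq : q < 1) :
    ∑' n : ℕ, ((n + 1 : ℕ) : ℝ≥0∞)⁻¹ * q ^ (n + 1) = ENNReal.ofReal (-Real.log (1 - q.toReal)) := by
  have hq' : q ≠ ∞ := ne_top_of_lt hq
  have h1 : q.toReal < 1 := by
    rw [← ENNReal.toReal_one]; exact (ENNReal.toReal_lt_toReal hq' ENNReal.one_ne_top).2 hq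
  have h := Real.hasSum_pow_div_log_of_abs_lt_one (x := q.toReal)
    (by rwa [abs_of_nonneg ENNReal.toReal_nonneg])
  rw [← h.tsum_eq, ENNReal.ofReal_tsum_of_nonneg (fun n => by positivity) h.summable]
  refine tsum_congr fun n => ?_
  rw [div_eq_inv_mul, ENNReal.ofReal_mul (by positivity), ENNReal.ofReal_pow ENNReal.toReal_nonneg,
    ENNReal.ofReal_toReal hq', ENNReal.ofReal_inv_of_pos (by positivity), ← Nat.cast_add_one,
    ENNReal.ofReal_natCast]

section

variable (μ : Measure ℝ) [IsProbabilityMeasure μ]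

lemma integrable_exp_neg_abs {s : ℝ} (hs : 0 ≤ s) :
    Integrable (fun x => Real.exp (-(s * |x|))) μ := by
  refine Integrable.of_bound (by fun_prop) 1 (ae_of_all _ fun x => ?_)
  rw [Real.norm_of_nonneg (Real.exp_nonneg _)]
  exact Real.exp_le_one_iff.2 (neg_nonpos.2 (by positivity))

lemma integral_exp_neg_abs {s : ℝ} (hs : 0 ≤ s) :
    ∫ x, Real.exp (-(s * |x|)) ∂μ = 1 - absExponent μ s := by
  rw [absExponent, integral_sub (integrable_const _) (integrable_exp_neg_abs μ hs)]
  simp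

lemma lintegral_discount {s : ℝ} (hs : 0 ≤ s) (n : ℕ) :
    ∫⁻ x, discount s n x ∂stepLaw μ = ENNReal.ofReal (1 - absExponent μ s) ^ n := by
  induction n with
  | zero => simp [discount, variationSum]
  | succ n ih =>
    have h1 : ∫⁻ x, discount s 1 x ∂stepLaw μ = ENNReal.ofReal (1 - absExponent μ s) := by
      have h := Measure.infinitePi_map_eval (fun _ : ℕ => μ) 0
      rw [← integral_exp_neg_abs μ hs, ofReal_integral_eq_lintegral_ofReal
        (integrable_exp_neg_abs μ hs) (ae_of_all _ fun _ => Real.exp_nonneg _)]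
      nth_rewrite 2 [← h]
      rw [lintegral_map (by fun_prop) (by fun_prop)]
      simp [discount, variationSum, stepLaw]
    simp_rw [add_comm n 1, discount_add]
    rw [lintegral_mul_shift μ (measurable_discount s 1) (measurable_discount s n)
      (fun x y h => by rw [discount, discount, variationSum_congr h]), h1, ih, pow_add, pow_one]

lemma lintegral_stepLaw_neg (hsymm : μ.map (fun x => -x) = μ) {F : (ℕ → ℝ) → ℝ≥0∞}
    (hF : Measurable F) : ∫⁻ x, F (fun k => -x k) ∂stepLaw μ = ∫⁻ x, F x ∂stepLaw μ := by
  have h : (stepLaw μ).map (fun x k => -x k) = stepLaw μ := by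
    have := Measure.infinitePi_map_pi (fun _ : ℕ => μ) (f := fun _ x => -x)
      (fun _ => measurable_neg)
    rw [stepLaw, this, hsymm]
  conv_rhs => rw [← h]
  rw [lintegral_map hF (by fun_prop)]

/-- Changing the sign of every step preserves the length and exchanges the events `S n > 0` and
`S n < 0`. -/
lemma two_mul_lintegral_discount_pos (hsymm : μ.map (fun x => -x) = μ) {s : ℝ} (hs : 0 ≤ s)
    (n : ℕ) :
    2 * ∫⁻ x in {x | 0 < partialSum x n}, discount s n x ∂stepLaw μ
        + ∫⁻ x in {x | partialSum x n = 0}, discount s n x ∂stepLaw μ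
      = ENNReal.ofReal (1 - absExponent μ s) ^ n := by
  have hpos : MeasurableSet {x : ℕ → ℝ | 0 < partialSum x n} :=
    measurableSet_lt measurable_const (measurable_partialSum n)
  have hneg : MeasurableSet {x : ℕ → ℝ | partialSum x n < 0} :=
    measurableSet_lt (measurable_partialSum n) measurable_const
  have hzero : MeasurableSet {x : ℕ → ℝ | partialSum x n = 0} :=
    measurable_partialSum n (measurableSet_singleton 0)
  have h : ∫⁻ x in {x | 0 < partialSum x n}, discount s n x ∂stepLaw μ
      = ∫⁻ x in {x | partialSum x n < 0}, discount s n x ∂stepLaw μ := by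
    rw [← lintegral_indicator hpos, ← lintegral_indicator hneg,
      ← lintegral_stepLaw_neg μ hsymm ((measurable_discount s n).indicator hneg)]
    refine lintegral_congr fun x => ?_
    simp [Set.indicator_apply, partialSum, discount, variationSum]
  rw [← lintegral_discount μ hs, two_mul]
  nth_rewrite 2 [h]
  rw [← lintegral_indicator hpos, ← lintegral_indicator hneg, ← lintegral_indicator hzero,
    ← lintegral_add_left ((measurable_discount s n).indicator hpos),
    ← lintegral_add_right _ ((measurable_discount s n).indicator hzero)]
  refine lintegral_congr fun x => ?_
  rcases lt_trichotomy (partialSum x n) 0 with hx | hx | hx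
  · simp [hx, hx.not_gt, hx.ne]
  · simp [hx]
  · simp [hx, hx.not_gt, hx.ne']

lemma tsum_ladderTerm_one_eq_discount (s : ℝ) {x : ℕ → ℝ} {m : ℕ}
    (h : IsLadder x m ∧ rank x m = 1) : ∑' n, ladderTerm s 1 n x = discount s m x := by
  have h0 : ∀ m' ≠ m, ladderTerm s 1 m' x = 0 := fun m' hne => if_neg fun h' =>
    hne (eq_of_rank_eq_one h'.1 h.1 h'.2 h.2)
  rw [tsum_eq_single m h0, ladderTerm, if_pos h]

lemma tsum_ladderTerm_one_le {s : ℝ} (hs : 0 ≤ s) (x : ℕ → ℝ) :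
    ∑' n, ladderTerm s 1 n x ≤ discount s 1 x := by
  by_cases hex : ∃ m, IsLadder x m ∧ rank x m = 1
  · obtain ⟨m, hm, hm1⟩ := hex
    rw [tsum_ladderTerm_one_eq_discount s ⟨hm, hm1⟩]
    have h0 : m ≠ 0 := by rintro rfl; simp [rank] at hm1
    refine ENNReal.ofReal_le_ofReal
      (Real.exp_le_exp.2 (neg_le_neg (mul_le_mul_of_nonneg_left ?_ hs)))
    exact Finset.sum_le_sum_of_subset_of_nonneg (Finset.range_subset_range.2 (by omega))
      fun _ _ _ => abs_nonneg _
  · push Not at hex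
    have h1 : ∀ m, ladderTerm s 1 m x = 0 := fun m => if_neg fun h => hex m h.1 h.2
    simp [h1]

/-- For a symmetric step law, the transform of the length at the first ladder epoch is explicit up
to the contribution of the returns to `0`. -/
lemma one_sub_ladderTransform (hsymm : μ.map (fun x => -x) = μ) {s : ℝ} (hs : 0 ≤ s)
    (hpos : 0 < absExponent μ s) :
    1 - (ladderTransform μ s 1).toReal
      = √(absExponent μ s) * Real.exp (1 / 2 * ∑' n : ℕ,
        (∫⁻ x in {x | partialSum x (n + 1) = 0}, discount s (n + 1) x ∂stepLaw μ).toReal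
          / (n + 1)) := by
  set q := ENNReal.ofReal (1 - absExponent μ s) with hqdef
  set χ := ladderTransform μ s 1 with hχ
  set z : ℕ → ℝ≥0∞ := fun n =>
    ∫⁻ x in {x | partialSum x (n + 1) = 0}, discount s (n + 1) x ∂stepLaw μ with hz
  have hle1 : absExponent μ s ≤ 1 := by
    have h1 := integral_exp_neg_abs μ hs
    have h2 : 0 ≤ ∫ x, Real.exp (-(s * |x|)) ∂μ := integral_nonneg fun _ => Real.exp_nonneg _
    linarith
  have hq1 : q < 1 := by
    rw [← ENNReal.ofReal_one]
    exact (ENNReal.ofReal_lt_ofReal_iff one_pos).2 (by linarith)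
  have hqr : 1 - q.toReal = absExponent μ s := by
    rw [hqdef, ENNReal.toReal_ofReal (by linarith)]; ring
  have hχq : χ ≤ q := by
    rw [← pow_one q, ← lintegral_discount μ hs 1]
    exact lintegral_mono fun x => tsum_ladderTerm_one_le hs x
  have hχ1 : χ < 1 := hχq.trans_lt hq1
  have hχr : χ.toReal < 1 := by
    rw [← ENNReal.toReal_one]
    exact (ENNReal.toReal_lt_toReal (ne_top_of_lt hχ1) ENNReal.one_ne_top).2 hχ1
  have hsum := tsum_lintegral_discount_pos μ s
  rw [tsum_inv_mul_pow_succ hχ1] at hsum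
  have hkey : 2 * ENNReal.ofReal (-Real.log (1 - χ.toReal))
      + ∑' n : ℕ, ((n + 1 : ℕ) : ℝ≥0∞)⁻¹ * z n = ENNReal.ofReal (-Real.log (1 - q.toReal)) := by
    rw [← hsum, ← tsum_inv_mul_pow_succ hq1, ← ENNReal.tsum_mul_left, ← ENNReal.tsum_add]
    refine tsum_congr fun n => ?_
    rw [hqdef, ← two_mul_lintegral_discount_pos μ hsymm hs]
    ring
  have hne : ∑' n : ℕ, ((n + 1 : ℕ) : ℝ≥0∞)⁻¹ * z n ≠ ∞ := fun h => by
    rw [h, add_top] at hkey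
    exact ENNReal.ofReal_ne_top hkey.symm
  have hreal := congrArg ENNReal.toReal hkey
  have hlog : 0 ≤ -Real.log (1 - χ.toReal) := by
    have := Real.log_nonpos (x := 1 - χ.toReal) (by linarith)
      (by linarith [ENNReal.toReal_nonneg (a := χ)])
    linarith
  have hlogq : 0 ≤ -Real.log (1 - q.toReal) := by
    rw [hqr]
    linarith [Real.log_nonpos hpos.le hle1]
  rw [ENNReal.toReal_add (ENNReal.mul_ne_top (by simp) ENNReal.ofReal_ne_top) hne,
    ENNReal.toReal_mul, ENNReal.toReal_ofReal hlog, ENNReal.toReal_ofReal hlogq, hqr,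
    ENNReal.tsum_toReal_eq fun n => ENNReal.ne_top_of_tsum_ne_top hne n] at hreal
  have hz' : ∑' n : ℕ, (((n + 1 : ℕ) : ℝ≥0∞)⁻¹ * z n).toReal
      = ∑' n : ℕ, (z n).toReal / (n + 1) := by
    refine tsum_congr fun n => ?_
    rw [ENNReal.toReal_mul, ENNReal.toReal_inv, ENNReal.toReal_natCast, div_eq_inv_mul]
    push_cast
    rfl
  rw [hz'] at hreal
  have h0 : (0 : ℝ) < 1 - χ.toReal := by linarith
  rw [Real.sqrt_eq_rpow, Real.rpow_def_of_pos hpos, ← Real.exp_add, ← Real.exp_log h0]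
  congr 1
  simp only [ENNReal.toReal_ofNat] at hreal
  linarith

/-! ### Transfer to the first ladder length -/

/-- The coordinate process on sequences. -/
def coord (k : ℕ) (x : ℕ → ℝ) : ℝ := x k

lemma walk_eq_partialSum {Ω : Type*} (ξ : ℕ → Ω → ℝ) (n : ℕ) (ω : Ω) :
    walk ξ n ω = partialSum (fun k => ξ k ω) n := rfl

lemma walkLength_eq_variationSum {Ω : Type*} (ξ : ℕ → Ω → ℝ) (n : ℕ) (ω : Ω) :
    walkLength ξ n ω = variationSum (fun k => ξ k ω) n := by
  unfold walkLength variationSum walk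
  exact Finset.sum_congr rfl fun k _ => by rw [Finset.sum_range_succ, add_sub_cancel_left]

lemma ladderLength_eq_coord {Ω : Type*} (ξ : ℕ → Ω → ℝ) (ω : Ω) :
    ladderLength ξ ω = ladderLength coord (fun k => ξ k ω) := by
  simp only [ladderLength, walkLength_eq_variationSum, ladderTime, walk_eq_partialSum]
  rfl

/-- The first ladder epoch is the first entrance of the walk into `(0, ∞)`. -/
lemma isLadder_rank_one_iff (x : ℕ → ℝ) (n : ℕ) :
    (IsLadder x n ∧ rank x n = 1) ↔
      (0 < n ∧ 0 < partialSum x n) ∧ ∀ k < n, ¬ (0 < k ∧ 0 < partialSum x k) := by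
  classical
  constructor
  · rintro ⟨h1, h2⟩
    have hn : 0 < n := by
      rcases Nat.eq_zero_or_pos n with rfl | h
      · simp [rank] at h2
      · exact h
    refine ⟨⟨hn, by simpa using h1 0 hn⟩, fun k hk hk' => ?_⟩
    have hex : ∃ k, 0 < k ∧ 0 < partialSum x k := ⟨k, hk'⟩
    have hf := Nat.find_spec hex
    have hle : Nat.find hex ≤ k := Nat.find_min' hex hk'
    have hlad : IsLadder x (Nat.find hex) := by
      intro i hi
      rcases Nat.eq_zero_or_pos i with rfl | hi0
      · simpa using hf.2
      · have := Nat.find_min hex hi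
        push Not at this
        exact (this hi0).trans_lt hf.2
    have hr := rank_pos hf.1 hlad
    have hadd := rank_add hlad (n - Nat.find hex)
    have hne : Nat.find hex + (n - Nat.find hex) = n := by omega
    have hr' := rank_pos (x := shift (Nat.find hex) x) (n := n - Nat.find hex) (by omega)
      ((isLadder_add_iff hlad _).1 (by rwa [hne]))
    rw [hne] at hadd
    omega
  · rintro ⟨⟨h1, h2⟩, h3⟩
    have hlad : IsLadder x n := by
      intro i hi
      rcases Nat.eq_zero_or_pos i with rfl | hi0
      · simpa using h2
      · have := h3 i hi
        push Not at this
        exact (this hi0).trans_lt h2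
    refine ⟨hlad, ?_⟩
    obtain ⟨m, hm, hl, hr⟩ := exists_rank_eq_one (rank_pos h1 hlad)
    rcases hm.eq_or_lt with rfl | hlt
    · exact hr
    · have h0 : 0 < m := by
        rcases Nat.eq_zero_or_pos m with rfl | h
        · simp [rank] at hr
        · exact h
      exact absurd ⟨h0, by simpa using hl 0 h0⟩ (h3 m hlt)

open scoped Classical in
/-- At most one term of the series is nonzero, the one at the first ladder time. -/
lemma tsum_ladderTerm_one (s : ℝ) (x : ℕ → ℝ) :
    ∑' n, ladderTerm s 1 n x = if ∃ n, 0 < n ∧ 0 < partialSum x n then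
      ENNReal.ofReal (Real.exp (-(s * ladderLength coord x))) else 0 := by
  split_ifs with hex
  · have hT : ladderTime coord x = Nat.find hex :=
      le_antisymm (Nat.sInf_le (Nat.find_spec hex))
        (Nat.find_min' hex (Nat.sInf_mem (s := {n | 0 < n ∧ 0 < partialSum x n}) hex))
    have h1 := (isLadder_rank_one_iff x (Nat.find hex)).2
      ⟨Nat.find_spec hex, fun k hk => Nat.find_min hex hk⟩
    rw [tsum_ladderTerm_one_eq_discount s h1, ladderLength, hT,
      walkLength_eq_variationSum]
    rfl
  · have h1 : ∀ m, ladderTerm s 1 m x = 0 := fun m => if_neg fun h =>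
      hex ⟨m, ((isLadder_rank_one_iff x m).1 h).1⟩
    simp [h1]

lemma measurable_ladderLength_coord : Measurable (ladderLength coord) := by
  have hT : Measurable (ladderTime coord) := by
    have hset : ∀ n, MeasurableSet {x : ℕ → ℝ | 0 < n ∧ 0 < partialSum x n} := fun n =>
      (MeasurableSet.const _).inter (measurableSet_lt measurable_const (measurable_partialSum n))
    have hpos : ∀ n, 0 < n → MeasurableSet (ladderTime coord ⁻¹' {n}) := by
      intro n hn
      have : ladderTime coord ⁻¹' {n} = {x : ℕ → ℝ | 0 < n ∧ 0 < partialSum x n} ∩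
          ⋂ k ∈ Finset.range n, {x : ℕ → ℝ | 0 < k ∧ 0 < partialSum x k}ᶜ := by
        ext x
        simp only [Set.mem_preimage, Set.mem_singleton_iff, Set.mem_inter_iff, Set.mem_ofPred_eq,
          Set.mem_iInter, Finset.mem_range, Set.mem_compl_iff]
        constructor
        · intro h
          have hne : {n : ℕ | 0 < n ∧ 0 < partialSum x n}.Nonempty := by
            by_contra hc
            rw [Set.not_nonempty_iff_eq_empty] at hc
            have : ladderTime coord x = 0 := by
              change sInf {n : ℕ | 0 < n ∧ 0 < partialSum x n} = 0
              rw [hc, Nat.sInf_empty]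
            omega
          have h' : sInf {n : ℕ | 0 < n ∧ 0 < partialSum x n} = n := h
          refine ⟨?_, fun k hk => ?_⟩
          · have := Nat.sInf_mem hne
            rwa [h'] at this
          · exact Nat.notMem_of_lt_sInf (h'.symm ▸ hk)
        · rintro ⟨h1, h2⟩
          refine le_antisymm (Nat.sInf_le h1) ?_
          by_contra hc
          push Not at hc
          exact h2 _ hc (Nat.sInf_mem (s := {n | 0 < n ∧ 0 < partialSum x n}) ⟨n, h1⟩)
      rw [this]
      exact (hset n).inter (Finset.measurableSet_biInter _ fun k _ => (hset k).compl)
    refine measurable_to_countable' fun n => ?_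
    rcases Nat.eq_zero_or_pos n with rfl | hn
    · have : ladderTime coord ⁻¹' {0} = (⋃ n ∈ {n : ℕ | 0 < n}, ladderTime coord ⁻¹' {n})ᶜ := by
        ext x
        simp [Nat.pos_iff_ne_zero]
        exact ⟨fun h i hi => by omega, fun h => by_contra fun hc => h _ hc rfl⟩
      rw [this]
      exact (MeasurableSet.biUnion (Set.to_countable _) hpos).compl
    · exact hpos n hn
  have h : Measurable fun p : (ℕ → ℝ) × ℕ => variationSum p.1 p.2 :=
    measurable_from_prod_countable_left fun n => measurable_variationSum n
  have : ladderLength coord = (fun p : (ℕ → ℝ) × ℕ => variationSum p.1 p.2) ∘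
      fun x => (x, ladderTime coord x) := by
    ext x
    simp [ladderLength, walkLength_eq_variationSum, coord]
  rw [this]
  exact h.comp (measurable_id.prodMk hT)

end

/-! ### The Laplace transform of the ladder length -/

/-- The function `s ↦ E (1 - exp (-s X))` for `X` with law `ν`. -/
noncomputable def laplaceExponent (ν : Measure ℝ) (s : ℝ) : ℝ :=
  ∫ x, (1 - Real.exp (-(s * x))) ∂ν

lemma variationSum_nonneg (x : ℕ → ℝ) (n : ℕ) : 0 ≤ variationSum x n :=
  Finset.sum_nonneg fun _ _ => abs_nonneg _

/-- The discounted return probability `E (exp (-s L n); S n = 0)`. -/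
noncomputable def discountedReturn (μ : Measure ℝ) (s : ℝ) (n : ℕ) : ℝ :=
  (∫⁻ x in {x | partialSum x n = 0}, discount s n x ∂stepLaw μ).toReal

lemma discountedReturn_eq (μ : Measure ℝ) (s : ℝ) (n : ℕ) :
    discountedReturn μ s n
      = ∫ x in {x | partialSum x n = 0}, Real.exp (-(s * variationSum x n)) ∂stepLaw μ := by
  rw [integral_eq_lintegral_of_nonneg_ae (ae_of_all _ fun _ => Real.exp_nonneg _)
    (by fun_prop)]
  rfl

/-- The law of the first ladder length. -/
noncomputable def ladderLaw (μ : Measure ℝ) : Measure ℝ := (stepLaw μ).map (ladderLength coord)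

lemma ladderLaw_Iio (μ : Measure ℝ) : ladderLaw μ (Set.Iio 0) = 0 := by
  rw [ladderLaw, Measure.map_apply measurable_ladderLength_coord measurableSet_Iio]
  convert! measure_empty (μ := stepLaw μ)
  ext x
  simp only [Set.mem_preimage, Set.mem_Iio, Set.mem_empty_iff_false, iff_false, not_lt]
  rw [ladderLength, walkLength_eq_variationSum]
  exact variationSum_nonneg _ _

section

variable (μ : Measure ℝ) [IsProbabilityMeasure μ]

lemma tendsto_absExponent_zero : Tendsto (absExponent μ) (𝓝[>] 0) (𝓝 0) := by
  have h : Tendsto (absExponent μ) (𝓝[>] 0) (𝓝 (∫ _, (0 : ℝ) ∂μ)) := by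
    refine tendsto_integral_filter_of_dominated_convergence (fun _ => 1) ?_ ?_
      (integrable_const _) ?_
    · exact Eventually.of_forall fun s => by fun_prop
    · filter_upwards [self_mem_nhdsWithin] with s hs
      refine ae_of_all _ fun x => ?_
      have := one_sub_exp_mem (a := s * |x|) (mul_nonneg (le_of_lt hs) (abs_nonneg x))
      rw [Real.norm_of_nonneg this.1]
      exact this.2
    · refine ae_of_all _ fun x => ?_
      have : Tendsto (fun s : ℝ => 1 - Real.exp (-(s * |x|))) (𝓝 0)
          (𝓝 (1 - Real.exp (-(0 * |x|)))) := by
        apply Continuous.tendsto; fun_prop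
      simpa using this.mono_left nhdsWithin_le_nhds
  simpa using h

lemma norm_exp_neg_variationSum_le {s : ℝ} (hs : 0 ≤ s) (x : ℕ → ℝ) (n : ℕ) :
    ‖Real.exp (-(s * variationSum x n))‖ ≤ 1 := by
  rw [Real.norm_of_nonneg (Real.exp_nonneg _)]
  exact Real.exp_le_one_iff.2 (neg_nonpos.2 (mul_nonneg hs (variationSum_nonneg x n)))

lemma abs_discountedReturn_le {s : ℝ} (hs : 0 ≤ s) (n : ℕ) :
    ‖discountedReturn μ s n‖ ≤ (stepLaw μ).real {x | partialSum x n = 0} := by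
  rw [discountedReturn_eq]
  refine (norm_setIntegral_le_of_norm_le_const (C := 1) (measure_lt_top _ _)
    fun x _ => norm_exp_neg_variationSum_le hs x n).trans_eq ?_
  rw [one_mul]

lemma tendsto_discountedReturn (n : ℕ) :
    Tendsto (fun s => discountedReturn μ s n) (𝓝[>] 0)
      (𝓝 ((stepLaw μ).real {x | partialSum x n = 0})) := by
  simp_rw [discountedReturn_eq]
  have h : (stepLaw μ).real {x | partialSum x n = 0}
      = ∫ x in {x | partialSum x n = 0}, (1 : ℝ) ∂stepLaw μ := by
    simp [Measure.real]
  rw [h]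
  refine tendsto_integral_filter_of_dominated_convergence (fun _ => 1) ?_ ?_
    (integrable_const _) ?_
  · exact Eventually.of_forall fun s => by fun_prop
  · filter_upwards [self_mem_nhdsWithin] with s hs
    exact ae_of_all _ fun x => norm_exp_neg_variationSum_le (le_of_lt hs) x n
  · refine ae_of_all _ fun x => ?_
    have : Tendsto (fun s : ℝ => Real.exp (-(s * variationSum x n))) (𝓝 0)
        (𝓝 (Real.exp (-(0 * variationSum x n)))) := by
      apply Continuous.tendsto; fun_prop
    simpa using this.mono_left nhdsWithin_le_nhds

/-- The constant `Φ (1, 0)` of the walk with step law `μ`. -/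
noncomputable def returnFactor : ℝ :=
  Real.exp (1 / 2 * ∑' n : ℕ, (stepLaw μ).real {x | partialSum x (n + 1) = 0} / (n + 1))

variable {μ}

/-- As the discount rate tends to `0`, the discounted return series tends to the return series, by
dominated convergence. -/
lemma tendsto_one_sub_ladderTransform_div (hsymm : μ.map (fun x => -x) = μ)
    (hpos : ∀ s, 0 < s → 0 < absExponent μ s)
    (hsum : Summable fun n : ℕ => (stepLaw μ).real {x | partialSum x (n + 1) = 0} / ((n : ℝ) + 1)) :
    Tendsto (fun s => (1 - (ladderTransform μ s 1).toReal) / √(absExponent μ s)) (𝓝[>] 0)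
      (𝓝 (returnFactor μ)) := by
  have h : Tendsto (fun s => ∑' n : ℕ, discountedReturn μ s (n + 1) / ((n : ℝ) + 1)) (𝓝[>] 0)
      (𝓝 (∑' n : ℕ, (stepLaw μ).real {x | partialSum x (n + 1) = 0} / ((n : ℝ) + 1))) := by
    refine tendsto_tsum_of_dominated_convergence hsum
      (fun n => (tendsto_discountedReturn μ (n + 1)).div_const _) ?_
    filter_upwards [self_mem_nhdsWithin] with s hs n
    rw [norm_div, Real.norm_of_nonneg (by positivity : (0 : ℝ) ≤ (n : ℝ) + 1)]
    exact div_le_div_of_nonneg_right (abs_discountedReturn_le μ (le_of_lt hs) _) (by positivity)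
  refine ((Real.continuous_exp.tendsto _).comp (h.const_mul (1 / 2))).congr' ?_
  filter_upwards [self_mem_nhdsWithin] with s hs
  rw [one_sub_ladderTransform μ hsymm (le_of_lt hs) (hpos s hs),
    mul_div_cancel_left₀ _ (Real.sqrt_pos.2 (hpos s hs)).ne']
  rfl

/-- The defect `1 - E (exp (-s L_T); T < ∞)` is of order `√(w s)` with `w s → 0`, so `P (T < ∞) = 1`.
This needs no appeal to the oscillation of symmetric walks. -/
lemma ae_exists_partialSum_pos (hsymm : μ.map (fun x => -x) = μ)
    (hpos : ∀ s, 0 < s → 0 < absExponent μ s)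
    (hsum : Summable fun n : ℕ => (stepLaw μ).real {x | partialSum x (n + 1) = 0} / ((n : ℝ) + 1)) :
    ∀ᵐ x ∂stepLaw μ, ∃ n, 0 < n ∧ 0 < partialSum x n := by
  classical
  set A : Set (ℕ → ℝ) := {x | ∃ n, 0 < n ∧ 0 < partialSum x n} with hA
  have hAm : MeasurableSet A := by
    have : A = ⋃ n, {x : ℕ → ℝ | 0 < n ∧ 0 < partialSum x n} := by ext x; simp [hA]
    rw [this]
    exact MeasurableSet.iUnion fun n =>
      (MeasurableSet.const _).inter (measurableSet_lt measurable_const (measurable_partialSum n))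
  -- the transform is at most the probability of `A`, and it tends to `1`
  have hle : ∀ s, 0 < s → (ladderTransform μ s 1).toReal ≤ (stepLaw μ).real A := by
    intro s hs
    refine ENNReal.toReal_mono (measure_ne_top _ _) ?_
    rw [← lintegral_indicator_one hAm, ladderTransform]
    refine lintegral_mono fun x => ?_
    simp only [tsum_ladderTerm_one]
    by_cases hx : ∃ n, 0 < n ∧ 0 < partialSum x n
    · rw [if_pos hx, Set.indicator_of_mem (show x ∈ A from hx), Pi.one_apply, ← ENNReal.ofReal_one]
      refine ENNReal.ofReal_le_ofReal (Real.exp_le_one_iff.2 (neg_nonpos.2 (mul_nonneg hs.le ?_)))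
      rw [ladderLength, walkLength_eq_variationSum]
      exact variationSum_nonneg _ _
    · simp [hx]
  have hlim : Tendsto (fun s => (ladderTransform μ s 1).toReal) (𝓝[>] 0) (𝓝 1) := by
    have h1 := (tendsto_one_sub_ladderTransform_div hsymm hpos hsum).mul
      ((Real.continuous_sqrt.tendsto _).comp (tendsto_absExponent_zero μ))
    rw [Real.sqrt_zero, mul_zero] at h1
    have h2 : Tendsto (fun s => 1 - (ladderTransform μ s 1).toReal) (𝓝[>] 0) (𝓝 0) := by
      refine h1.congr' ?_
      filter_upwards [self_mem_nhdsWithin] with s hs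
      simp only [Function.comp_apply]
      rw [div_mul_cancel₀ _ (Real.sqrt_pos.2 (hpos s hs)).ne']
    simpa using h2.const_sub 1
  have h1 : 1 ≤ (stepLaw μ).real A := by
    refine le_of_tendsto hlim ?_
    filter_upwards [self_mem_nhdsWithin] with s hs using hle s hs
  have h2 : stepLaw μ A = 1 := by
    refine le_antisymm prob_le_one ?_
    rw [← ENNReal.ofReal_one, ← ENNReal.ofReal_toReal (measure_ne_top (stepLaw μ) A)]
    exact ENNReal.ofReal_le_ofReal h1
  exact (prob_compl_eq_zero_iff hAm).2 h2

instance : IsProbabilityMeasure (ladderLaw μ) :=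
  Measure.isProbabilityMeasure_map measurable_ladderLength_coord.aemeasurable

lemma laplaceExponent_ladderLaw (hladder : ∀ᵐ x ∂stepLaw μ, ∃ n, 0 < n ∧ 0 < partialSum x n)
    {s : ℝ} (hs : 0 ≤ s) :
    laplaceExponent (ladderLaw μ) s = 1 - (ladderTransform μ s 1).toReal := by
  have hnn : ∀ x, 0 ≤ ladderLength coord x := fun x => by
    rw [ladderLength, walkLength_eq_variationSum]
    exact variationSum_nonneg _ _
  have hm := measurable_ladderLength_coord
  have hint : Integrable (fun x => Real.exp (-(s * ladderLength coord x))) (stepLaw μ) := by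
    refine Integrable.of_bound (by fun_prop) 1 (ae_of_all _ fun x => ?_)
    rw [Real.norm_of_nonneg (Real.exp_nonneg _)]
    exact Real.exp_le_one_iff.2 (neg_nonpos.2 (mul_nonneg hs (hnn x)))
  rw [laplaceExponent, ladderLaw, integral_map hm.aemeasurable (by fun_prop),
    integral_sub (integrable_const _) hint,
    integral_eq_lintegral_of_nonneg_ae (ae_of_all _ fun _ => Real.exp_nonneg _) (by fun_prop),
    ladderTransform]
  have : ∫⁻ x, ∑' n, ladderTerm s 1 n x ∂stepLaw μ
      = ∫⁻ x, ENNReal.ofReal (Real.exp (-(s * ladderLength coord x))) ∂stepLaw μ := by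
    refine lintegral_congr_ae ?_
    filter_upwards [hladder] with x hx
    rw [tsum_ladderTerm_one, if_pos hx]
  rw [this]
  simp

/-- The Laplace exponent of the first ladder length is asymptotic to the square root of the
exponent of `|ξ|`, up to the factor `Φ (1, 0)`. -/
lemma tendsto_laplaceExponent_ladderLaw_div (hsymm : μ.map (fun x => -x) = μ)
    (hpos : ∀ s, 0 < s → 0 < absExponent μ s)
    (hsum : Summable fun n : ℕ => (stepLaw μ).real {x | partialSum x (n + 1) = 0} / ((n : ℝ) + 1)) :
    Tendsto (fun s => laplaceExponent (ladderLaw μ) s / √(absExponent μ s)) (𝓝[>] 0)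
      (𝓝 (returnFactor μ)) := by
  refine (tendsto_one_sub_ladderTransform_div hsymm hpos hsum).congr' ?_
  filter_upwards [self_mem_nhdsWithin] with s hs
  rw [laplaceExponent_ladderLaw (ae_exists_partialSum_pos hsymm hpos hsum) (le_of_lt hs)]

end

/-! ### Characteristic functions of symmetric laws -/

/-- The function `t ↦ E (1 - cos (t X))` for `X` with law `μ`. -/
noncomputable def cosExponent (μ : Measure ℝ) (t : ℝ) : ℝ := ∫ x, (1 - Real.cos (t * x)) ∂μ

@[simp] lemma cosExponent_zero (μ : Measure ℝ) : cosExponent μ 0 = 0 := by simp [cosExponent]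

lemma cosExponent_nonneg (μ : Measure ℝ) (t : ℝ) : 0 ≤ cosExponent μ t :=
  integral_nonneg fun x => by simpa using Real.cos_le_one (t * x)

/-- The law of the `n`-th partial sum. -/
noncomputable def sumLaw (μ : Measure ℝ) (n : ℕ) : Measure ℝ :=
  (stepLaw μ).map fun x => partialSum x n

lemma sumLaw_real_zero (μ : Measure ℝ) (n : ℕ) :
    (sumLaw μ n).real {0} = (stepLaw μ).real {x | partialSum x n = 0} := by
  rw [sumLaw, map_measureReal_apply (measurable_partialSum n) (measurableSet_singleton 0)]
  rfl

section

variable (μ : Measure ℝ) [IsProbabilityMeasure μ]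

lemma integrable_cos_mul (t : ℝ) : Integrable (fun x => Real.cos (t * x)) μ :=
  Integrable.of_bound (by fun_prop) 1 (ae_of_all _ fun x => Real.abs_cos_le_one _)

lemma integral_cos_mul (t : ℝ) : ∫ x, Real.cos (t * x) ∂μ = 1 - cosExponent μ t := by
  rw [cosExponent, integral_sub (integrable_const _) (integrable_cos_mul μ t)]
  simp

lemma charFun_re (t : ℝ) : (charFun μ t).re = 1 - cosExponent μ t := by
  rw [← integral_cos_mul, charFun_apply_real]
  have hint : Integrable (fun x : ℝ => Complex.exp (t * x * Complex.I)) μ := by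
    refine Integrable.of_bound (by fun_prop) 1 (ae_of_all _ fun x => ?_)
    rw [← Complex.ofReal_mul, Complex.norm_exp_ofReal_mul_I]
  rw [← RCLike.re_eq_complex_re, ← integral_re hint]
  refine integral_congr_ae (ae_of_all _ fun x => ?_)
  simp only [RCLike.re_eq_complex_re]
  rw [← Complex.ofReal_mul, Complex.exp_ofReal_mul_I_re]

lemma continuous_cosExponent : Continuous (cosExponent μ) := by
  have h : cosExponent μ = fun t => 1 - (charFun μ t).re := by
    ext t; rw [charFun_re]; ring
  rw [h]
  exact continuous_const.sub (Complex.continuous_re.comp continuous_charFun)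

lemma cosExponent_le_two (t : ℝ) : cosExponent μ t ≤ 2 := by
  have h := (charFun μ t).abs_re_le_norm.trans (norm_charFun_le_one t)
  rw [charFun_re, abs_le] at h
  linarith

lemma abs_one_sub_cosExponent_le_one (t : ℝ) : |1 - cosExponent μ t| ≤ 1 :=
  abs_le.2 ⟨by linarith [cosExponent_le_two μ t], by linarith [cosExponent_nonneg μ t]⟩

variable {μ}

lemma charFun_eq_of_symm (hsymm : μ.map (fun x => -x) = μ) (t : ℝ) :
    charFun μ t = ((1 - cosExponent μ t : ℝ) : ℂ) := by
  have h1 : charFun μ (-t) = charFun μ t := by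
    conv_rhs => rw [← hsymm]
    have := charFun_map_mul (μ := μ) (-1) t
    simp only [neg_mul, one_mul] at this
    exact this.symm
  rw [charFun_neg, Complex.conj_eq_iff_re] at h1
  rw [← h1, charFun_re]

lemma absExponent_pos (hnd : ¬ ∀ᵐ x ∂μ, x = 0) {s : ℝ} (hs : 0 < s) : 0 < absExponent μ s := by
  have hnn : ∀ x : ℝ, 0 ≤ 1 - Real.exp (-(s * |x|)) := fun x =>
    (one_sub_exp_mem (mul_nonneg hs.le (abs_nonneg x))).1
  have hint : Integrable (fun x => 1 - Real.exp (-(s * |x|))) μ :=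
    (integrable_const _).sub (integrable_exp_neg_abs μ hs.le)
  refine lt_of_le_of_ne (integral_nonneg hnn) fun h => hnd ?_
  have h0 := (integral_eq_zero_iff_of_nonneg hnn hint).1 h.symm
  filter_upwards [h0] with x hx
  have h1 : Real.exp (-(s * |x|)) = 1 := by simp only [Pi.zero_apply] at hx; linarith
  rw [Real.exp_eq_one_iff] at h1
  simpa [hs.ne'] using h1

/-- Near `0`, a nondegenerate law has a quadratically growing exponent. -/
lemma exists_mul_sq_le_cosExponent (hnd : ¬ ∀ᵐ x ∂μ, x = 0) :
    ∃ c > 0, ∃ δ > 0, ∀ t, 0 ≤ t → t ≤ δ → c * t ^ 2 ≤ cosExponent μ t := by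
  have hM : ∃ M : ℕ, 0 < ∫ x in {x | |x| ≤ M}, x ^ 2 ∂μ := by
    by_contra hcon
    push Not at hcon
    refine hnd ?_
    have h1 : ∀ M : ℕ, ∀ᵐ x : ℝ ∂μ, |x| ≤ (M : ℝ) → x = 0 := by
      intro M
      have hms : MeasurableSet {x : ℝ | |x| ≤ M} := measurableSet_le (by fun_prop) (by fun_prop)
      have hint : IntegrableOn (fun x : ℝ => x ^ 2) {x | |x| ≤ M} μ := by
        refine Integrable.of_bound (by fun_prop) ((M : ℝ) ^ 2) ?_
        filter_upwards [ae_restrict_mem hms] with x hx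
        rw [norm_pow, Real.norm_eq_abs]
        exact pow_le_pow_left₀ (abs_nonneg x) hx 2
      have h0 : ∫ x in {x | |x| ≤ M}, x ^ 2 ∂μ = 0 :=
        le_antisymm (hcon M) (integral_nonneg fun x => sq_nonneg x)
      have := (integral_eq_zero_iff_of_nonneg (fun x => sq_nonneg x) hint).1 h0
      rw [EventuallyEq, ae_restrict_iff' hms] at this
      filter_upwards [this] with x hx hxM
      simpa using hx hxM
    filter_upwards [ae_all_iff.2 h1] with x hx
    obtain ⟨M, hM⟩ := exists_nat_ge |x|
    exact hx M hM
  obtain ⟨M, hM⟩ := hM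
  have hM0 : (0 : ℝ) < M + 1 := by positivity
  refine ⟨2 / Real.pi ^ 2 * ∫ x in {x | |x| ≤ M}, x ^ 2 ∂μ, by positivity, 1 / (M + 1),
    by positivity, fun t ht htd => ?_⟩
  have hms : MeasurableSet {x : ℝ | |x| ≤ M} := measurableSet_le (by fun_prop) (by fun_prop)
  have hint : Integrable (fun x => 1 - Real.cos (t * x)) μ :=
    (integrable_const _).sub (integrable_cos_mul μ t)
  calc 2 / Real.pi ^ 2 * (∫ x in {x | |x| ≤ M}, x ^ 2 ∂μ) * t ^ 2
      = ∫ x in {x | |x| ≤ M}, 2 / Real.pi ^ 2 * (t * x) ^ 2 ∂μ := by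
        rw [← integral_const_mul, ← integral_mul_const]
        congr 1 with x
        ring
    _ ≤ ∫ x in {x | |x| ≤ M}, (1 - Real.cos (t * x)) ∂μ := by
        refine setIntegral_mono_on ?_ hint.integrableOn hms fun x hx => ?_
        · refine Integrable.of_bound (by fun_prop) (2 / Real.pi ^ 2 * (t * M) ^ 2) ?_
          filter_upwards [ae_restrict_mem hms] with x hx
          rw [Real.norm_of_nonneg (by positivity), ← sq_abs (t * x), abs_mul, abs_of_nonneg ht]
          have : |x| ≤ M := hx
          gcongr
        · have h1 : |t * x| ≤ Real.pi := by
            rw [abs_mul, abs_of_nonneg ht]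
            have hx' : |x| ≤ M := hx
            have : t * |x| ≤ 1 := by
              calc t * |x| ≤ 1 / (M + 1) * (M + 1) :=
                    mul_le_mul htd (by linarith) (abs_nonneg x) (by positivity)
                _ = 1 := by field_simp
            linarith [Real.pi_gt_three]
          have := Real.cos_le_one_sub_mul_cos_sq h1
          linarith
    _ ≤ ∫ x, (1 - Real.cos (t * x)) ∂μ := setIntegral_le_integral hint
        (ae_of_all _ fun x => by simpa using Real.cos_le_one (t * x))

/-! ### Return probabilities -/

lemma integral_intervalIntegral_cos (ρ : Measure ℝ) [IsProbabilityMeasure ρ] {b : ℝ} (hb : 0 ≤ b)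
    {k : ℝ → ℝ} (hk : Continuous k) (hk1 : ∀ t ∈ Set.Ioc 0 b, |k t| ≤ 1) :
    ∫ x, (∫ t in (0 : ℝ)..b, k t * Real.cos (t * x)) ∂ρ
      = ∫ t in (0 : ℝ)..b, k t * ∫ x, Real.cos (t * x) ∂ρ := by
  simp_rw [intervalIntegral.integral_of_le hb, ← integral_const_mul]
  rw [integral_integral_swap]
  refine Integrable.of_bound (by fun_prop) 1 ?_
  have h1 : ∀ᵐ p ∂ρ.prod (volume.restrict (Set.Ioc 0 b)), p.2 ∈ Set.Ioc 0 b := by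
    have := Measure.quasiMeasurePreserving_snd (μ := ρ) (ν := volume.restrict (Set.Ioc 0 b))
    exact this.ae (ae_restrict_mem measurableSet_Ioc)
  filter_upwards [h1] with p hp
  simp only [Function.uncurry, norm_mul, Real.norm_eq_abs]
  exact mul_le_one₀ (hk1 _ hp) (abs_nonneg _) (Real.abs_cos_le_one _)

lemma intervalIntegral_fejer {δ : ℝ} (hδ : 0 < δ) {x : ℝ} (hx : x ≠ 0) :
    ∫ t in (0 : ℝ)..δ, (1 - t / δ) * Real.cos (t * x) = (1 - Real.cos (δ * x)) / (δ * x ^ 2) := by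
  have hd : ∀ t ∈ Set.uIcc 0 δ, HasDerivAt
      (fun t => (1 - t / δ) * (Real.sin (t * x) / x) - Real.cos (t * x) / (δ * x ^ 2))
      ((1 - t / δ) * Real.cos (t * x)) t := by
    intro t _
    have h1 : HasDerivAt (fun t : ℝ => t * x) x t := by simpa using (hasDerivAt_id t).mul_const x
    have h2 : HasDerivAt (fun t : ℝ => 1 - t / δ) (-(1 / δ)) t := by
      simpa using ((hasDerivAt_id t).div_const δ).const_sub 1
    have h3 := (h2.mul (h1.sin.div_const x)).sub (h1.cos.div_const (δ * x ^ 2))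
    convert! h3 using 1
    field_simp
    ring
  rw [intervalIntegral.integral_eq_sub_of_hasDerivAt hd
    (Continuous.intervalIntegrable (by fun_prop) _ _)]
  field_simp
  simp
  ring

/-- The mass of `0` is controlled by the characteristic function near `0`. -/
lemma measureReal_singleton_zero_le (ρ : Measure ℝ) [IsProbabilityMeasure ρ] {δ : ℝ} (hδ : 0 < δ) :
    ρ.real {0} * (δ / 2) ≤ ∫ t in (0 : ℝ)..δ, |1 - cosExponent ρ t| := by
  have h0 : ∫ t in (0 : ℝ)..δ, (1 - t / δ) * Real.cos (t * 0) = δ / 2 := by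
    simp only [mul_zero, Real.cos_zero, mul_one]
    rw [intervalIntegral.integral_sub (by simp) (Continuous.intervalIntegrable (by fun_prop) _ _),
      intervalIntegral.integral_div]
    simp
    field_simp
    ring
  have hk1 : ∀ t ∈ Set.Ioc 0 δ, |1 - t / δ| ≤ 1 := fun t ht => by
    have h1 : t / δ ≤ 1 := (div_le_one hδ).2 ht.2
    have h2 : 0 < t / δ := div_pos ht.1 hδ
    rw [abs_le]
    constructor <;> linarith
  have hle : ∀ x : ℝ, Set.indicator {0} (fun _ => δ / 2) x
      ≤ ∫ t in (0 : ℝ)..δ, (1 - t / δ) * Real.cos (t * x) := by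
    intro x
    by_cases hx : x = 0
    · subst hx
      simp only [Set.mem_singleton_iff, Set.indicator_of_mem]
      rw [h0]
    · rw [Set.indicator_of_notMem (by simpa using hx), intervalIntegral_fejer hδ hx]
      have := Real.cos_le_one (δ * x)
      positivity [sub_nonneg.2 this]
  have hbound : ∀ x : ℝ, ‖∫ t in (0 : ℝ)..δ, (1 - t / δ) * Real.cos (t * x)‖ ≤ 1 * |δ - 0| := by
    intro x
    refine intervalIntegral.norm_integral_le_of_norm_le_const fun t ht => ?_
    rw [Set.uIoc_of_le hδ.le] at ht
    rw [norm_mul, Real.norm_eq_abs, Real.norm_eq_abs]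
    exact mul_le_one₀ (hk1 t ht) (abs_nonneg _) (Real.abs_cos_le_one _)
  have hcont : Continuous fun x : ℝ => ∫ t in (0 : ℝ)..δ, (1 - t / δ) * Real.cos (t * x) :=
    intervalIntegral.continuous_parametric_intervalIntegral_of_continuous' (by fun_prop) _ _
  calc ρ.real {0} * (δ / 2) = ∫ x, Set.indicator {0} (fun _ => δ / 2) x ∂ρ := by
        rw [integral_indicator_const _ (measurableSet_singleton 0), smul_eq_mul]
    _ ≤ ∫ x, (∫ t in (0 : ℝ)..δ, (1 - t / δ) * Real.cos (t * x)) ∂ρ :=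
        integral_mono ((integrable_const _).indicator (measurableSet_singleton 0))
          (Integrable.of_bound hcont.aestronglyMeasurable _ (ae_of_all _ hbound)) hle
    _ = ∫ t in (0 : ℝ)..δ, (1 - t / δ) * (1 - cosExponent ρ t) := by
        rw [integral_intervalIntegral_cos ρ hδ.le (by fun_prop) hk1]
        simp_rw [integral_cos_mul]
    _ ≤ ∫ t in (0 : ℝ)..δ, |1 - cosExponent ρ t| := by
        have hc := continuous_cosExponent ρ
        refine intervalIntegral.integral_mono_on hδ.le
          (Continuous.intervalIntegrable (by fun_prop) _ _)
          (Continuous.intervalIntegrable (by fun_prop) _ _) fun t ht => ?_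
        have h1 : t / δ ≤ 1 := (div_le_one hδ).2 ht.2
        have h2 : 0 ≤ t / δ := div_nonneg ht.1 hδ.le
        calc (1 - t / δ) * (1 - cosExponent ρ t) ≤ |(1 - t / δ) * (1 - cosExponent ρ t)| :=
              le_abs_self _
          _ = |1 - t / δ| * |1 - cosExponent ρ t| := abs_mul _ _
          _ ≤ 1 * |1 - cosExponent ρ t| := by
              refine mul_le_mul_of_nonneg_right ?_ (abs_nonneg _)
              rw [abs_le]
              constructor <;> linarith
          _ = _ := one_mul _

instance (n : ℕ) : IsProbabilityMeasure (sumLaw μ n) :=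
  Measure.isProbabilityMeasure_map (measurable_partialSum n).aemeasurable

lemma charFun_sumLaw (n : ℕ) (t : ℝ) : charFun (sumLaw μ n) t = charFun μ t ^ n := by
  have hind : iIndepFun (fun (k : ℕ) (x : ℕ → ℝ) => x k) (stepLaw μ) :=
    iIndepFun_infinitePi (P := fun _ : ℕ => μ) (X := fun _ x => x) (fun _ => measurable_id)
  have h := iIndepFun.charFun_map_fun_finsetSum_eq_prod (s := Finset.range n)
    (fun i _ => (measurable_pi_apply i).aemeasurable) (hind.restrict (Finset.range n))
  have hi : ∀ i : ℕ, (stepLaw μ).map (fun x => x i) = μ := fun i =>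
    Measure.infinitePi_map_eval (fun _ : ℕ => μ) i
  simp only [hi, Finset.prod_const, Finset.card_range] at h
  exact congrFun h t

lemma cosExponent_sumLaw (hsymm : μ.map (fun x => -x) = μ) (n : ℕ) (t : ℝ) :
    1 - cosExponent (sumLaw μ n) t = (1 - cosExponent μ t) ^ n := by
  rw [← charFun_re, charFun_sumLaw, charFun_eq_of_symm hsymm, ← Complex.ofReal_pow,
    Complex.ofReal_re]

/-- The concentration bound: near `0` the characteristic function of a nondegenerate law is at most
`1 - c t ^ 2`, and averaging its `n`-th power over a fixed neighbourhood of `0` costs `O(n^(-1/2))`. -/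
lemma exists_return_le (hsymm : μ.map (fun x => -x) = μ) (hnd : ¬ ∀ᵐ x ∂μ, x = 0) :
    ∃ K, ∀ n : ℕ, (stepLaw μ).real {x | partialSum x (n + 1) = 0} ≤ K / √(n + 1) := by
  obtain ⟨c, hc, δ₁, hδ₁, hq⟩ := exists_mul_sq_le_cosExponent hnd
  obtain ⟨δ₂, hδ₂, hone⟩ : ∃ δ₂ > 0, ∀ t, 0 ≤ t → t ≤ δ₂ → cosExponent μ t ≤ 1 := by
    have h := (continuous_cosExponent μ).tendsto 0
    rw [cosExponent_zero] at h
    obtain ⟨ε, hε, h⟩ := Metric.eventually_nhds_iff.1 (h.eventually (eventually_le_nhds one_pos))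
    refine ⟨ε / 2, by positivity, fun t ht htd => h ?_⟩
    rw [Real.dist_eq, sub_zero, abs_of_nonneg ht]
    linarith
  set δ := min δ₁ δ₂ with hδ
  have hδ0 : 0 < δ := lt_min hδ₁ hδ₂
  refine ⟨2 / δ * (√(Real.pi / c) / 2), fun n => ?_⟩
  have hn : (0 : ℝ) < n + 1 := by positivity
  have h1 := measureReal_singleton_zero_le (sumLaw μ (n + 1)) hδ0
  have hgauss : IntegrableOn (fun t : ℝ => Real.exp (-((n + 1) * c) * t ^ 2)) (Set.Ioi 0) :=
    (integrable_exp_neg_mul_sq (by positivity)).integrableOn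
  have h2 : ∫ t in (0 : ℝ)..δ, |1 - cosExponent (sumLaw μ (n + 1)) t|
      ≤ √(Real.pi / ((n + 1) * c)) / 2 := by
    rw [← integral_gaussian_Ioi, intervalIntegral.integral_of_le hδ0.le]
    have hcont := continuous_cosExponent (sumLaw μ (n + 1))
    calc ∫ t in Set.Ioc 0 δ, |1 - cosExponent (sumLaw μ (n + 1)) t|
        ≤ ∫ t in Set.Ioc 0 δ, Real.exp (-((n + 1) * c) * t ^ 2) := by
          refine setIntegral_mono_on ?_ (hgauss.mono_set Set.Ioc_subset_Ioi_self)
            measurableSet_Ioc fun t ht => ?_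
          · exact (Continuous.integrableOn_Icc (by fun_prop)).mono_set Set.Ioc_subset_Icc_self
          · have h3 := hq t ht.1.le (ht.2.trans (min_le_left _ _))
            have h4 := hone t ht.1.le (ht.2.trans (min_le_right _ _))
            rw [cosExponent_sumLaw hsymm, abs_pow, abs_of_nonneg (by linarith)]
            calc (1 - cosExponent μ t) ^ (n + 1) ≤ (Real.exp (-(c * t ^ 2))) ^ (n + 1) := by
                  refine pow_le_pow_left₀ (by linarith) ?_ _
                  linarith [Real.add_one_le_exp (-(c * t ^ 2))]
              _ = _ := by
                  rw [← Real.exp_nat_mul]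
                  push_cast
                  ring_nf
      _ ≤ ∫ t in Set.Ioi 0, Real.exp (-((n + 1) * c) * t ^ 2) :=
          setIntegral_mono_set hgauss (ae_of_all _ fun _ => Real.exp_nonneg _)
            (ae_of_all _ Set.Ioc_subset_Ioi_self)
  rw [sumLaw_real_zero] at h1
  have h3 : √(Real.pi / ((n + 1) * c)) = √(Real.pi / c) / √(n + 1) := by
    rw [← Real.sqrt_div (by positivity), div_div, mul_comm c]
  rw [h3] at h2
  have h4 := h1.trans h2
  rw [← le_div_iff₀ (by positivity)] at h4
  refine h4.trans_eq ?_
  field_simp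

lemma summable_return (hsymm : μ.map (fun x => -x) = μ) (hnd : ¬ ∀ᵐ x ∂μ, x = 0) :
    Summable fun n : ℕ => (stepLaw μ).real {x | partialSum x (n + 1) = 0} / ((n : ℝ) + 1) := by
  obtain ⟨K, hK⟩ := exists_return_le hsymm hnd
  have hs : Summable fun n : ℕ => K * (1 / ((n : ℝ) + 1) ^ (3 / 2 : ℝ)) := by
    refine Summable.mul_left K ?_
    have := (summable_nat_add_iff 1).2 (Real.summable_one_div_nat_rpow.2
      (by norm_num : (1 : ℝ) < 3 / 2))
    simpa using this
  refine Summable.of_nonneg_of_le (fun n => by positivity) (fun n => ?_) hs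
  refine (div_le_div_of_nonneg_right (hK n) (by positivity)).trans_eq ?_
  have hn : (0 : ℝ) < n + 1 := by positivity
  rw [show (3 / 2 : ℝ) = 1 / 2 + 1 by norm_num, Real.rpow_add hn, Real.rpow_one,
    ← Real.sqrt_eq_rpow]
  field_simp

end

section

variable {μ : Measure ℝ} [IsProbabilityMeasure μ]

/-! ### Steps without atoms -/

lemma return_eq_zero_of_noAtoms (hna : ∀ x, μ {x} = 0) (n : ℕ) :
    (stepLaw μ).real {x | partialSum x (n + 1) = 0} = 0 := by
  have hconv : sumLaw μ (n + 1) = sumLaw μ n ∗ μ := by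
    refine Measure.ext_of_charFun (funext fun t => ?_)
    rw [charFun_conv, charFun_sumLaw, charFun_sumLaw, pow_succ]
  rw [← sumLaw_real_zero, hconv, Measure.real, Measure.conv,
    Measure.map_apply (by fun_prop) (measurableSet_singleton 0),
    Measure.prod_apply ((by fun_prop : Measurable fun p : ℝ × ℝ => p.1 + p.2)
      (measurableSet_singleton 0))]
  have : ∀ x : ℝ, μ (Prod.mk x ⁻¹' ((fun p : ℝ × ℝ => p.1 + p.2) ⁻¹' {0})) = 0 := by
    intro x
    convert! hna (-x) using 2
    ext y
    simp only [Set.mem_preimage, Set.mem_singleton_iff]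
    constructor <;> intro h <;> linarith
  simp [this]

/-! ### Integer-valued steps -/

lemma intervalIntegral_cos_int (m : ℤ) :
    ∫ t in (0 : ℝ)..Real.pi, Real.cos (t * m) = Set.indicator {0} (fun _ => Real.pi) (m : ℝ) := by
  by_cases hm : m = 0
  · simp [hm]
  · have hm' : (m : ℝ) ≠ 0 := by exact_mod_cast hm
    rw [Set.indicator_of_notMem (by simpa using hm), intervalIntegral.integral_comp_mul_right _ hm',
      integral_cos, mul_comm Real.pi, Real.sin_int_mul_pi]
    simp

lemma ae_sumLaw_int (hint : ∀ᵐ x : ℝ ∂μ, ∃ m : ℤ, x = m) (n : ℕ) :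
    ∀ᵐ x : ℝ ∂sumLaw μ n, ∃ m : ℤ, x = m := by
  have hms : MeasurableSet {x : ℝ | ∃ m : ℤ, x = m} := by
    have : {x : ℝ | ∃ m : ℤ, x = m} = Set.range ((↑) : ℤ → ℝ) := by
      ext x; simp [eq_comm]
    rw [this]
    exact (Set.countable_range _).measurableSet
  rw [sumLaw, ae_map_iff (measurable_partialSum n).aemeasurable hms]
  have hcoord : ∀ k : ℕ, ∀ᵐ x ∂stepLaw μ, ∃ m : ℤ, x k = (m : ℝ) := by
    intro k
    have hk : (stepLaw μ).map (fun x => x k) = μ := Measure.infinitePi_map_eval (fun _ : ℕ => μ) k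
    rw [← hk, ae_map_iff (measurable_pi_apply (X := fun _ : ℕ => ℝ) k).aemeasurable hms] at hint
    exact hint
  filter_upwards [ae_all_iff.2 hcoord] with x hx
  choose m hm using hx
  exact ⟨∑ k ∈ Finset.range n, m k, by simp [partialSum, hm]⟩

/-- Fourier inversion for the return probabilities of an integer-valued walk. -/
lemma return_eq_integral (hsymm : μ.map (fun x => -x) = μ) (hint : ∀ᵐ x : ℝ ∂μ, ∃ m : ℤ, x = m)
    (n : ℕ) : (stepLaw μ).real {x | partialSum x n = 0} * Real.pi
      = ∫ t in (0 : ℝ)..Real.pi, (1 - cosExponent μ t) ^ n := by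
  have h := integral_intervalIntegral_cos (sumLaw μ n) Real.pi_pos.le (k := fun _ => 1)
    continuous_const (fun _ _ => by simp)
  simp_rw [one_mul, integral_cos_mul, cosExponent_sumLaw hsymm] at h
  rw [← h, ← sumLaw_real_zero, ← smul_eq_mul,
    ← integral_indicator_const _ (measurableSet_singleton 0)]
  refine integral_congr_ae ?_
  filter_upwards [ae_sumLaw_int hint n] with x hx
  obtain ⟨m, rfl⟩ := hx
  exact (intervalIntegral_cos_int m).symm

lemma exists_integral_abs_pow_le (hsymm : μ.map (fun x => -x) = μ) (hnd : ¬ ∀ᵐ x ∂μ, x = 0)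
    (hint : ∀ᵐ x : ℝ ∂μ, ∃ m : ℤ, x = m) :
    ∃ K, ∀ n : ℕ, ∫ t in (0 : ℝ)..Real.pi, |1 - cosExponent μ t| ^ (n + 1) ≤ K / √(n + 1) := by
  obtain ⟨K, hK⟩ := exists_return_le hsymm hnd
  have hcont := continuous_cosExponent μ
  -- odd powers are bounded by the preceding even ones, which are return probabilities
  have hle : ∀ m n : ℕ, 2 * m ≤ n → ∫ t in (0 : ℝ)..Real.pi, |1 - cosExponent μ t| ^ n
      ≤ (stepLaw μ).real {x | partialSum x (2 * m) = 0} * Real.pi := by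
    intro m n hmn
    rw [return_eq_integral hsymm hint]
    refine intervalIntegral.integral_mono_on Real.pi_pos.le
      (Continuous.intervalIntegrable (by fun_prop) _ _)
      (Continuous.intervalIntegrable (by fun_prop) _ _) fun t _ => ?_
    calc |1 - cosExponent μ t| ^ n ≤ |1 - cosExponent μ t| ^ (2 * m) :=
          pow_le_pow_of_le_one (abs_nonneg _) (abs_one_sub_cosExponent_le_one μ t) hmn
      _ = _ := by rw [pow_mul, sq_abs, ← pow_mul]
  refine ⟨Real.pi + |K| * √2 * Real.pi, fun n => ?_⟩
  have hpi := Real.pi_pos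
  rcases Nat.eq_zero_or_pos n with rfl | hn
  · refine (hle 0 (0 + 1) (by omega)).trans ?_
    have h1 : (stepLaw μ).real {x | partialSum x (2 * 0) = 0} ≤ 1 := measureReal_le_one
    have h2 : 0 ≤ |K| * √2 * Real.pi := by positivity
    have h3 : √((0 : ℕ) + 1 : ℝ) = 1 := by simp
    rw [h3, div_one]
    nlinarith
  · obtain ⟨m, hm⟩ : ∃ m, 2 * (m + 1) ≤ n + 1 ∧ n ≤ 2 * (m + 1) := ⟨(n + 1) / 2 - 1, by omega⟩
    refine (hle (m + 1) (n + 1) hm.1).trans ?_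
    have h1 := hK (2 * m + 1)
    rw [show 2 * m + 1 + 1 = 2 * (m + 1) by ring] at h1
    have h2 : K / √((2 * m + 1 : ℕ) + 1 : ℝ) ≤ |K| * √2 / √(n + 1) := by
      have h4 : √((n : ℝ) + 1) ≤ √2 * √((2 * m + 1 : ℕ) + 1 : ℝ) := by
        rw [← Real.sqrt_mul (by norm_num)]
        refine Real.sqrt_le_sqrt ?_
        have : (n : ℝ) ≤ 2 * (m + 1) := by exact_mod_cast hm.2
        push_cast
        linarith
      rw [div_le_div_iff₀ (by positivity) (by positivity)]
      calc K * √((n : ℝ) + 1) ≤ |K| * √((n : ℝ) + 1) :=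
            mul_le_mul_of_nonneg_right (le_abs_self K) (by positivity)
        _ ≤ |K| * (√2 * √((2 * m + 1 : ℕ) + 1 : ℝ)) :=
            mul_le_mul_of_nonneg_left h4 (abs_nonneg K)
        _ = _ := by ring
    calc (stepLaw μ).real {x | partialSum x (2 * (m + 1)) = 0} * Real.pi
        ≤ |K| * √2 / √(n + 1) * Real.pi := mul_le_mul_of_nonneg_right (h1.trans h2) hpi.le
      _ = (|K| * √2 * Real.pi) / √(n + 1) := by ring
      _ ≤ _ := div_le_div_of_nonneg_right (by linarith) (by positivity)

/-- The logarithmic series of `log (1 - φ)` integrated term by term, by absolute convergence. The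
values of `t` with `|φ t| = 1`, where the series may diverge, form a null set. -/
lemma lattice_log_integral (hsymm : μ.map (fun x => -x) = μ) (hnd : ¬ ∀ᵐ x ∂μ, x = 0)
    (hint : ∀ᵐ x : ℝ ∂μ, ∃ m : ℤ, x = m) :
    IntervalIntegrable (fun t => Real.log (cosExponent μ t)) volume 0 Real.pi ∧
    ∫ t in (0 : ℝ)..Real.pi, Real.log (cosExponent μ t)
      = -(Real.pi * ∑' n : ℕ, (stepLaw μ).real {x | partialSum x (n + 1) = 0} / (n + 1)) := by
  obtain ⟨K, hK⟩ := exists_integral_abs_pow_le hsymm hnd hint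
  have hcont := continuous_cosExponent μ
  set m : Measure ℝ := volume.restrict (Set.Ioc 0 Real.pi) with hm
  set F : ℕ → ℝ → ℝ := fun n t => (1 - cosExponent μ t) ^ (n + 1) / (n + 1) with hF
  have hFc : ∀ n, Continuous (F n) := fun n => by simp only [hF]; fun_prop
  have hFi : ∀ n, Integrable (F n) m := fun n =>
    (hFc n).integrableOn_Icc.mono_set Set.Ioc_subset_Icc_self
  have hnorm : ∀ n, ∫ t, ‖F n t‖ ∂m ≤ K * (1 / ((n : ℝ) + 1) ^ (3 / 2 : ℝ)) := by
    intro n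
    have hn : (0 : ℝ) < n + 1 := by positivity
    have h1 := hK n
    rw [intervalIntegral.integral_of_le Real.pi_pos.le] at h1
    simp only [hF, norm_div, norm_pow, Real.norm_eq_abs, abs_of_pos hn]
    rw [integral_div]
    refine (div_le_div_of_nonneg_right h1 hn.le).trans_eq ?_
    rw [show (3 / 2 : ℝ) = 1 / 2 + 1 by norm_num, Real.rpow_add hn, Real.rpow_one,
      ← Real.sqrt_eq_rpow]
    field_simp
  have hsum : Summable fun n => ∫ t, ‖F n t‖ ∂m := by
    refine Summable.of_nonneg_of_le (fun n => integral_nonneg fun _ => norm_nonneg _) hnorm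
      (Summable.mul_left K ?_)
    have := (summable_nat_add_iff 1).2 (Real.summable_one_div_nat_rpow.2
      (by norm_num : (1 : ℝ) < 3 / 2))
    simpa using this
  have hfin : ∫⁻ t, ∑' n, ‖F n t‖ₑ ∂m ≠ ∞ := by
    rw [lintegral_tsum fun n => (hFc n).measurable.enorm.aemeasurable]
    have h1 : ∀ n, ∫⁻ t, ‖F n t‖ₑ ∂m = ENNReal.ofReal (∫ t, ‖F n t‖ ∂m) := fun n =>
      (ofReal_integral_norm_eq_lintegral_enorm (hFi n)).symm
    simp_rw [h1]
    rw [← ENNReal.ofReal_tsum_of_nonneg (fun n => integral_nonneg fun _ => norm_nonneg _) hsum]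
    exact ENNReal.ofReal_ne_top
  have hmeas : Measurable fun t => ∑' n, ‖F n t‖ₑ :=
    Measurable.tsum fun n => (hFc n).measurable.enorm
  -- the harmonic series diverges, so `|φ| < 1` almost everywhere
  have hlt : ∀ᵐ t ∂m, HasSum (fun n => F n t) (-Real.log (cosExponent μ t)) ∧
      ‖∑' n, F n t‖ₑ ≤ ∑' n, ‖F n t‖ₑ := by
    filter_upwards [ae_lt_top hmeas hfin] with t ht
    have hs : Summable fun n => ‖F n t‖ := by
      have := ENNReal.summable_toReal ht.ne
      simpa using this
    have h1 : |1 - cosExponent μ t| < 1 := by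
      refine lt_of_le_of_ne (abs_one_sub_cosExponent_le_one μ t) fun h => ?_
      have : (fun n => ‖F n t‖) = fun n : ℕ => 1 / ((n : ℝ) + 1) := by
        ext n
        have hn : (0 : ℝ) < n + 1 := by positivity
        simp [hF, h, abs_of_pos hn]
      rw [this] at hs
      refine Real.not_summable_one_div_natCast ((summable_nat_add_iff 1).1 ?_)
      simpa using hs
    have h2 := Real.hasSum_pow_div_log_of_abs_lt_one h1
    rw [sub_sub_cancel] at h2
    exact ⟨h2, enorm_tsum_le_tsum_enorm⟩
  have hlog : Integrable (fun t => Real.log (cosExponent μ t)) m := by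
    refine ⟨(Real.measurable_log.comp hcont.measurable).aestronglyMeasurable, ?_⟩
    refine lt_of_le_of_lt (lintegral_mono_ae ?_) (lt_top_iff_ne_top.2 hfin)
    filter_upwards [hlt] with t ht
    rw [← enorm_neg, ← ht.1.tsum_eq]
    exact ht.2
  refine ⟨(intervalIntegrable_iff_integrableOn_Ioc_of_le Real.pi_pos.le).2 hlog, ?_⟩
  rw [intervalIntegral.integral_of_le Real.pi_pos.le]
  have h1 := (hasSum_integral_of_summable_integral_norm hFi hsum).tsum_eq
  have h2 : ∫ t, ∑' n, F n t ∂m = -∫ t, Real.log (cosExponent μ t) ∂m := by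
    rw [← integral_neg]
    refine integral_congr_ae ?_
    filter_upwards [hlt] with t ht using ht.1.tsum_eq
  have h3 : ∀ n, ∫ t, F n t ∂m
      = Real.pi * ((stepLaw μ).real {x | partialSum x (n + 1) = 0} / (n + 1)) := by
    intro n
    have := return_eq_integral hsymm hint (n + 1)
    rw [intervalIntegral.integral_of_le Real.pi_pos.le] at this
    simp only [hF]
    rw [integral_div, ← this]
    ring
  simp_rw [h3] at h1
  rw [tsum_mul_left, h2] at h1
  rw [h1, neg_neg]

end

open scoped NNReal

/-! ### The continuity theorem for Laplace transforms -/

/-- The bounded continuous function `x ↦ exp (-x)` on `[0, ∞)`. -/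
noncomputable def expNeg : BoundedContinuousFunction ℝ≥0 ℝ :=
  BoundedContinuousFunction.ofNormedAddCommGroup (fun x : ℝ≥0 => Real.exp (-(x : ℝ)))
    (by fun_prop) 1
    fun x => by
      rw [Real.norm_of_nonneg (Real.exp_nonneg _)]
      exact Real.exp_le_one_iff.2 (neg_nonpos.2 x.2)

/-- The algebra of polynomials in `exp (-x)` on `[0, ∞)`. -/
noncomputable def expAlgebra : StarSubalgebra ℝ (BoundedContinuousFunction ℝ≥0 ℝ) where
  toSubalgebra := Algebra.adjoin ℝ {expNeg}
  star_mem' := fun {a} ha => by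
    have : star a = a := by ext x; simp
    rwa [this]

lemma expAlgebra_separatesPoints :
    (expAlgebra.map (BoundedContinuousFunction.toContinuousMapStarₐ ℝ)).SeparatesPoints := by
  intro x y hxy
  refine ⟨expNeg, ⟨BoundedContinuousFunction.toContinuousMapStarₐ ℝ expNeg,
    ⟨expNeg, Algebra.subset_adjoin rfl, rfl⟩, rfl⟩, ?_⟩
  intro h
  have h' : Real.exp (-(x : ℝ)) = Real.exp (-(y : ℝ)) := h
  rw [Real.exp_eq_exp, neg_inj] at h'
  exact hxy (NNReal.coe_injective h')

/-- The algebra generated by `x ↦ exp (-x)` consists of the polynomials in this function, so its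
integrals are determined by the Laplace transform at the natural numbers. -/
lemma exists_polynomial_of_mem_expAlgebra {g : BoundedContinuousFunction ℝ≥0 ℝ}
    (hg : g ∈ expAlgebra) : ∃ p : Polynomial ℝ, ∀ x : ℝ≥0, g x = p.eval (Real.exp (-(x : ℝ))) := by
  have hg' : g ∈ Algebra.adjoin ℝ {expNeg} := hg
  rw [Algebra.adjoin_singleton_eq_range_aeval] at hg'
  obtain ⟨p, rfl⟩ := hg'
  refine ⟨p, fun x => ?_⟩
  clear hg
  induction p using Polynomial.induction_on' with
  | add p q hp hq => simpa using congrArg₂ (· + ·) hp hq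
  | monomial n a =>
    simp [Polynomial.aeval_monomial, expNeg, Algebra.algebraMap_eq_smul_one]

lemma integral_polynomial_exp (m : Measure ℝ≥0) [IsProbabilityMeasure m] (p : Polynomial ℝ) :
    ∫ x, p.eval (Real.exp (-(x : ℝ))) ∂m
      = p.sum fun k a => a * ∫ x, Real.exp (-(k * (x : ℝ))) ∂m := by
  simp_rw [Polynomial.eval_eq_sum, Polynomial.sum]
  rw [integral_finsetSum]
  · refine Finset.sum_congr rfl fun k _ => ?_
    rw [integral_const_mul]
    congr 1
    refine integral_congr_ae (ae_of_all _ fun x => ?_)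
    simp only
    rw [← Real.exp_nat_mul]
    ring_nf
  · intro k _
    refine Integrable.const_mul (Integrable.of_bound (by fun_prop) 1 (ae_of_all _ fun x => ?_)) _
    rw [norm_pow, Real.norm_of_nonneg (Real.exp_nonneg _)]
    exact pow_le_one₀ (Real.exp_nonneg _) (Real.exp_le_one_iff.2 (neg_nonpos.2 x.2))

/-- The values of Laplace transforms at the natural numbers determine weak limits of tight families,
because the algebra generated by `x ↦ exp (-x)` separates the points of `[0, ∞)`. -/
lemma tendsto_of_tight_of_tendsto_exp {ι : Type*} {𝓕 : Filter ι} {m : ι → ProbabilityMeasure ℝ≥0}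
    (htight : IsTightMeasureSet {(m n : Measure ℝ≥0) | n}) {m₀ : ProbabilityMeasure ℝ≥0}
    (h : ∀ k : ℕ, Tendsto (fun n => ∫ x, Real.exp (-(k * (x : ℝ))) ∂(m n : Measure ℝ≥0)) 𝓕
      (𝓝 (∫ x, Real.exp (-(k * (x : ℝ))) ∂(m₀ : Measure ℝ≥0)))) :
    Tendsto m 𝓕 (𝓝 m₀) := by
  refine ProbabilityMeasure.tendsto_of_tight_of_separatesPoints ℝ htight
    expAlgebra_separatesPoints fun g hg => ?_
  obtain ⟨p, hp⟩ := exists_polynomial_of_mem_expAlgebra hg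
  simp_rw [hp, integral_polynomial_exp, Polynomial.sum]
  exact tendsto_finsetSum _ fun k _ => (h k).const_mul _

lemma eq_of_forall_integral_exp_eq {m m' : Measure ℝ≥0} [IsProbabilityMeasure m]
    [IsProbabilityMeasure m']
    (h : ∀ k : ℕ, ∫ x, Real.exp (-(k * (x : ℝ))) ∂m = ∫ x, Real.exp (-(k * (x : ℝ))) ∂m') :
    m = m' := by
  refine ext_of_forall_mem_subalgebra_integral_eq_of_pseudoEMetric_complete_countable
    expAlgebra_separatesPoints fun g hg => ?_
  obtain ⟨p, hp⟩ := exists_polynomial_of_mem_expAlgebra hg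
  simp_rw [hp, integral_polynomial_exp, h]

section

variable {ν : Measure ℝ}

lemma ae_nonneg_of_Iio (h : ν (Set.Iio 0) = 0) : ∀ᵐ x ∂ν, 0 ≤ x := by
  filter_upwards [measure_eq_zero_iff_ae_notMem.1 h] with x hx
  simpa using hx

lemma integrable_exp_neg_of_Iio [IsProbabilityMeasure ν] (h : ν (Set.Iio 0) = 0) {s : ℝ}
    (hs : 0 ≤ s) : Integrable (fun x => Real.exp (-(s * x))) ν := by
  refine Integrable.of_bound (by fun_prop) 1 ?_
  filter_upwards [ae_nonneg_of_Iio h] with x hx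
  rw [Real.norm_of_nonneg (Real.exp_nonneg _)]
  exact Real.exp_le_one_iff.2 (neg_nonpos.2 (mul_nonneg hs hx))

lemma integral_exp_neg_eq [IsProbabilityMeasure ν] (h : ν (Set.Iio 0) = 0) {s : ℝ} (hs : 0 ≤ s) :
    ∫ x, Real.exp (-(s * x)) ∂ν = 1 - laplaceExponent ν s := by
  rw [laplaceExponent, integral_sub (integrable_const _) (integrable_exp_neg_of_Iio h hs)]
  simp

lemma integral_map_toNNReal (h : ν (Set.Iio 0) = 0) (s : ℝ) :
    ∫ x, Real.exp (-(s * (x : ℝ))) ∂(ν.map Real.toNNReal) = ∫ x, Real.exp (-(s * x)) ∂ν := by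
  rw [integral_map (by fun_prop) (by fun_prop)]
  refine integral_congr_ae ?_
  filter_upwards [ae_nonneg_of_Iio h] with x hx
  simp [hx]

lemma map_toNNReal_map_coe (h : ν (Set.Iio 0) = 0) :
    (ν.map Real.toNNReal).map ((↑) : ℝ≥0 → ℝ) = ν := by
  rw [Measure.map_map (by fun_prop) (by fun_prop)]
  conv_rhs => rw [← Measure.map_id (μ := ν)]
  refine Measure.map_congr ?_
  filter_upwards [ae_nonneg_of_Iio h] with x hx
  simp [hx]

lemma map_coe_Iio (m : Measure ℝ≥0) : m.map ((↑) : ℝ≥0 → ℝ) (Set.Iio 0) = 0 := by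
  rw [Measure.map_apply (by fun_prop) measurableSet_Iio]
  convert! measure_empty (μ := m)
  ext x
  simp

/-- A law on `[0, ∞)` is determined by its Laplace transform. -/
lemma eq_of_laplaceExponent_eq {ν' : Measure ℝ} [IsProbabilityMeasure ν] [IsProbabilityMeasure ν']
    (h : ν (Set.Iio 0) = 0) (h' : ν' (Set.Iio 0) = 0)
    (heq : ∀ s, 0 < s → laplaceExponent ν s = laplaceExponent ν' s) : ν = ν' := by
  rw [← map_toNNReal_map_coe h, ← map_toNNReal_map_coe h']
  have : IsProbabilityMeasure (ν.map Real.toNNReal) :=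
    Measure.isProbabilityMeasure_map (by fun_prop)
  have : IsProbabilityMeasure (ν'.map Real.toNNReal) :=
    Measure.isProbabilityMeasure_map (by fun_prop)
  congr 1
  refine eq_of_forall_integral_exp_eq fun k => ?_
  rw [integral_map_toNNReal h, integral_map_toNNReal h', integral_exp_neg_eq h (by positivity),
    integral_exp_neg_eq h' (by positivity)]
  rcases Nat.eq_zero_or_pos k with rfl | hk
  · simp [laplaceExponent]
  · rw [heq k (by exact_mod_cast hk)]

/-- The tail is controlled by the Laplace exponent near `0`, whence tightness. -/
lemma measure_norm_gt_le [IsProbabilityMeasure ν] (h : ν (Set.Iio 0) = 0) {r : ℝ}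
    (hr : 0 < r) : ν {x | r < ‖x‖} ≤ ENNReal.ofReal (2 * laplaceExponent ν (1 / r)) := by
  have hms : MeasurableSet {x : ℝ | r < ‖x‖} := measurableSet_lt (by fun_prop) (by fun_prop)
  rw [← ENNReal.ofReal_toReal (measure_ne_top ν {x | r < ‖x‖})]
  refine ENNReal.ofReal_le_ofReal ?_
  have hint : Integrable (fun x => 1 - Real.exp (-(1 / r * x))) ν :=
    (integrable_const _).sub (integrable_exp_neg_of_Iio h (by positivity))
  calc (ν {x | r < ‖x‖}).toReal = ∫ x, Set.indicator {x | r < ‖x‖} (fun _ => (1 : ℝ)) x ∂ν := by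
        rw [integral_indicator_const _ hms]; simp [Measure.real]
    _ ≤ ∫ x, 2 * (1 - Real.exp (-(1 / r * x))) ∂ν := by
        refine integral_mono_ae ((integrable_const _).indicator hms) (hint.const_mul 2) ?_
        filter_upwards [ae_nonneg_of_Iio h] with x hx
        by_cases hxr : r < ‖x‖
        · simp only [Set.indicator, Set.mem_ofPred_eq, hxr, if_true]
          rw [Real.norm_of_nonneg hx] at hxr
          have h1 : Real.exp (-(1 / r * x)) ≤ Real.exp (-1) := by
            rw [Real.exp_le_exp, neg_le_neg_iff, div_mul_eq_mul_div, one_mul, one_le_div hr]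
            exact hxr.le
          have h2 : Real.exp (-1) < 0.3678794412 := Real.exp_neg_one_lt_d9
          norm_num at h2
          linarith
        · simp only [Set.indicator, Set.mem_ofPred_eq, hxr, if_false]
          have := (one_sub_exp_mem (a := 1 / r * x) (by positivity)).1
          linarith
    _ = 2 * laplaceExponent ν (1 / r) := by rw [integral_const_mul]; rfl

end

/-- If the Laplace exponents of laws on `[0, ∞)` converge pointwise to a function vanishing at
`0+`, then the laws converge weakly to a law on `[0, ∞)` with this exponent. -/
lemma exists_limit_of_tendsto_laplaceExponent {ν : ℕ → Measure ℝ}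
    [hp : ∀ n, IsProbabilityMeasure (ν n)] (hν : ∀ n, ν n (Set.Iio 0) = 0) {g : ℝ → ℝ}
    (hg : Tendsto g (𝓝[>] 0) (𝓝 0))
    (h : ∀ s, 0 < s → Tendsto (fun n => laplaceExponent (ν n) s) atTop (𝓝 (g s))) :
    ∃ (G : Measure ℝ) (hG : IsProbabilityMeasure G), G (Set.Iio 0) = 0 ∧
      (∀ s, 0 < s → laplaceExponent G s = g s) ∧
      Tendsto (β := ProbabilityMeasure ℝ) (fun n => ⟨ν n, hp n⟩) atTop (𝓝 ⟨G, hG⟩) := by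
  have htight : IsTightMeasureSet (Set.range ν) := by
    refine isTightMeasureSet_range_of_tendsto_limsup_measure_norm_gt ?_
    have h0 : Tendsto (fun r : ℝ => ENNReal.ofReal (2 * g (1 / r))) atTop (𝓝 0) := by
      have h1 : Tendsto (fun r : ℝ => 1 / r) atTop (𝓝[>] 0) := by
        simpa using tendsto_inv_atTop_nhdsGT_zero (𝕜 := ℝ)
      have := ENNReal.tendsto_ofReal ((hg.comp h1).const_mul 2)
      simpa using this
    refine tendsto_of_tendsto_of_tendsto_of_le_of_le' tendsto_const_nhds h0
      (Eventually.of_forall fun _ => bot_le) ?_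
    filter_upwards [eventually_gt_atTop 0] with r hr
    have h2 := ENNReal.tendsto_ofReal ((h (1 / r) (by positivity)).const_mul 2)
    rw [← h2.limsup_eq]
    exact limsup_le_limsup (Eventually.of_forall fun n => measure_norm_gt_le (hν n) hr)
  let m : ℕ → ProbabilityMeasure ℝ≥0 := fun n =>
    ⟨(ν n).map Real.toNNReal, Measure.isProbabilityMeasure_map (by fun_prop)⟩
  have hmtight : IsTightMeasureSet {(m n : Measure ℝ≥0) | n} := by
    refine (htight.map continuous_real_toNNReal).subset ?_
    rintro _ ⟨n, rfl⟩
    exact ⟨ν n, ⟨n, rfl⟩, rfl⟩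
  have hmlap : ∀ s, 0 < s → Tendsto (fun n => ∫ x, Real.exp (-(s * (x : ℝ))) ∂(m n : Measure ℝ≥0))
      atTop (𝓝 (1 - g s)) := by
    intro s hs
    refine ((h s hs).const_sub 1).congr fun n => ?_
    rw [← integral_exp_neg_eq (hν n) hs.le, ← integral_map_toNNReal (hν n)]
    rfl
  obtain ⟨U, hU⟩ : ∃ U : Ultrafilter ℕ, (U : Filter ℕ) ≤ atTop :=
    ⟨Ultrafilter.of _, Ultrafilter.of_le _⟩
  have hcomp : IsCompact (closure {m n | n}) :=
    isCompact_closure_of_isTightMeasureSet (by simpa using hmtight)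
  obtain ⟨m₀, -, hm₀ : Tendsto m U (𝓝 m₀)⟩ := hcomp.ultrafilter_le_nhds (U.map m)
    (.trans (by simp) (monotone_principal subset_closure))
  have hlap₀ : ∀ s, 0 < s → ∫ x, Real.exp (-(s * (x : ℝ))) ∂(m₀ : Measure ℝ≥0) = 1 - g s := by
    intro s hs
    refine tendsto_nhds_unique ?_ ((hmlap s hs).mono_left hU)
    let f : BoundedContinuousFunction ℝ≥0 ℝ :=
      BoundedContinuousFunction.ofNormedAddCommGroup (fun x : ℝ≥0 => Real.exp (-(s * (x : ℝ))))
        (by fun_prop) 1 fun x => by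
          rw [Real.norm_of_nonneg (Real.exp_nonneg _)]
          exact Real.exp_le_one_iff.2 (neg_nonpos.2 (mul_nonneg hs.le x.2))
    exact (ProbabilityMeasure.tendsto_iff_forall_integral_tendsto.1 hm₀) f
  have hlim : Tendsto m atTop (𝓝 m₀) := by
    refine tendsto_of_tight_of_tendsto_exp hmtight fun k => ?_
    rcases Nat.eq_zero_or_pos k with rfl | hk
    · simp
    · have hk' : (0 : ℝ) < k := by exact_mod_cast hk
      rw [hlap₀ k hk']
      exact hmlap k hk'
  have hcoe : Continuous ((↑) : ℝ≥0 → ℝ) := NNReal.continuous_coe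
  refine ⟨(m₀ : Measure ℝ≥0).map ((↑) : ℝ≥0 → ℝ), Measure.isProbabilityMeasure_map (by fun_prop),
    map_coe_Iio _, fun s hs => ?_, ?_⟩
  · have hprob : IsProbabilityMeasure ((m₀ : Measure ℝ≥0).map ((↑) : ℝ≥0 → ℝ)) :=
      Measure.isProbabilityMeasure_map (by fun_prop)
    have h1 := integral_exp_neg_eq (map_coe_Iio (m₀ : Measure ℝ≥0)) hs.le
    rw [integral_map (by fun_prop) (by fun_prop), hlap₀ s hs] at h1
    linarith
  · have h1 := ProbabilityMeasure.tendsto_map_of_tendsto_of_continuous m m₀ hlim hcoe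
    refine h1.congr fun n => ?_
    exact Subtype.ext (map_toNNReal_map_coe (hν n))

/-! ### Regular variation and one-sided domains of attraction -/

/-- `f` is regularly varying at `0+` with index `α`. -/
def RegularlyVarying (f : ℝ → ℝ) (α : ℝ) : Prop :=
  ∀ l, 0 < l → Tendsto (fun s => f (l * s) / f s) (𝓝[>] 0) (𝓝 (l ^ α))

@[simp] lemma laplaceExponent_zero (ν : Measure ℝ) : laplaceExponent ν 0 = 0 := by
  simp [laplaceExponent]

section

variable {ν : Measure ℝ} [IsProbabilityMeasure ν]

lemma monotoneOn_laplaceExponent (h : ν (Set.Iio 0) = 0) :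
    MonotoneOn (laplaceExponent ν) (Set.Ici 0) := by
  intro s hs t ht hst
  refine integral_mono_ae ((integrable_const _).sub (integrable_exp_neg_of_Iio h hs))
    ((integrable_const _).sub (integrable_exp_neg_of_Iio h ht)) ?_
  filter_upwards [ae_nonneg_of_Iio h] with x hx
  have : Real.exp (-(t * x)) ≤ Real.exp (-(s * x)) :=
    Real.exp_le_exp.2 (neg_le_neg (mul_le_mul_of_nonneg_right hst hx))
  exact sub_le_sub_left this 1

lemma continuousOn_laplaceExponent (h : ν (Set.Iio 0) = 0) :
    ContinuousOn (laplaceExponent ν) (Set.Ici 0) := by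
  refine continuousOn_of_dominated (bound := fun _ => 1) (fun s _ => by fun_prop)
    (fun s hs => ?_) (integrable_const _) (ae_of_all _ fun x => by fun_prop)
  filter_upwards [ae_nonneg_of_Iio h] with x hx
  have := one_sub_exp_mem (a := s * x) (mul_nonneg hs hx)
  rw [Real.norm_of_nonneg this.1]
  exact this.2

lemma pi_ae_nonneg (h : ν (Set.Iio 0) = 0) (n : ℕ) :
    ∀ᵐ x ∂Measure.pi fun _ : Fin n => ν, ∀ i, 0 ≤ x i :=
  ae_all_iff.2 fun _ => (Measure.tendsto_eval_ae_ae (μ := fun _ : Fin n => ν)).eventually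
    (ae_nonneg_of_Iio h)

lemma map_sum_div_Iio (h : ν (Set.Iio 0) = 0) (n : ℕ) {a : ℝ} (ha : 0 < a) :
    (Measure.pi fun _ : Fin n => ν).map (fun x => (∑ i, x i) / a) (Set.Iio 0) = 0 := by
  rw [Measure.map_apply (by fun_prop) measurableSet_Iio, measure_eq_zero_iff_ae_notMem]
  filter_upwards [pi_ae_nonneg h n] with x hx
  simp only [Set.mem_preimage, Set.mem_Iio, not_lt]
  exact div_nonneg (Finset.sum_nonneg fun i _ => hx i) ha.le

lemma laplaceExponent_map_sum_div (h : ν (Set.Iio 0) = 0) (n : ℕ) {a : ℝ} (ha : 0 < a) {s : ℝ}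
    (hs : 0 ≤ s) :
    laplaceExponent ((Measure.pi fun _ : Fin n => ν).map (fun x => (∑ i, x i) / a)) s
      = 1 - (1 - laplaceExponent ν (s / a)) ^ n := by
  have hprob : IsProbabilityMeasure
      ((Measure.pi fun _ : Fin n => ν).map (fun x => (∑ i, x i) / a)) :=
    Measure.isProbabilityMeasure_map (by fun_prop)
  have h1 := integral_exp_neg_eq (map_sum_div_Iio h n ha) hs
  rw [integral_map (by fun_prop) (by fun_prop)] at h1
  have h2 : ∀ x : Fin n → ℝ, Real.exp (-(s * ((∑ i, x i) / a)))
      = ∏ i, Real.exp (-(s / a * x i)) := fun x => by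
    rw [← Real.exp_sum, Finset.sum_neg_distrib, ← Finset.mul_sum]
    ring_nf
  simp_rw [h2] at h1
  rw [integral_fintype_prod_eq_pow (fun x => Real.exp (-(s / a * x))), Fintype.card_fin,
    integral_exp_neg_eq h (by positivity)] at h1
  linarith

/-- A law on `[0, ∞)` with Laplace transform `exp (-s ^ α)` is `α`-stable. -/
lemma isStableLaw_of_laplaceExponent {α : ℝ} (hα0 : 0 < α) (hα1 : α < 1) (h : ν (Set.Iio 0) = 0)
    (hlap : ∀ s, 0 < s → laplaceExponent ν s = 1 - Real.exp (-(s ^ α))) : IsStableLaw α ν where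
  isProbabilityMeasure := inferInstance
  nondegenerate := by
    intro c hc
    have h1 : ∀ s, 0 < s → s ^ α = s * c := by
      intro s hs
      have := hlap s hs
      rw [hc, laplaceExponent, integral_dirac] at this
      have h2 : Real.exp (-(s * c)) = Real.exp (-(s ^ α)) := by linarith
      rw [Real.exp_eq_exp] at h2
      linarith
    have h2 := h1 1 one_pos
    rw [Real.one_rpow, one_mul] at h2
    have h3 := h1 2 two_pos
    rw [← h2, mul_one] at h3
    have h4 : (2 : ℝ) ^ α < 2 ^ (1 : ℝ) := Real.rpow_lt_rpow_of_exponent_lt one_lt_two hα1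
    rw [Real.rpow_one] at h4
    linarith
  sum_eq := by
    intro n hn
    refine ⟨0, ?_⟩
    have hn' : (0 : ℝ) < n := by exact_mod_cast hn
    have hc : (0 : ℝ) < (n : ℝ) ^ (1 / α) := Real.rpow_pos_of_pos hn' _
    have hp1 : IsProbabilityMeasure ((Measure.pi fun _ : Fin n => ν).map (fun x => ∑ i, x i)) :=
      Measure.isProbabilityMeasure_map (by fun_prop)
    have hp2 : IsProbabilityMeasure (ν.map fun x => (n : ℝ) ^ (1 / α) * x + 0) :=
      Measure.isProbabilityMeasure_map (by fun_prop)
    have hI1 : (Measure.pi fun _ : Fin n => ν).map (fun x => ∑ i, x i) (Set.Iio 0) = 0 := by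
      simpa using map_sum_div_Iio h n one_pos
    have hI2 : ν.map (fun x => (n : ℝ) ^ (1 / α) * x + 0) (Set.Iio 0) = 0 := by
      rw [Measure.map_apply (by fun_prop) measurableSet_Iio, measure_eq_zero_iff_ae_notMem]
      filter_upwards [ae_nonneg_of_Iio h] with x hx
      simp only [Set.mem_preimage, Set.mem_Iio, not_lt]
      positivity
    refine eq_of_laplaceExponent_eq hI1 hI2 fun s hs => ?_
    have h1 := laplaceExponent_map_sum_div h n one_pos hs.le
    simp only [div_one] at h1
    rw [h1, hlap s hs, sub_sub_cancel, ← Real.exp_nat_mul, laplaceExponent,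
      integral_map (by fun_prop) (by fun_prop)]
    have h2 : ∀ x : ℝ, s * ((n : ℝ) ^ (1 / α) * x + 0) = s * (n : ℝ) ^ (1 / α) * x := fun x => by
      ring
    simp_rw [h2]
    have h3 := hlap (s * (n : ℝ) ^ (1 / α)) (by positivity)
    rw [laplaceExponent] at h3
    rw [h3, Real.mul_rpow hs.le hc.le, ← Real.rpow_mul hn'.le, one_div_mul_cancel hα0.ne',
      Real.rpow_one]
    ring_nf

/-- A law on `[0, ∞)` whose Laplace exponent is regularly varying with index `α ∈ (0, 1)` is in the
domain of attraction of an `α`-stable law. -/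
lemma inDomainOfAttraction_of_regularlyVarying {α : ℝ} (hα0 : 0 < α) (hα1 : α < 1)
    (h : ν (Set.Iio 0) = 0) (hpos : ∀ s, 0 < s → 0 < laplaceExponent ν s)
    (hrv : RegularlyVarying (laplaceExponent ν) α) : InDomainOfAttraction α ν := by
  have hex : ∀ n : ℕ, ∃ s : ℝ, 0 < s ∧
      (0 < n → (1 : ℝ) / n ≤ laplaceExponent ν 1 → laplaceExponent ν s = 1 / n) := by
    intro n
    by_cases hn : 0 < n ∧ (1 : ℝ) / n ≤ laplaceExponent ν 1
    · have hcont : ContinuousOn (laplaceExponent ν) (Set.Icc 0 1) :=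
        (continuousOn_laplaceExponent h).mono Set.Icc_subset_Ici_self
      obtain ⟨s, hs, hs'⟩ := intermediate_value_Icc zero_le_one hcont
        (show (1 : ℝ) / n ∈ Set.Icc (laplaceExponent ν 0) (laplaceExponent ν 1) from
          ⟨by rw [laplaceExponent_zero]; positivity, hn.2⟩)
      refine ⟨s, lt_of_le_of_ne hs.1 fun h0 => ?_, fun _ _ => hs'⟩
      rw [← h0, laplaceExponent_zero] at hs'
      have : (0 : ℝ) < 1 / n := by have := hn.1; positivity
      linarith
    · exact ⟨1, one_pos, fun h1 h2 => absurd ⟨h1, h2⟩ hn⟩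
  choose s hs0 hs using hex
  have hlim : Tendsto (fun n : ℕ => (1 : ℝ) / n) atTop (𝓝 0) := tendsto_one_div_atTop_nhds_zero_nat
  have hsn : ∀ᶠ n : ℕ in atTop, laplaceExponent ν (s n) = 1 / n := by
    filter_upwards [eventually_gt_atTop 0, hlim.eventually (eventually_le_nhds (hpos 1 one_pos))]
      with n h1 h2 using hs n h1 h2
  have hs_lim : Tendsto s atTop (𝓝[>] 0) := by
    refine tendsto_nhdsWithin_iff.2 ⟨?_, Eventually.of_forall hs0⟩
    rw [Metric.tendsto_atTop']
    intro ε hε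
    obtain ⟨N, hN⟩ := eventually_atTop.1
      (hsn.and (hlim.eventually (eventually_lt_nhds (hpos ε hε))))
    refine ⟨N, fun n hn => ?_⟩
    obtain ⟨h1, h2⟩ := hN n hn.le
    rw [Real.dist_eq, sub_zero, abs_of_pos (hs0 n)]
    by_contra hcon
    push Not at hcon
    have := monotoneOn_laplaceExponent h (Set.mem_Ici.2 hε.le) (Set.mem_Ici.2 (hs0 n).le) hcon
    linarith
  let a : ℕ → ℝ := fun n => 1 / s n
  have ha : ∀ n, 0 < a n := fun n => one_div_pos.2 (hs0 n)
  let ρ : ℕ → Measure ℝ := fun n =>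
    (Measure.pi fun _ : Fin n => ν).map (fun x => (∑ i, x i) / a n)
  have hρp : ∀ n, IsProbabilityMeasure (ρ n) := fun n =>
    Measure.isProbabilityMeasure_map (by fun_prop)
  have hlap : ∀ l, 0 < l → Tendsto (fun n => laplaceExponent (ρ n) l) atTop
      (𝓝 (1 - Real.exp (-(l ^ α)))) := by
    intro l hl
    have h1 : Tendsto (fun n : ℕ => (n : ℝ) * -laplaceExponent ν (l * s n)) atTop
        (𝓝 (-(l ^ α))) := by
      refine ((hrv l hl).comp hs_lim).neg.congr' ?_
      filter_upwards [hsn] with n hn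
      simp only [Function.comp_apply, hn]
      rw [div_div_eq_mul_div, div_one]
      ring
    refine ((Real.tendsto_one_add_pow_exp_of_tendsto h1).const_sub 1).congr fun n => ?_
    simp only [ρ]
    rw [laplaceExponent_map_sum_div h n (ha n) hl.le]
    simp only [a, div_div_eq_mul_div, div_one]
    ring
  have hg : Tendsto (fun l : ℝ => 1 - Real.exp (-(l ^ α))) (𝓝[>] 0) (𝓝 0) := by
    have h1 : Tendsto (fun l : ℝ => l ^ α) (𝓝 0) (𝓝 0) := by
      have := (Real.continuous_rpow_const hα0.le).tendsto 0
      rwa [Real.zero_rpow hα0.ne'] at this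
    have h2 : Tendsto (fun l : ℝ => 1 - Real.exp (-(l ^ α))) (𝓝 0) (𝓝 (1 - Real.exp (-0))) :=
      ((Real.continuous_exp.tendsto _).comp h1.neg).const_sub 1
    simpa using h2.mono_left nhdsWithin_le_nhds
  obtain ⟨G, hG, hG0, hGlap, hGlim⟩ := exists_limit_of_tendsto_laplaceExponent (ν := ρ)
    (fun n => map_sum_div_Iio h n (ha n)) hg hlap
  refine ⟨inferInstance, G, hG, isStableLaw_of_laplaceExponent hα0 hα1 hG0 hGlap, a, fun _ => 0, ha,
    ⟨fun n => by fun_prop, by fun_prop, ?_⟩⟩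
  simp only [sub_zero, Measure.map_id']
  exact hGlim

end

/-! ### A Tauberian theorem for tails -/

section

variable {ν : Measure ℝ} [IsProbabilityMeasure ν]

lemma antitone_tail (ν : Measure ℝ) [IsProbabilityMeasure ν] :
    Antitone fun x => ν.real (Set.Ioi x) := fun _ _ h =>
  measureReal_mono (Set.Ioi_subset_Ioi h)

/-- Integration by parts: the Laplace transform of the tail function. -/
lemma integral_tail_mul_exp (h : ν (Set.Iio 0) = 0) {s : ℝ} (hs : 0 < s) :
    ∫ x in Set.Ioi 0, Real.exp (-(s * x)) * ν.real (Set.Ioi x) = laplaceExponent ν s / s := by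
  have hd : ∀ y : ℝ, ∫ t in (0 : ℝ)..y, s * Real.exp (-(s * t)) = 1 - Real.exp (-(s * y)) := by
    intro y
    have hder : ∀ t ∈ Set.uIcc 0 y, HasDerivAt (fun t => -Real.exp (-(s * t)))
        (s * Real.exp (-(s * t))) t := by
      intro t _
      have h1 : HasDerivAt (fun t : ℝ => -(s * t)) (-s) t := by
        simpa using! ((hasDerivAt_id t).const_mul s).neg
      convert! h1.exp.neg using 1
      ring
    rw [intervalIntegral.integral_eq_sub_of_hasDerivAt hder
      (Continuous.intervalIntegrable (by fun_prop) _ _)]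
    simp
    ring
  have hlc := lintegral_comp_eq_lintegral_meas_lt_mul ν (f := fun y : ℝ => y)
    (g := fun t => s * Real.exp (-(s * t))) (ae_nonneg_of_Iio h) (by fun_prop)
    (fun t _ => Continuous.intervalIntegrable (by fun_prop) _ _)
    (ae_of_all _ fun t => by positivity)
  simp_rw [hd] at hlc
  have hint : Integrable (fun x => 1 - Real.exp (-(s * x))) ν :=
    (integrable_const _).sub (integrable_exp_neg_of_Iio h hs.le)
  have hm : Measurable fun x => ν.real (Set.Ioi x) := (antitone_tail ν).measurable
  have h1 : laplaceExponent ν s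
      = ∫ x in Set.Ioi 0, s * (Real.exp (-(s * x)) * ν.real (Set.Ioi x)) := by
    rw [integral_eq_lintegral_of_nonneg_ae (ae_of_all _ fun x => by positivity) (by fun_prop),
      laplaceExponent, integral_eq_lintegral_of_nonneg_ae _ (by fun_prop), hlc]
    · congr 1
      refine lintegral_congr fun x => ?_
      rw [← mul_assoc, ENNReal.ofReal_mul (p := s * Real.exp (-(s * x))) (by positivity),
        mul_comm, Measure.real, ENNReal.ofReal_toReal (measure_ne_top _ _)]
      rfl
    · filter_upwards [ae_nonneg_of_Iio h] with x hx
      exact (one_sub_exp_mem (mul_nonneg hs.le hx)).1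
  rw [h1, integral_const_mul, mul_div_cancel_left₀ _ hs.ne']

lemma integral_tail_comp_mul_exp (h : ν (Set.Iio 0) = 0) {s t : ℝ} (hs : 0 < s) (ht : 0 < t) :
    ∫ y in Set.Ioi 0, Real.exp (-(s * y)) * ν.real (Set.Ioi (t * y))
      = laplaceExponent ν (s / t) / s := by
  have h1 := integral_comp_mul_left_Ioi
    (fun x => Real.exp (-(s / t * x)) * ν.real (Set.Ioi x)) 0 ht
  rw [mul_zero, integral_tail_mul_exp h (by positivity)] at h1
  have h2 : ∀ y : ℝ, s / t * (t * y) = s * y := fun y => by field_simp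
  simp_rw [h2] at h1
  rw [h1, smul_eq_mul]
  field_simp

/-- The measure on `(0, ∞)` with density `exp (-y) d y`. -/
noncomputable def expDensity (d : ℝ → ℝ) : Measure ℝ :=
  (volume.restrict (Set.Ioi 0)).withDensity fun y => ENNReal.ofReal (Real.exp (-y) * d y)

lemma expDensity_Iio (d : ℝ → ℝ) : expDensity d (Set.Iio 0) = 0 := by
  rw [expDensity]
  refine withDensity_absolutelyContinuous _ _ ?_
  rw [Measure.restrict_apply measurableSet_Iio]
  convert! measure_empty (μ := (volume : Measure ℝ))
  ext x
  simp
  intro hx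
  exact hx.le

lemma isProbabilityMeasure_expDensity {d : ℝ → ℝ} (hd : ∀ y ∈ Set.Ioi (0 : ℝ), 0 ≤ d y)
    (h1 : ∫ y in Set.Ioi 0, Real.exp (-y) * d y = 1) :
    IsProbabilityMeasure (expDensity d) := by
  constructor
  have hint : IntegrableOn (fun y => Real.exp (-y) * d y) (Set.Ioi 0) := by
    by_contra hcon
    rw [integral_undef hcon] at h1
    norm_num at h1
  rw [expDensity, withDensity_apply _ MeasurableSet.univ, Measure.restrict_univ,
    ← ofReal_integral_eq_lintegral_ofReal hint, h1, ENNReal.ofReal_one]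
  filter_upwards [ae_restrict_mem measurableSet_Ioi] with y hy
  exact mul_nonneg (Real.exp_nonneg _) (hd y hy)

lemma integral_expDensity {d : ℝ → ℝ} (hd : ∀ y ∈ Set.Ioi (0 : ℝ), 0 ≤ d y)
    (hm : Measurable d) (g : ℝ → ℝ) :
    ∫ y, g y ∂expDensity d = ∫ y in Set.Ioi 0, (Real.exp (-y) * d y) * g y := by
  rw [expDensity, integral_withDensity_eq_integral_toReal_smul (by fun_prop)
    (ae_of_all _ fun _ => ENNReal.ofReal_lt_top)]
  refine setIntegral_congr_fun measurableSet_Ioi fun y hy => ?_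
  simp only [smul_eq_mul]
  rw [ENNReal.toReal_ofReal (mul_nonneg (Real.exp_nonneg _) (hd y hy))]

lemma laplaceExponent_expDensity {d : ℝ → ℝ} (hd : ∀ y ∈ Set.Ioi (0 : ℝ), 0 ≤ d y)
    (hm : Measurable d) (h1 : ∫ y in Set.Ioi 0, Real.exp (-y) * d y = 1) {s : ℝ} (hs : 0 ≤ s) :
    laplaceExponent (expDensity d) s
      = 1 - ∫ y in Set.Ioi 0, Real.exp (-((1 + s) * y)) * d y := by
  have := isProbabilityMeasure_expDensity hd h1
  have h2 := integral_exp_neg_eq (expDensity_Iio d) hs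
  rw [integral_expDensity hd hm] at h2
  have h3 : ∀ y, Real.exp (-((1 + s) * y)) * d y = (Real.exp (-y) * d y) * Real.exp (-(s * y)) := by
    intro y
    rw [mul_right_comm, ← Real.exp_add]
    ring_nf
  simp_rw [h3]
  linarith

lemma measureReal_expDensity_Ioc {d : ℝ → ℝ} (hd : ∀ y ∈ Set.Ioi (0 : ℝ), 0 ≤ d y)
    (hm : Measurable d) {a b : ℝ} (ha : 0 ≤ a) :
    (expDensity d).real (Set.Ioc a b) = ∫ y in Set.Ioc a b, Real.exp (-y) * d y := by
  have h1 := integral_expDensity hd hm (Set.indicator (Set.Ioc a b) fun _ => 1)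
  rw [integral_indicator_const _ measurableSet_Ioc, smul_eq_mul, mul_one] at h1
  rw [h1, ← integral_indicator measurableSet_Ioi, ← integral_indicator measurableSet_Ioc]
  refine integral_congr_ae (ae_of_all _ fun y => ?_)
  by_cases hy : y ∈ Set.Ioc a b
  · have : y ∈ Set.Ioi (0 : ℝ) := ha.trans_lt hy.1
    simp [hy, this]
  · simp [hy]

/-- Karamata's Tauberian theorem for tails: the tail of a law on `[0, ∞)` is asymptotic to its
Laplace exponent if the latter is regularly varying with index in `(0, 1)`. -/
theorem tendsto_tail_div_laplaceExponent {α : ℝ} (hα0 : 0 < α) (hα1 : α < 1)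
    (h : ν (Set.Iio 0) = 0) (hpos : ∀ s, 0 < s → 0 < laplaceExponent ν s)
    (hrv : RegularlyVarying (laplaceExponent ν) α) :
    Tendsto (fun t => ν.real (Set.Ioi t) / laplaceExponent ν (1 / t)) atTop
      (𝓝 (1 / Real.Gamma (1 - α))) := by
  have hΓ : 0 < Real.Gamma (1 - α) := Real.Gamma_pos_of_pos (by linarith)
  -- the limit density and its Laplace transform
  let d₀ : ℝ → ℝ := fun y => y ^ (-α) / Real.Gamma (1 - α)
  have hd₀ : ∀ y ∈ Set.Ioi (0 : ℝ), 0 ≤ d₀ y := fun y hy =>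
    div_nonneg (Real.rpow_nonneg (le_of_lt hy) _) hΓ.le
  have hd₀m : Measurable d₀ := by fun_prop
  have hd₀l : ∀ r, 0 < r → ∫ y in Set.Ioi 0, Real.exp (-(r * y)) * d₀ y = r ^ (α - 1) := by
    intro r hr
    have h1 := Real.integral_rpow_mul_exp_neg_mul_Ioi (a := 1 - α) (by linarith) hr
    have h2 : ∀ y, Real.exp (-(r * y)) * d₀ y
        = (y ^ (1 - α - 1) * Real.exp (-(r * y))) / Real.Gamma (1 - α) := fun y => by
      simp only [d₀]
      rw [show 1 - α - 1 = -α by ring]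
      ring
    simp_rw [h2]
    rw [integral_div, h1, mul_div_cancel_right₀ _ hΓ.ne', one_div, Real.inv_rpow hr.le,
      ← Real.rpow_neg hr.le, neg_sub]
  have hd₀1 : ∫ y in Set.Ioi 0, Real.exp (-y) * d₀ y = 1 := by
    simpa using hd₀l 1 one_pos
  -- the rescaled tails
  let d : ℝ → ℝ → ℝ := fun t y => ν.real (Set.Ioi (t * y)) / laplaceExponent ν (1 / t)
  have hd : ∀ t, 0 < t → ∀ y ∈ Set.Ioi (0 : ℝ), 0 ≤ d t y := fun t ht y _ =>
    div_nonneg measureReal_nonneg (hpos _ (by positivity)).le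
  have hdm : ∀ t, Measurable (d t) := fun t =>
    ((antitone_tail ν).measurable.comp (measurable_const_mul t)).div_const _
  have hdl : ∀ t, 0 < t → ∀ r, 0 < r → ∫ y in Set.Ioi 0, Real.exp (-(r * y)) * d t y
      = laplaceExponent ν (r * (1 / t)) / laplaceExponent ν (1 / t) / r := by
    intro t ht r hr
    have h1 := integral_tail_comp_mul_exp h hr ht
    simp only [d, ← mul_div_assoc]
    rw [integral_div, h1, mul_one, div_right_comm]
  have hd1 : ∀ t, 0 < t → ∫ y in Set.Ioi 0, Real.exp (-y) * d t y = 1 := by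
    intro t ht
    have := hdl t ht 1 one_pos
    simp only [one_mul, div_one] at this
    rw [this, div_self (hpos _ (by positivity)).ne']
  -- convergence of masses of intervals, along an arbitrary sequence
  have hmass : ∀ a b, 0 < a → a < b →
      Tendsto (fun t => ∫ y in Set.Ioc a b, Real.exp (-y) * d t y) atTop
      (𝓝 (∫ y in Set.Ioc a b, Real.exp (-y) * d₀ y)) := by
    intro a b ha hab
    refine tendsto_of_seq_tendsto fun u hu => ?_
    -- replace the finitely many nonpositive terms by `1`
    let v : ℕ → ℝ := fun n => max (u n) 1
    have hv0 : ∀ n, 0 < v n := fun n => lt_max_of_lt_right one_pos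
    have hvu : ∀ᶠ n in atTop, v n = u n := by
      filter_upwards [hu.eventually_ge_atTop 1] with n hn using max_eq_left hn
    have hv : Tendsto v atTop atTop := hu.congr' (hvu.mono fun n hn => hn.symm)
    have hvinv : Tendsto (fun n => 1 / v n) atTop (𝓝[>] 0) := by
      have := (tendsto_inv_atTop_nhdsGT_zero (𝕜 := ℝ)).comp hv
      simpa [Function.comp_def] using this
    let M : ℕ → Measure ℝ := fun n => expDensity (d (v n))
    have hM : ∀ n, IsProbabilityMeasure (M n) := fun n =>
      isProbabilityMeasure_expDensity (hd _ (hv0 n)) (hd1 _ (hv0 n))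
    have hlap : ∀ s, 0 < s → Tendsto (fun n => laplaceExponent (M n) s) atTop
        (𝓝 (1 - (1 + s) ^ (α - 1))) := by
      intro s hs
      have h1 := (((hrv (1 + s) (by linarith)).comp hvinv).div_const (1 + s)).const_sub 1
      rw [← Real.rpow_sub_one (by linarith)] at h1
      refine h1.congr fun n => ?_
      simp only [M, Function.comp_apply]
      rw [laplaceExponent_expDensity (hd _ (hv0 n)) (hdm _) (hd1 _ (hv0 n)) hs.le,
        hdl _ (hv0 n) _ (by linarith)]
    have hg : Tendsto (fun s : ℝ => 1 - (1 + s) ^ (α - 1)) (𝓝[>] 0) (𝓝 0) := by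
      have h1 : ContinuousAt (fun s : ℝ => 1 - (1 + s) ^ (α - 1)) 0 := by
        refine ContinuousAt.sub (by fun_prop) (ContinuousAt.rpow_const (by fun_prop) ?_)
        left; norm_num
      have h2 := h1.tendsto
      simp only [add_zero, Real.one_rpow, sub_self] at h2
      exact h2.mono_left nhdsWithin_le_nhds
    obtain ⟨G, hG, hG0, hGl, hGt⟩ := exists_limit_of_tendsto_laplaceExponent (ν := M)
      (fun n => expDensity_Iio _) hg hlap
    have hP₀ := isProbabilityMeasure_expDensity hd₀ hd₀1
    have hGeq : G = expDensity d₀ := by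
      refine eq_of_laplaceExponent_eq hG0 (expDensity_Iio _) fun s hs => ?_
      rw [hGl s hs, laplaceExponent_expDensity hd₀ hd₀m hd₀1 hs.le, hd₀l _ (by linarith)]
    have hfr : G (frontier (Set.Ioc a b)) = 0 := by
      rw [hGeq]
      refine withDensity_absolutelyContinuous _ _
        (Measure.absolutelyContinuous_of_le Measure.restrict_le_self ?_)
      rw [frontier_Ioc hab]
      exact (Set.toFinite {a, b}).measure_zero _
    have h2 := ProbabilityMeasure.tendsto_measure_of_null_frontier_of_tendsto' hGt hfr
    have h3 := (ENNReal.tendsto_toReal (measure_ne_top G (Set.Ioc a b))).comp h2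
    have h4 : (G (Set.Ioc a b)).toReal = ∫ y in Set.Ioc a b, Real.exp (-y) * d₀ y := by
      rw [hGeq]
      exact measureReal_expDensity_Ioc hd₀ hd₀m ha.le
    rw [h4] at h3
    refine h3.congr' ?_
    filter_upwards [hvu] with n hn
    simp only [Function.comp_apply, ← hn]
    exact measureReal_expDensity_Ioc (hd _ (hv0 n)) (hdm _) ha.le
  -- monotonicity of the tail compares its value at `t` with averages over `(1 - ε, 1]` and
  -- `(1, 1 + ε]`
  have hint : ∀ t, 0 < t → IntegrableOn (fun y => Real.exp (-y) * d t y) (Set.Ioi 0) := by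
    intro t ht
    by_contra hcon
    have := hd1 t ht
    rw [integral_undef hcon] at this
    norm_num at this
  have hint₀ : IntegrableOn (fun y => Real.exp (-y) * d₀ y) (Set.Ioi 0) := by
    by_contra hcon
    have := hd₀1
    rw [integral_undef hcon] at this
    norm_num at this
  have hanti : ∀ t, 0 < t → ∀ y z, y ≤ z → d t z ≤ d t y := fun t ht y z hyz =>
    div_le_div_of_nonneg_right (antitone_tail ν (mul_le_mul_of_nonneg_left hyz ht.le))
      (hpos _ (by positivity)).le
  have hd1' : ∀ t, d t 1 = ν.real (Set.Ioi t) / laplaceExponent ν (1 / t) := fun t => by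
    simp [d]
  have hub : ∀ ε, 0 < ε → ε < 1 → ∀ t, 0 < t →
      d t 1 ≤ (∫ y in Set.Ioc (1 - ε) 1, Real.exp (-y) * d t y) * (Real.exp 1 / ε) := by
    intro ε hε hε1 t ht
    have h1 : ∫ y in Set.Ioc (1 - ε) 1, Real.exp (-1) * d t 1
        ≤ ∫ y in Set.Ioc (1 - ε) 1, Real.exp (-y) * d t y := by
      refine setIntegral_mono_on (integrableOn_const measure_Ioc_lt_top.ne) ((hint t ht).mono_set ?_)
        measurableSet_Ioc ?_
      · exact fun y hy => lt_trans (by linarith) hy.1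
      · intro y hy
        exact mul_le_mul (Real.exp_le_exp.2 (neg_le_neg hy.2)) (hanti t ht _ _ hy.2)
          (hd t ht 1 (Set.mem_Ioi.2 one_pos)) (Real.exp_nonneg _)
    rw [setIntegral_const, Measure.real, Real.volume_Ioc, smul_eq_mul, sub_sub_cancel,
      ENNReal.toReal_ofReal hε.le] at h1
    calc d t 1 = (ε * (Real.exp (-1) * d t 1)) * (Real.exp 1 / ε) := by
          rw [Real.exp_neg]; field_simp
      _ ≤ _ := mul_le_mul_of_nonneg_right h1 (by positivity)
  have hlb : ∀ ε, 0 < ε → ∀ t, 0 < t →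
      (∫ y in Set.Ioc 1 (1 + ε), Real.exp (-y) * d t y) * (Real.exp 1 / ε) ≤ d t 1 := by
    intro ε hε t ht
    have h1 : ∫ y in Set.Ioc 1 (1 + ε), Real.exp (-y) * d t y
        ≤ ∫ y in Set.Ioc 1 (1 + ε), Real.exp (-1) * d t 1 := by
      refine setIntegral_mono_on ((hint t ht).mono_set ?_) (integrableOn_const measure_Ioc_lt_top.ne)
        measurableSet_Ioc ?_
      · exact fun y hy => lt_trans one_pos hy.1
      · intro y hy
        exact mul_le_mul (Real.exp_le_exp.2 (neg_le_neg hy.1.le)) (hanti t ht _ _ hy.1.le)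
          (hd t ht y (lt_trans one_pos hy.1)) (Real.exp_nonneg _)
    rw [setIntegral_const, Measure.real, Real.volume_Ioc, smul_eq_mul, add_sub_cancel_left,
      ENNReal.toReal_ofReal hε.le] at h1
    calc _ ≤ (ε * (Real.exp (-1) * d t 1)) * (Real.exp 1 / ε) :=
          mul_le_mul_of_nonneg_right h1 (by positivity)
      _ = d t 1 := by
          rw [Real.exp_neg]; field_simp
  have hub₀ : ∀ ε, 0 < ε → ε < 1 → (∫ y in Set.Ioc (1 - ε) 1, Real.exp (-y) * d₀ y) *
      (Real.exp 1 / ε) ≤ Real.exp ε * (1 - ε) ^ (-α) / Real.Gamma (1 - α) := by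
    intro ε hε hε1
    have h1 : ∫ y in Set.Ioc (1 - ε) 1, Real.exp (-y) * d₀ y
        ≤ ∫ y in Set.Ioc (1 - ε) 1, Real.exp (-(1 - ε)) * d₀ (1 - ε) := by
      refine setIntegral_mono_on (hint₀.mono_set ?_) (integrableOn_const measure_Ioc_lt_top.ne)
        measurableSet_Ioc ?_
      · exact fun y hy => lt_trans (by linarith) hy.1
      · intro y hy
        have hy0 : 0 < y := lt_trans (by linarith) hy.1
        refine mul_le_mul (Real.exp_le_exp.2 (neg_le_neg hy.1.le)) ?_ (hd₀ y hy0)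
          (Real.exp_nonneg _)
        exact div_le_div_of_nonneg_right (Real.rpow_le_rpow_of_nonpos (by linarith) hy.1.le
          (by linarith)) hΓ.le
    rw [setIntegral_const, Measure.real, Real.volume_Ioc, smul_eq_mul, sub_sub_cancel,
      ENNReal.toReal_ofReal hε.le] at h1
    calc _ ≤ (ε * (Real.exp (-(1 - ε)) * d₀ (1 - ε))) * (Real.exp 1 / ε) :=
          mul_le_mul_of_nonneg_right h1 (by positivity)
      _ = (Real.exp (-(1 - ε)) * Real.exp 1) * d₀ (1 - ε) := by field_simp
      _ = _ := by
          rw [← Real.exp_add]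
          simp only [d₀]
          ring_nf
  have hlb₀ : ∀ ε, 0 < ε → Real.exp (-ε) * (1 + ε) ^ (-α) / Real.Gamma (1 - α) ≤
      (∫ y in Set.Ioc 1 (1 + ε), Real.exp (-y) * d₀ y) * (Real.exp 1 / ε) := by
    intro ε hε
    have h1 : ∫ y in Set.Ioc 1 (1 + ε), Real.exp (-(1 + ε)) * d₀ (1 + ε)
        ≤ ∫ y in Set.Ioc 1 (1 + ε), Real.exp (-y) * d₀ y := by
      refine setIntegral_mono_on (integrableOn_const measure_Ioc_lt_top.ne) (hint₀.mono_set ?_)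
        measurableSet_Ioc ?_
      · exact fun y hy => lt_trans one_pos hy.1
      · intro y hy
        have hy0 : 0 < y := lt_trans one_pos hy.1
        refine mul_le_mul (Real.exp_le_exp.2 (neg_le_neg hy.2)) ?_
          (hd₀ _ (Set.mem_Ioi.2 (by linarith))) (Real.exp_nonneg _)
        exact div_le_div_of_nonneg_right (Real.rpow_le_rpow_of_nonpos hy0 hy.2
          (by linarith)) hΓ.le
    rw [setIntegral_const, Measure.real, Real.volume_Ioc, smul_eq_mul, add_sub_cancel_left,
      ENNReal.toReal_ofReal hε.le] at h1
    calc _ = (Real.exp (-(1 + ε)) * Real.exp 1) * d₀ (1 + ε) := by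
          rw [← Real.exp_add]
          simp only [d₀]
          ring_nf
      _ = (ε * (Real.exp (-(1 + ε)) * d₀ (1 + ε))) * (Real.exp 1 / ε) := by field_simp
      _ ≤ _ := mul_le_mul_of_nonneg_right h1 (by positivity)
  have hlim1 : Tendsto (fun ε : ℝ => Real.exp ε * (1 - ε) ^ (-α) / Real.Gamma (1 - α)) (𝓝[>] 0)
      (𝓝 (1 / Real.Gamma (1 - α))) := by
    have h1 : ContinuousAt (fun ε : ℝ => Real.exp ε * (1 - ε) ^ (-α) / Real.Gamma (1 - α)) 0 := by
      refine ContinuousAt.div_const (ContinuousAt.mul (by fun_prop)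
        (ContinuousAt.rpow_const (by fun_prop) ?_)) _
      left; norm_num
    have h2 := h1.tendsto
    simp only [sub_zero, Real.one_rpow, Real.exp_zero, mul_one] at h2
    exact h2.mono_left nhdsWithin_le_nhds
  have hlim2 : Tendsto (fun ε : ℝ => Real.exp (-ε) * (1 + ε) ^ (-α) / Real.Gamma (1 - α)) (𝓝[>] 0)
      (𝓝 (1 / Real.Gamma (1 - α))) := by
    have h1 : ContinuousAt (fun ε : ℝ => Real.exp (-ε) * (1 + ε) ^ (-α) / Real.Gamma (1 - α)) 0 := by
      refine ContinuousAt.div_const (ContinuousAt.mul (by fun_prop)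
        (ContinuousAt.rpow_const (by fun_prop) ?_)) _
      left; norm_num
    have h2 := h1.tendsto
    simp only [add_zero, Real.one_rpow, neg_zero, Real.exp_zero, mul_one] at h2
    exact h2.mono_left nhdsWithin_le_nhds
  simp_rw [← hd1']
  rw [tendsto_order]
  constructor
  · intro c hc
    obtain ⟨ε, hε1, hε2⟩ := ((hlim2.eventually (eventually_gt_nhds hc)).and
      self_mem_nhdsWithin).exists
    have hε : 0 < ε := hε2
    have h1 := ((hmass 1 (1 + ε) one_pos (by linarith)).mul_const (Real.exp 1 / ε)).eventually
      (eventually_gt_nhds (hε1.trans_le (hlb₀ ε hε)))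
    filter_upwards [h1, eventually_gt_atTop 0] with t ht ht0
    exact ht.trans_le (hlb ε hε t ht0)
  · intro c hc
    obtain ⟨ε, ⟨hε1, hε3⟩, hε2⟩ := ((((hlim1.eventually (eventually_lt_nhds hc))).and
      (nhdsWithin_le_nhds (eventually_lt_nhds one_pos))).and self_mem_nhdsWithin).exists
    have hε : 0 < ε := hε2
    have h1 := ((hmass (1 - ε) 1 (by linarith) (by linarith)).mul_const (Real.exp 1 / ε)).eventually
      (eventually_lt_nhds ((hub₀ ε hε hε3).trans_lt hε1))
    filter_upwards [h1, eventually_gt_atTop 0] with t ht ht0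
    exact (hub ε hε hε3 t ht0).trans_lt ht

end

/-! ### Characteristic functions of stable laws and of their domains of attraction -/

lemma norm_charFun_map_mul_add (G : Measure ℝ) (r d t : ℝ) :
    ‖charFun (G.map fun x => r * x + d) t‖ = ‖charFun G (r * t)‖ := by
  have h1 : G.map (fun x => r * x + d) = (G.map (fun x => r * x)).map (fun x => x + d) := by
    rw [Measure.map_map (by fun_prop) (by fun_prop)]
    rfl
  rw [h1, charFun_map_add_const, norm_mul, charFun_map_mul, Complex.norm_exp_ofReal_mul_I, mul_one]

/-- A law whose characteristic function has modulus one is a point mass. -/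
lemma exists_eq_dirac_of_norm_charFun {G : Measure ℝ} [IsProbabilityMeasure G]
    (h : ∀ t, ‖charFun G t‖ = 1) : ∃ c, G = Measure.dirac c := by
  -- the symmetrization of the law has characteristic function `1`
  let H : Measure ℝ := (G.prod G).map fun p => p.1 - p.2
  have hH : IsProbabilityMeasure H := Measure.isProbabilityMeasure_map (by fun_prop)
  have hint : ∀ t : ℝ, Integrable (fun x : ℝ => Complex.exp (t * x * Complex.I)) G := fun t => by
    refine Integrable.of_bound (by fun_prop) 1 (ae_of_all _ fun x => ?_)
    rw [← Complex.ofReal_mul, Complex.norm_exp_ofReal_mul_I]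
  have h1 : ∀ t, charFun H t = 1 := by
    intro t
    have h2 : charFun H t = charFun G t * charFun G (-t) := by
      rw [charFun_apply_real, integral_map (by fun_prop) (by fun_prop), charFun_apply_real,
        charFun_apply_real, ← integral_prod_mul]
      refine integral_congr_ae (ae_of_all _ fun p => ?_)
      simp only
      rw [← Complex.exp_add]
      push_cast
      ring_nf
    rw [h2, charFun_neg, Complex.mul_conj, Complex.normSq_eq_norm_sq, h t]
    simp
  have h3 : ∀ᵐ x ∂H, x = 0 := by
    by_contra hnd
    obtain ⟨c, hc, δ, hδ, hq⟩ := exists_mul_sq_le_cosExponent hnd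
    have h4 := hq δ hδ.le le_rfl
    have h5 := charFun_re H δ
    rw [h1, Complex.one_re] at h5
    have : 0 < c * δ ^ 2 := by positivity
    linarith
  have h4 : ∀ᵐ p ∂G.prod G, p.1 - p.2 = 0 := ae_of_ae_map (by fun_prop) h3
  obtain ⟨c, hc⟩ := (Measure.ae_ae_of_ae_prod h4).exists
  refine ⟨c, ?_⟩
  have h5 : ∀ᵐ y ∂G, y = c := by
    filter_upwards [hc] with y hy
    linarith [sub_eq_zero.1 hy]
  have h6 : G.map id = G.map fun _ => c := Measure.map_congr h5
  rw [Measure.map_id, Measure.map_const, measure_univ, one_smul] at h6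
  exact h6

/-- The modulus of the characteristic function of a `β`-stable law is `exp (-c t ^ β)`. -/
lemma exists_norm_charFun_stable {β : ℝ} (hβ : 0 < β) {G : Measure ℝ} (hG : IsStableLaw β G) :
    ∃ c > 0, ∀ t, 0 ≤ t → ‖charFun G t‖ = Real.exp (-(c * t ^ β)) := by
  have := hG.isProbabilityMeasure
  let g : ℝ → ℝ := fun t => ‖charFun G t‖
  have hgc : Continuous g := continuous_norm.comp continuous_charFun
  have hg0 : g 0 = 1 := by simp [g]
  have hscale : ∀ n : ℕ, 0 < n → ∀ t, g ((n : ℝ) ^ (1 / β) * t) = g t ^ n := by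
    intro n hn t
    obtain ⟨d, hd⟩ := hG.sum_eq n hn
    have h1 := charFun_map_sum_pi_eq_prod (fun _ : Fin n => G)
    rw [hd] at h1
    have h2 := norm_charFun_map_mul_add G ((n : ℝ) ^ (1 / β)) d t
    rw [h1] at h2
    simp only [Finset.prod_const, Finset.card_univ, Fintype.card_fin, Pi.pow_apply,
      norm_pow] at h2
    exact h2.symm
  have hgpos : ∀ t, 0 < g t := by
    intro t
    have h1 : Tendsto (fun n : ℕ => (n : ℝ) ^ (-(1 / β)) * t) atTop (𝓝 0) := by
      have := ((tendsto_rpow_neg_atTop (one_div_pos.2 hβ)).comp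
        (tendsto_natCast_atTop_atTop (R := ℝ))).mul_const t
      simpa using! this
    have h2 := (hgc.tendsto 0).comp h1
    rw [hg0] at h2
    obtain ⟨n, hn, hn0⟩ := ((h2.eventually (eventually_gt_nhds one_pos)).and
      (eventually_gt_atTop 0)).exists
    have hn' : (0 : ℝ) < n := by exact_mod_cast hn0
    have h3 := hscale n hn0 ((n : ℝ) ^ (-(1 / β)) * t)
    rw [← mul_assoc, ← Real.rpow_add hn', add_neg_cancel, Real.rpow_zero, one_mul] at h3
    rw [h3]
    exact pow_pos hn n
  -- `q u = - log ‖charFun G (u ^ (1 / β))‖` is linear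
  let q : ℝ → ℝ := fun u => -Real.log (g (u ^ (1 / β)))
  have hqc : Continuous q := by
    refine (Continuous.log (hgc.comp (Real.continuous_rpow_const (by positivity)))
      fun u => (hgpos _).ne').neg
  have hqn : ∀ (n : ℕ) u, 0 < n → 0 ≤ u → q (n * u) = n * q u := by
    intro n u hn hu
    simp only [q]
    rw [Real.mul_rpow (Nat.cast_nonneg n) hu, hscale n hn, Real.log_pow]
    ring
  have hqr : ∀ (m n : ℕ), 0 < m → 0 < n → q ((m : ℝ) / n) = (m : ℝ) / n * q 1 := by
    intro m n hm hn
    have hn' : (0 : ℝ) < n := by exact_mod_cast hn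
    have h1 := hqn n ((m : ℝ) / n) hn (by positivity)
    rw [mul_div_cancel₀ _ hn'.ne'] at h1
    have h2 := hqn m 1 hm zero_le_one
    rw [mul_one] at h2
    rw [h2] at h1
    field_simp
    linarith
  have hql : ∀ u, 0 < u → q u = u * q 1 := by
    intro u hu
    have h1 : Tendsto (fun n : ℕ => (⌊u * n⌋₊ : ℝ) / n) atTop (𝓝 u) :=
      (tendsto_nat_floor_mul_div_atTop hu.le).comp tendsto_natCast_atTop_atTop
    refine tendsto_nhds_unique ((hqc.tendsto u).comp h1) ((h1.mul_const (q 1)).congr' ?_)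
    filter_upwards [h1.eventually (eventually_gt_nhds hu), eventually_gt_atTop 0] with n hn hn0
    refine (hqr _ n ?_ hn0).symm
    by_contra hcon
    simp only [not_lt, nonpos_iff_eq_zero] at hcon
    simp [hcon] at hn
  have hg : ∀ t, 0 ≤ t → g t = Real.exp (-(q 1 * t ^ β)) := by
    intro t ht
    rcases ht.eq_or_lt with h0 | h0
    · rw [← h0, hg0, Real.zero_rpow hβ.ne']
      simp
    · have h1 := hql (t ^ β) (by positivity)
      simp only [q] at h1
      rw [← Real.rpow_mul ht, mul_one_div_cancel hβ.ne', Real.rpow_one] at h1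
      rw [← Real.exp_log (hgpos t)]
      congr 1
      simp only [q]
      linarith
  refine ⟨q 1, lt_of_le_of_ne ?_ fun h0 => ?_, hg⟩
  · simp only [q, Left.nonneg_neg_iff]
    exact Real.log_nonpos (hgpos _).le (norm_charFun_le_one _)
  · obtain ⟨c, hc⟩ := exists_eq_dirac_of_norm_charFun (G := G) fun t => by
      rcases le_total 0 t with ht | ht
      · have := hg t ht
        rw [← h0] at this
        simpa [g] using this
      · have := hg (-t) (by linarith)
        rw [← h0] at this
        simpa [g, charFun_neg] using this
    exact hG.nondegenerate c hc

section

variable {μ : Measure ℝ} [IsProbabilityMeasure μ]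

lemma cosExponent_add_le (μ : Measure ℝ) [IsProbabilityMeasure μ] (s t : ℝ) :
    cosExponent μ (s + t) ≤ 2 * cosExponent μ s + 2 * cosExponent μ t := by
  have hi : ∀ t, Integrable (fun x => 1 - Real.cos (t * x)) μ := fun t =>
    (integrable_const _).sub (integrable_cos_mul μ t)
  simp only [cosExponent]
  rw [← integral_const_mul, ← integral_const_mul, ← integral_add ((hi s).const_mul 2)
    ((hi t).const_mul 2)]
  refine integral_mono (hi _) (((hi s).const_mul 2).add ((hi t).const_mul 2)) fun x => ?_
  simp only
  rw [add_mul, Real.cos_add]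
  nlinarith [sq_nonneg (Real.sin (s * x) - Real.sin (t * x)),
    sq_nonneg (Real.cos (s * x) + Real.cos (t * x) - 2), Real.sin_sq_add_cos_sq (s * x),
    Real.sin_sq_add_cos_sq (t * x)]

lemma cosExponent_neg (μ : Measure ℝ) (t : ℝ) : cosExponent μ (-t) = cosExponent μ t := by
  simp [cosExponent]

lemma cosExponent_two_pow_mul_le (μ : Measure ℝ) [IsProbabilityMeasure μ] (k : ℕ) (t : ℝ) :
    cosExponent μ (2 ^ k * t) ≤ 4 ^ k * cosExponent μ t := by
  induction k with
  | zero => simp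
  | succ k ih =>
    have h1 := cosExponent_add_le μ (2 ^ k * t) (2 ^ k * t)
    rw [← two_mul, ← mul_assoc, ← pow_succ'] at h1
    rw [pow_succ' 4]
    linarith

/-- A bound for `cosExponent` near `0` extends with quadratic growth. -/
lemma cosExponent_le_of_bound_near_zero {B r σ : ℝ} (hr : 0 < r) (hB : 0 ≤ B)
    (h : ∀ y, 0 ≤ y → y ≤ r → cosExponent μ (y * σ) ≤ B) {y : ℝ} (hy : 0 ≤ y) :
    cosExponent μ (y * σ) ≤ B * (1 + 4 * (y / r) ^ 2) := by
  rcases le_total y r with hyr | hyr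
  · refine (h y hy hyr).trans ?_
    nlinarith [mul_nonneg hB (sq_nonneg (y / r))]
  · have h1 : 1 ≤ y / r := (one_le_div hr).2 hyr
    obtain ⟨k, hk1, hk2⟩ := exists_nat_pow_near h1 one_lt_two
    have h2 : y * σ = 2 ^ (k + 1) * (y / 2 ^ (k + 1) * σ) := by field_simp
    rw [h2]
    have h3 : y / 2 ^ (k + 1) ≤ r := by
      rw [div_lt_iff₀ hr] at hk2
      rw [div_le_iff₀ (by positivity)]
      linarith
    calc _ ≤ _ := cosExponent_two_pow_mul_le μ _ _
      _ ≤ 4 ^ (k + 1) * B := by gcongr; exact h _ (by positivity) h3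
      _ = B * (4 * (2 ^ k) ^ 2) := by
          rw [← pow_mul, mul_comm k 2, pow_mul, pow_succ]
          norm_num
          ring
      _ ≤ B * (4 * (y / r) ^ 2) := by gcongr
      _ ≤ _ := by gcongr; linarith

/-- If `(1 - x n) ^ n` converges to `exp (-L)` and `x n → 0`, then `n * x n → L`. -/
lemma tendsto_mul_of_tendsto_one_sub_pow {x : ℕ → ℝ} {L : ℝ} (hx : Tendsto x atTop (𝓝 0))
    (h : Tendsto (fun n => (1 - x n) ^ n) atTop (𝓝 (Real.exp (-L)))) :
    Tendsto (fun n : ℕ => n * x n) atTop (𝓝 L) := by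
  have h1 : Tendsto (fun n : ℕ => -(n * Real.log (1 - x n))) atTop (𝓝 L) := by
    have := (h.log (Real.exp_pos _).ne').neg
    rw [Real.log_exp, neg_neg] at this
    refine this.congr fun n => ?_
    rw [Real.log_pow]
  -- `x ≤ - log (1 - x) ≤ x / (1 - x)`
  have h2 : Tendsto (fun n : ℕ => -(n * Real.log (1 - x n)) * (1 - x n)) atTop (𝓝 L) := by
    simpa using h1.mul (hx.const_sub 1)
  have hlt := hx.eventually (eventually_lt_nhds one_pos)
  refine tendsto_of_tendsto_of_tendsto_of_le_of_le' h2 h1 ?_ ?_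
  · filter_upwards [hlt] with n hn
    have h3 := Real.one_sub_inv_le_log_of_pos (x := 1 - x n) (by linarith)
    have h4 : -Real.log (1 - x n) * (1 - x n) ≤ x n := by
      have h5 : 0 < 1 - x n := by linarith
      calc -Real.log (1 - x n) * (1 - x n) ≤ ((1 - x n)⁻¹ - 1) * (1 - x n) := by
            gcongr; linarith
        _ = x n := by field_simp; ring
    calc _ = n * (-Real.log (1 - x n) * (1 - x n)) := by ring
      _ ≤ _ := by gcongr
  · filter_upwards [hlt] with n hn
    have h3 := Real.log_le_sub_one_of_pos (x := 1 - x n) (by linarith)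
    rw [← mul_neg]
    gcongr
    linarith

end

/-- The characteristic function of a symmetric law in the domain of attraction of a `β`-stable
law, along the normalizing sequence. The quadratic bound, which allows passing to the limit under
integrals, comes from the Baire category theorem. -/
lemma exists_normalization {μ : Measure ℝ} {β : ℝ} (hβ : 0 < β) (hsymm : μ.map (fun x => -x) = μ)
    (hDA : InDomainOfAttraction β μ) :
    ∃ a : ℕ → ℝ, (∀ n, 0 < a n) ∧ ∃ c > 0, ∃ K,
      (∀ t, 0 ≤ t → Tendsto (fun n : ℕ => n * cosExponent μ (t / a n)) atTop (𝓝 (c * t ^ β))) ∧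
      ∀ᶠ n : ℕ in atTop, ∀ t, 0 ≤ t → n * cosExponent μ (t / a n) ≤ K * (1 + t ^ 2) := by
  obtain ⟨hμ, G, hGp, hG, a, b, ha, hconv⟩ := hDA
  obtain ⟨c, hc, hcG⟩ := exists_norm_charFun_stable hβ hG
  have hpow : ∀ t, 0 ≤ t → Tendsto (fun n : ℕ => |1 - cosExponent μ (t / a n)| ^ n) atTop
      (𝓝 (Real.exp (-(c * t ^ β)))) := by
    intro t ht
    have h1 := ((ProbabilityMeasure.tendsto_iff_tendsto_charFun.1 hconv.tendsto) t).norm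
    simp only [ProbabilityMeasure.coe_mk, Measure.map_id'] at h1
    rw [hcG t ht] at h1
    refine h1.congr fun n => ?_
    have h2 : (Measure.pi fun _ : Fin n => μ).map (fun x => (∑ i, x i - b n) / a n)
        = ((Measure.pi fun _ : Fin n => μ).map (fun x => ∑ i, x i)).map
          (fun y => (a n)⁻¹ * y + -(b n / a n)) := by
      rw [Measure.map_map (by fun_prop) (by fun_prop)]
      congr 1
      ext x
      simp only [Function.comp_apply]
      ring
    rw [h2, norm_charFun_map_mul_add, charFun_map_sum_pi_eq_prod]
    simp only [Finset.prod_const, Finset.card_univ, Fintype.card_fin, Pi.pow_apply, norm_pow]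
    rw [charFun_eq_of_symm hsymm, Complex.norm_real, Real.norm_eq_abs, inv_mul_eq_div]
  have hnd : ¬ ∀ᵐ x ∂μ, x = 0 := by
    intro h0
    have h2 : ∀ t, cosExponent μ t = 0 := fun t => by
      refine integral_eq_zero_of_ae ?_
      filter_upwards [h0] with x hx
      simp [hx]
    have h3 := hpow 1 zero_le_one
    simp only [h2, sub_zero, abs_one, one_pow, Real.one_rpow, mul_one] at h3
    have h4 := tendsto_nhds_unique h3 tendsto_const_nhds
    rw [Real.exp_eq_one_iff] at h4
    linarith
  -- the symmetrization `ρ` has a nonnegative characteristic function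
  let ρ := sumLaw μ 2
  have hρ : ∀ t, 1 - cosExponent ρ t = (1 - cosExponent μ t) ^ 2 := cosExponent_sumLaw hsymm 2
  have hρpow : ∀ t, 0 ≤ t → Tendsto (fun n : ℕ => (1 - cosExponent ρ (t / a n)) ^ n) atTop
      (𝓝 (Real.exp (-(2 * (c * t ^ β))))) := by
    intro t ht
    have h1 := (hpow t ht).pow 2
    rw [← Real.exp_nat_mul] at h1
    simp only [Nat.cast_ofNat, mul_neg] at h1
    refine h1.congr fun n => ?_
    rw [hρ, ← sq_abs (1 - _), ← pow_mul, ← pow_mul, mul_comm]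
  have hρbdd : ∀ t, ∃ K : ℕ, ∀ n : ℕ, n * cosExponent ρ (t / a n) ≤ K := by
    intro t
    have h1 : ∀ᶠ n : ℕ in atTop, n * cosExponent ρ (t / a n) ≤ 2 * (c * |t| ^ β) + 1 := by
      have h2 := ((hρpow |t| (abs_nonneg t)).log (Real.exp_pos _).ne').neg
      rw [Real.log_exp, neg_neg] at h2
      filter_upwards [h2.eventually (eventually_lt_nhds (lt_add_one _)),
        (hρpow |t| (abs_nonneg t)).eventually (eventually_gt_nhds (Real.exp_pos _)),
        eventually_gt_atTop 0] with n hn hn1 hn0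
      have heq : cosExponent ρ (|t| / a n) = cosExponent ρ (t / a n) := by
        rcases abs_choice t with h | h <;> rw [h]
        rw [neg_div, cosExponent_neg]
      rw [heq] at hn hn1
      have h3 : 0 < 1 - cosExponent ρ (t / a n) := by
        refine lt_of_le_of_ne (by rw [hρ]; positivity) fun h => ?_
        rw [← h, zero_pow hn0.ne'] at hn1
        exact lt_irrefl _ hn1
      have h4 := Real.log_le_sub_one_of_pos h3
      rw [Real.log_pow] at hn
      refine le_trans ?_ hn.le
      rw [← mul_neg]
      gcongr
      linarith
    obtain ⟨N, hN⟩ := eventually_atTop.1 h1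
    obtain ⟨K, hK⟩ := exists_nat_ge (max (2 * (c * |t| ^ β) + 1) (N * 2))
    refine ⟨K, fun n => ?_⟩
    rcases le_total N n with h | h
    · exact (hN n h).trans ((le_max_left _ _).trans hK)
    · refine le_trans ?_ ((le_max_right _ _).trans hK)
      have h5 := cosExponent_le_two ρ (t / a n)
      have h6 := cosExponent_nonneg ρ (t / a n)
      gcongr
  obtain ⟨K, r, hr, hK⟩ : ∃ K : ℝ, ∃ r > 0, ∀ y, 0 ≤ y → y ≤ r → ∀ n : ℕ,
      n * cosExponent ρ (y / a n) ≤ K := by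
    let A : ℕ → Set ℝ := fun K => {t | ∀ n : ℕ, n * cosExponent ρ (t / a n) ≤ K}
    have hA : ∀ K, IsClosed (A K) := by
      intro K
      have : A K = ⋂ n : ℕ, {t | n * cosExponent ρ (t / a n) ≤ K} := by
        ext t; simp [A]
      rw [this]
      have hcc := continuous_cosExponent ρ
      exact isClosed_iInter fun n => isClosed_le (by fun_prop) (by fun_prop)
    have hU : ⋃ K, A K = Set.univ := by
      refine Set.eq_univ_of_forall fun t => ?_
      obtain ⟨K, hK⟩ := hρbdd t
      exact Set.mem_iUnion.2 ⟨K, hK⟩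
    obtain ⟨K, t₀, ht₀⟩ := nonempty_interior_of_iUnion_of_closed hA hU
    obtain ⟨ε, hε, hball⟩ := Metric.isOpen_iff.1 isOpen_interior t₀ ht₀
    refine ⟨4 * K, ε / 2, by positivity, fun y hy hyr n => ?_⟩
    have h1 : t₀ + y ∈ A K := interior_subset (hball (by
      rw [Metric.mem_ball, Real.dist_eq, add_sub_cancel_left, abs_of_nonneg hy]; linarith))
    have h2 : t₀ ∈ A K := interior_subset ht₀
    have h3 := cosExponent_add_le ρ ((t₀ + y) / a n) (-(t₀ / a n))
    rw [cosExponent_neg, show (t₀ + y) / a n + -(t₀ / a n) = y / a n by ring] at h3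
    have h4 := h1 n
    have h5 := h2 n
    have h6 := mul_le_mul_of_nonneg_left h3 (Nat.cast_nonneg (α := ℝ) n)
    linarith
  -- the normalizing constants tend to infinity
  obtain ⟨c₁, hc₁, δ₁, hδ₁, hq⟩ := exists_mul_sq_le_cosExponent hnd
  obtain ⟨δ₂, hδ₂, hone⟩ : ∃ δ₂ > 0, ∀ t, 0 ≤ t → t ≤ δ₂ → cosExponent μ t ≤ 1 := by
    have h := (continuous_cosExponent μ).tendsto 0
    rw [cosExponent_zero] at h
    obtain ⟨ε, hε, h⟩ := Metric.eventually_nhds_iff.1 (h.eventually (eventually_le_nhds one_pos))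
    refine ⟨ε / 2, by positivity, fun t ht htd => h ?_⟩
    rw [Real.dist_eq, sub_zero, abs_of_nonneg ht]
    linarith
  have hle : ∀ t, 0 ≤ t → t ≤ δ₂ → cosExponent μ t ≤ cosExponent ρ t := by
    intro t ht htd
    have h1 := hone t ht htd
    have h2 := cosExponent_nonneg μ t
    have h3 := hρ t
    nlinarith
  have hatop : Tendsto a atTop atTop := by
    rw [tendsto_atTop]
    intro A
    let A' := max A 1
    have hA' : 0 < A' := lt_max_of_lt_right one_pos
    let z := min (r / A') (min δ₁ δ₂)
    have hz : 0 < z := by positivity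
    obtain ⟨N, hN⟩ := exists_nat_gt (K / (c₁ * z ^ 2))
    filter_upwards [eventually_ge_atTop N] with n hn
    by_contra hcon
    push Not at hcon
    have h1 : z * a n ≤ r := by
      calc z * a n ≤ r / A' * A' := by
            have := (ha n).le
            have h2 : z ≤ r / A' := min_le_left _ _
            have h3 : a n ≤ A' := hcon.le.trans (le_max_left _ _)
            gcongr
        _ = r := by field_simp
    have h2 := hK (z * a n) (by have := ha n; positivity) h1 n
    rw [mul_div_cancel_right₀ _ (ha n).ne'] at h2
    have h3 := hq z hz.le ((min_le_right _ _).trans (min_le_left _ _))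
    have h4 := hle z hz.le ((min_le_right _ _).trans (min_le_right _ _))
    rw [div_lt_iff₀ (by positivity)] at hN
    have h5 : (N : ℝ) * (c₁ * z ^ 2) ≤ n * cosExponent ρ z := by
      have : (N : ℝ) ≤ n := by exact_mod_cast hn
      have := h3.trans h4
      gcongr
    linarith
  have hzero : ∀ t, Tendsto (fun n => cosExponent μ (t / a n)) atTop (𝓝 0) := by
    intro t
    have h1 := ((continuous_cosExponent μ).tendsto 0).comp (hatop.const_div_atTop t)
    rw [cosExponent_zero] at h1
    exact h1
  have hev : ∀ᶠ n : ℕ in atTop, r / a n ≤ δ₂ :=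
    (hatop.const_div_atTop r).eventually (eventually_le_nhds hδ₂)
  have hK0 : 0 ≤ K := by simpa using hK 0 le_rfl hr.le 0
  refine ⟨a, ha, c, hc, K * (1 + 4 / r ^ 2), fun t ht => ?_, ?_⟩
  · refine tendsto_mul_of_tendsto_one_sub_pow (hzero t)
      ((hpow t ht).congr' ?_)
    filter_upwards [(hzero t).eventually (eventually_lt_nhds one_pos)] with n hn
    rw [abs_of_pos (by linarith)]
  · filter_upwards [hev, eventually_gt_atTop 0] with n hn hn0 t ht
    have hn' : (0 : ℝ) < n := by exact_mod_cast hn0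
    have h1 := cosExponent_le_of_bound_near_zero (μ := μ) (B := K / n) (σ := 1 / a n) hr
      (by positivity) (fun y hy hyr => by
        rw [mul_one_div, le_div_iff₀' hn']
        have han := ha n
        have h2 := hle (y / a n) (by positivity) (le_trans (by gcongr) hn)
        exact le_trans (by gcongr) (hK y hy hyr n)) ht
    rw [mul_one_div] at h1
    calc _ ≤ n * (K / n * (1 + 4 * (t / r) ^ 2)) := by gcongr
      _ = K * (1 + 4 / r ^ 2 * t ^ 2) := by field_simp
      _ ≤ K * ((1 + 4 / r ^ 2) * (1 + t ^ 2)) := by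
          refine mul_le_mul_of_nonneg_left ?_ hK0
          have : 0 < 4 / r ^ 2 := by positivity
          nlinarith [sq_nonneg t]
      _ = _ := by ring

/-! ### Cosine integrals -/

lemma integral_exp_neg_mul_one_sub_cos (z : ℝ) :
    ∫ y in Set.Ioi 0, Real.exp (-y) * (1 - Real.cos (y * z)) = z ^ 2 / (1 + z ^ 2) := by
  have hre : (-1 + z * Complex.I : ℂ).re < 0 := by simp
  have h1 := integral_exp_mul_complex_Ioi hre 0
  have h2 := integrableOn_exp_mul_complex_Ioi hre 0
  have h3 : ∫ y in Set.Ioi 0, Real.exp (-y) * Real.cos (y * z) = 1 / (1 + z ^ 2) := by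
    have h4 : ∀ y : ℝ, Real.exp (-y) * Real.cos (y * z)
        = RCLike.re (Complex.exp ((-1 + z * Complex.I) * y)) := fun y => by
      simp [Complex.exp_re, mul_comm]
    simp_rw [h4]
    rw [integral_re h2, h1]
    simp [Complex.inv_re, Complex.normSq_apply, neg_div]
    ring
  have h5 : IntegrableOn (fun y : ℝ => Real.exp (-y)) (Set.Ioi 0) := integrableOn_exp_neg_Ioi 0
  have h6 : IntegrableOn (fun y => Real.exp (-y) * Real.cos (y * z)) (Set.Ioi 0) :=
    h5.mul_bdd (c := 1) (by fun_prop) (ae_of_all _ fun y => Real.abs_cos_le_one _)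
  simp_rw [mul_sub, mul_one]
  rw [integral_sub h5 h6, integral_exp_neg_Ioi_zero, h3]
  field_simp
  ring

/-- The Fourier transform of the Cauchy density, by inversion of that of `exp (-|x|)`. -/
lemma integral_cos_div_one_add_sq (z : ℝ) :
    ∫ y, Real.cos (y * z) * (1 + y ^ 2)⁻¹ = Real.pi * Real.exp (-|z|) := by
  have hπ := Real.pi_pos
  let f : ℝ → ℂ := fun x => (Real.exp (-(2 * Real.pi * |x|)) : ℂ)
  have hfc : Continuous f := by fun_prop
  have hr : ∀ w : ℝ, Set.EqOn (fun v : ℝ => Complex.exp ((-2 * Real.pi * v * w : ℝ) * Complex.I)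
      • f v) (fun v : ℝ => Complex.exp ((-(2 * Real.pi) * (1 + w * Complex.I)) * v))
      (Set.Ioi 0) := by
    intro w v hv
    simp only [f, smul_eq_mul, abs_of_pos (Set.mem_Ioi.1 hv)]
    rw [Complex.ofReal_exp, ← Complex.exp_add]
    push_cast
    ring_nf
  have hl : ∀ w : ℝ, Set.EqOn (fun v : ℝ => Complex.exp ((-2 * Real.pi * v * w : ℝ) * Complex.I)
      • f v) (fun v : ℝ => Complex.exp (((2 * Real.pi) * (1 - w * Complex.I)) * v))
      (Set.Iic 0) := by
    intro w v hv
    simp only [f, smul_eq_mul, abs_of_nonpos (Set.mem_Iic.1 hv)]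
    rw [Complex.ofReal_exp, ← Complex.exp_add]
    push_cast
    ring_nf
  have hre1 : ∀ w : ℝ, (-(2 * Real.pi) * (1 + w * Complex.I) : ℂ).re < 0 := fun w => by
    simp [hπ]
  have hre2 : ∀ w : ℝ, 0 < ((2 * Real.pi) * (1 - w * Complex.I) : ℂ).re := fun w => by
    simp [hπ]
  have hI1 : ∀ w : ℝ, IntegrableOn (fun v : ℝ => Complex.exp ((-2 * Real.pi * v * w : ℝ)
      * Complex.I) • f v) (Set.Ioi 0) := fun w =>
    (integrableOn_exp_mul_complex_Ioi (hre1 w) 0).congr_fun (hr w).symm measurableSet_Ioi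
  have hI2 : ∀ w : ℝ, IntegrableOn (fun v : ℝ => Complex.exp ((-2 * Real.pi * v * w : ℝ)
      * Complex.I) • f v) (Set.Iic 0) := fun w =>
    (integrableOn_exp_mul_complex_Iic (hre2 w) 0).congr_fun (hl w).symm measurableSet_Iic
  have hF : FourierTransform.fourier f = fun w : ℝ => ((1 / Real.pi * (1 + w ^ 2)⁻¹ : ℝ) : ℂ) := by
    ext w
    rw [Real.fourier_real_eq_integral_exp_smul,
      ← intervalIntegral.integral_Iic_add_Ioi (hI2 w) (hI1 w),
      setIntegral_congr_fun measurableSet_Iic (hl w),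
      setIntegral_congr_fun measurableSet_Ioi (hr w),
      integral_exp_mul_complex_Ioi (hre1 w), integral_exp_mul_complex_Iic (hre2 w)]
    have e1 : (1 - w * Complex.I : ℂ) ≠ 0 := fun h => by simpa using congrArg Complex.re h
    have e2 : (1 + w * Complex.I : ℂ) ≠ 0 := fun h => by simpa using congrArg Complex.re h
    have e3 : (1 + (w : ℂ) ^ 2) = (1 - w * Complex.I) * (1 + w * Complex.I) := by
      ring_nf
      rw [Complex.I_sq]
      ring
    have e4 : (Real.pi : ℂ) ≠ 0 := by exact_mod_cast hπ.ne'
    push_cast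
    rw [e3]
    simp only [mul_zero, Complex.exp_zero]
    field_simp
    ring
  have hfi : Integrable f := by
    have := (hI2 0).union (hI1 0)
    rw [Set.Iic_union_Ioi, integrableOn_univ] at this
    simpa using this
  have hFi : Integrable (FourierTransform.fourier f) := by
    rw [hF]
    exact (integrable_inv_one_add_sq.const_mul _).ofReal
  have h1 := congrFun (hfc.fourierInv_fourier_eq hfi hFi) (z / (2 * Real.pi))
  rw [Real.fourierInv_eq', hF] at h1
  have h2 := congrArg RCLike.re h1
  rw [← integral_re] at h2
  · have h3 : ∀ y : ℝ, RCLike.re (Complex.exp ((2 * Real.pi * inner ℝ y (z / (2 * Real.pi)) : ℝ)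
        * Complex.I) • ((1 / Real.pi * (1 + y ^ 2)⁻¹ : ℝ) : ℂ))
        = 1 / Real.pi * (Real.cos (y * z) * (1 + y ^ 2)⁻¹) := by
      intro y
      rw [smul_eq_mul, RCLike.re_eq_complex_re, Complex.re_mul_ofReal, Complex.exp_ofReal_mul_I_re]
      have : 2 * Real.pi * inner ℝ y (z / (2 * Real.pi)) = y * z := by
        simp
        field_simp
      rw [this]
      ring
    simp_rw [h3] at h2
    rw [integral_const_mul] at h2
    have h4 : RCLike.re (f (z / (2 * Real.pi))) = Real.exp (-|z|) := by
      simp only [f, RCLike.re_eq_complex_re, Complex.ofReal_re, abs_div, abs_of_pos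
        (by positivity : 0 < 2 * Real.pi)]
      field_simp
    rw [h4] at h2
    rw [← h2, ← mul_assoc, mul_one_div_cancel hπ.ne', one_mul]
  · simp only [smul_eq_mul]
    refine Integrable.bdd_mul (c := 1) (integrable_inv_one_add_sq.const_mul _).ofReal
      (by fun_prop) (ae_of_all _ fun y => ?_)
    rw [Complex.norm_exp_ofReal_mul_I]

lemma integral_one_sub_cos_div_one_add_sq (z : ℝ) :
    ∫ y in Set.Ioi 0, (1 + y ^ 2)⁻¹ * (1 - Real.cos (y * z))
      = Real.pi / 2 * (1 - Real.exp (-|z|)) := by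
  have h1 : ∫ y, (1 + y ^ 2)⁻¹ * (1 - Real.cos (y * z)) = Real.pi * (1 - Real.exp (-|z|)) := by
    have hi : Integrable fun y : ℝ => (1 + y ^ 2)⁻¹ * Real.cos (y * z) :=
      integrable_inv_one_add_sq.mul_bdd (c := 1) (by fun_prop)
        (ae_of_all _ fun y => Real.abs_cos_le_one _)
    simp_rw [mul_sub, mul_one]
    rw [integral_sub integrable_inv_one_add_sq hi, integral_univ_inv_one_add_sq]
    simp_rw [mul_comm _ (Real.cos _)]
    rw [integral_cos_div_one_add_sq]
  have h2 := integral_comp_abs (f := fun y => (1 + y ^ 2)⁻¹ * (1 - Real.cos (y * z)))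
  have h3 : ∀ y : ℝ, (1 + |y| ^ 2)⁻¹ * (1 - Real.cos (|y| * z))
      = (1 + y ^ 2)⁻¹ * (1 - Real.cos (y * z)) := fun y => by
    rcases abs_choice y with h | h <;> simp [h]
  simp_rw [h3] at h2
  linarith

/-- The integral `∫ y ^ β / (1 + y ^ 2)` over the positive half-line, by the reflection formula
for the Gamma function. -/
lemma integral_rpow_div_one_add_sq {β : ℝ} (h0 : -1 < β) (h1 : β < 1) :
    IntegrableOn (fun y : ℝ => (1 + y ^ 2)⁻¹ * y ^ β) (Set.Ioi 0) ∧
    ∫ y in Set.Ioi 0, (1 + y ^ 2)⁻¹ * y ^ β = Real.pi / (2 * Real.cos (Real.pi * β / 2)) := by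
  let F : ℝ × ℝ → ℝ := fun p => p.1 ^ β * Real.exp (-(1 + p.1 ^ 2) * p.2)
  have hFm : Measurable F := by fun_prop
  have hFu : ∀ y : ℝ, ∫ u in Set.Ioi 0, F (y, u) = (1 + y ^ 2)⁻¹ * y ^ β := by
    intro y
    have hneg : -(1 + y ^ 2) < 0 := by nlinarith [sq_nonneg y]
    simp only [F]
    rw [integral_const_mul, integral_exp_mul_Ioi hneg]
    simp only [mul_zero, Real.exp_zero]
    rw [neg_div_neg_eq, one_div, mul_comm]
  have hFy : ∀ u ∈ Set.Ioi (0 : ℝ), ∫ y in Set.Ioi 0, F (y, u)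
      = Real.Gamma ((β + 1) / 2) / 2 * (Real.exp (-u) * u ^ ((1 - β) / 2 - 1)) := by
    intro u hu
    have h2 := integral_rpow_mul_exp_neg_mul_rpow two_pos h0 hu
    have h3 : ∀ y : ℝ, F (y, u) = Real.exp (-u) * (y ^ β * Real.exp (-u * y ^ (2 : ℝ))) := by
      intro y
      simp only [F]
      rw [Real.rpow_two, mul_left_comm, ← Real.exp_add]
      ring_nf
    simp_rw [h3]
    rw [integral_const_mul, h2, show (1 - β) / 2 - 1 = -(β + 1) / 2 by ring]
    ring
  have hFi : Integrable F ((volume.restrict (Set.Ioi 0)).prod (volume.restrict (Set.Ioi 0))) := by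
    rw [integrable_prod_iff' hFm.aestronglyMeasurable]
    constructor
    · filter_upwards [ae_restrict_mem measurableSet_Ioi] with u hu
      by_contra hcon
      have h2 := hFy u hu
      rw [integral_undef hcon] at h2
      have hu' : (0 : ℝ) < u := hu
      have h3 : 0 < Real.Gamma ((β + 1) / 2) := Real.Gamma_pos_of_pos (by linarith)
      have : 0 < Real.Gamma ((β + 1) / 2) / 2 * (Real.exp (-u) * u ^ ((1 - β) / 2 - 1)) := by
        positivity
      linarith
    · have h2 := (Real.GammaIntegral_convergent (s := (1 - β) / 2) (by linarith)).const_mul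
        (Real.Gamma ((β + 1) / 2) / 2)
      refine IntegrableOn.congr_fun h2 (fun u hu => ?_) measurableSet_Ioi
      rw [← hFy u hu]
      refine setIntegral_congr_fun measurableSet_Ioi fun y hy => ?_
      rw [Real.norm_of_nonneg]
      have hy' : (0 : ℝ) < y := hy
      positivity
  have h2 := integral_integral_swap (f := fun y u => F (y, u)) hFi
  simp_rw [hFu] at h2
  refine ⟨?_, ?_⟩
  · refine hFi.integral_prod_left.congr (ae_of_all _ fun y => hFu y)
  · rw [h2, setIntegral_congr_fun measurableSet_Ioi hFy, integral_const_mul,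
      ← Real.Gamma_eq_integral (by linarith)]
    have h3 := Real.Gamma_mul_Gamma_one_sub ((β + 1) / 2)
    rw [show 1 - (β + 1) / 2 = (1 - β) / 2 by ring,
      show Real.pi * ((β + 1) / 2) = Real.pi * β / 2 + Real.pi / 2 by ring,
      Real.sin_add_pi_div_two] at h3
    rw [div_mul_eq_mul_div, h3, div_div, mul_comm (Real.cos _)]

/-! ### Mixtures of `1 - cos` -/

section

variable (μ : Measure ℝ) [IsProbabilityMeasure μ]

lemma integrableOn_mul_cosExponent {k : ℝ → ℝ} (hk : IntegrableOn k (Set.Ioi 0)) (s : ℝ) :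
    IntegrableOn (fun y => k y * cosExponent μ (y * s)) (Set.Ioi 0) := by
  have hc := continuous_cosExponent μ
  refine Integrable.mono' (hk.norm.mul_const 2)
    (hk.aestronglyMeasurable.mul (Continuous.aestronglyMeasurable (by fun_prop)))
    (ae_of_all _ fun y => ?_)
  rw [norm_mul, Real.norm_of_nonneg (cosExponent_nonneg _ _)]
  gcongr
  exact cosExponent_le_two _ _

lemma integral_mul_cosExponent {k : ℝ → ℝ} (hk : IntegrableOn k (Set.Ioi 0)) (s : ℝ) :
    ∫ y in Set.Ioi 0, k y * cosExponent μ (y * s)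
      = ∫ x, (∫ y in Set.Ioi 0, k y * (1 - Real.cos (y * (s * x)))) ∂μ := by
  simp_rw [cosExponent, ← integral_const_mul]
  rw [integral_integral_swap]
  · simp_rw [mul_assoc]
  · have h1 : Integrable (fun p : ℝ × ℝ => k p.1) ((volume.restrict (Set.Ioi 0)).prod μ) :=
      hk.integrable.comp_fst μ
    refine Integrable.mono' (h1.norm.mul_const 2)
      (h1.aestronglyMeasurable.mul (by fun_prop)) (ae_of_all _ fun p => ?_)
    have h1 := Real.cos_le_one (p.1 * s * p.2)
    have h2 := Real.neg_one_le_cos (p.1 * s * p.2)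
    simp only [Function.uncurry]
    rw [norm_mul, Real.norm_of_nonneg (sub_nonneg.2 h1)]
    gcongr
    linarith

/-- The function `s ↦ E (s² X² / (1 + s² X²))`, a monotone substitute for `cosExponent`. -/
noncomputable def truncExponent (s : ℝ) : ℝ := ∫ x, (s * x) ^ 2 / (1 + (s * x) ^ 2) ∂μ

/-- `truncExponent` is the mixture of `cosExponent` with respect to the exponential law. -/
lemma truncExponent_eq (s : ℝ) :
    truncExponent μ s = ∫ y in Set.Ioi 0, Real.exp (-y) * cosExponent μ (y * s) := by
  rw [integral_mul_cosExponent μ (integrableOn_exp_neg_Ioi 0)]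
  simp_rw [integral_exp_neg_mul_one_sub_cos]
  rfl

/-- `absExponent` is the mixture of `cosExponent` with respect to the Cauchy law. -/
lemma absExponent_eq {s : ℝ} (hs : 0 ≤ s) :
    absExponent μ s
      = 2 / Real.pi * ∫ y in Set.Ioi 0, (1 + y ^ 2)⁻¹ * cosExponent μ (y * s) := by
  rw [integral_mul_cosExponent μ integrable_inv_one_add_sq.integrableOn]
  simp_rw [integral_one_sub_cos_div_one_add_sq]
  rw [integral_const_mul, ← mul_assoc, absExponent]
  have : 2 / Real.pi * (Real.pi / 2) = 1 := by
    have := Real.pi_pos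
    field_simp
  simp_rw [this, one_mul, abs_mul, abs_of_nonneg hs]

end

/-! ### Regular variation of the truncated second moment -/

/-- A monotone function is regularly varying at `0+` as soon as it is asymptotically homogeneous
along some normalizing sequence. -/
lemma regularlyVarying_of_tendsto {f : ℝ → ℝ} (hmono : ∀ s t, 0 < s → s ≤ t → f s ≤ f t)
    (hpos : ∀ s, 0 < s → 0 < f s) {a : ℕ → ℝ} (ha : ∀ n, 0 < a n) {C b : ℝ} (hC : 0 < C)
    (hb : 0 < b)
    (h : ∀ t, 0 < t → Tendsto (fun n : ℕ => n * f (t / a n)) atTop (𝓝 (C * t ^ b))) :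
    RegularlyVarying f b := by
  -- `f` vanishes at `0+`
  have hf0 : Tendsto f (𝓝[>] 0) (𝓝 0) := by
    rw [tendsto_order]
    refine ⟨fun c hc => ?_, fun c hc => ?_⟩
    · filter_upwards [self_mem_nhdsWithin] with s hs
      exact hc.trans (hpos s hs)
    · have h1 : Tendsto (fun n : ℕ => f (1 / a n)) atTop (𝓝 0) := by
        have := (h 1 one_pos).mul tendsto_one_div_atTop_nhds_zero_nat
        rw [mul_zero] at this
        refine this.congr' ?_
        filter_upwards [eventually_gt_atTop 0] with n hn
        have : (0 : ℝ) < n := by exact_mod_cast hn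
        field_simp
      obtain ⟨n, hn⟩ := (h1.eventually (eventually_lt_nhds hc)).exists
      have h2 : 0 < 1 / a n := one_div_pos.2 (ha n)
      filter_upwards [Ioo_mem_nhdsGT h2] with s hs
      exact (hmono s _ hs.1 hs.2.le).trans_lt hn
  -- the index `m s` for which `s` is comparable with `1 / a (m s)`
  let m : ℝ → ℕ := fun s => ⌊C / f s⌋₊
  have hinv : Tendsto (fun s => C / f s) (𝓝[>] 0) atTop := by
    have h1 : Tendsto f (𝓝[>] 0) (𝓝[>] 0) := by
      refine tendsto_nhdsWithin_iff.2 ⟨hf0, ?_⟩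
      filter_upwards [self_mem_nhdsWithin] with s hs using hpos s hs
    simpa [div_eq_mul_inv] using (tendsto_inv_nhdsGT_zero.comp h1).const_mul_atTop hC
  have hm : Tendsto m (𝓝[>] 0) atTop := tendsto_nat_floor_atTop.comp hinv
  have hmf : Tendsto (fun s => m s * f s) (𝓝[>] 0) (𝓝 C) := by
    have h1 := ((tendsto_nat_floor_div_atTop (R := ℝ)).comp hinv).const_mul C
    rw [mul_one] at h1
    refine h1.congr' ?_
    filter_upwards [self_mem_nhdsWithin] with s hs
    have := hpos s hs
    simp only [Function.comp_apply, m]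
    field_simp
  have hcmp : ∀ ε, 0 < ε → ε < 1 → ∀ᶠ s in 𝓝[>] 0,
      (1 - ε) / a (m s) ≤ s ∧ s ≤ (1 + ε) / a (m s) := by
    intro ε hε hε1
    have h1 := (h (1 - ε) (by linarith)).comp hm
    have h2 := (h (1 + ε) (by linarith)).comp hm
    have h3 : C * (1 - ε) ^ b < C := by
      have := Real.rpow_lt_one (x := 1 - ε) (by linarith) (by linarith) hb
      nlinarith
    have h4 : C < C * (1 + ε) ^ b := by
      have := Real.one_lt_rpow (x := 1 + ε) (by linarith) hb
      nlinarith
    filter_upwards [h1.eventually_lt hmf h3, hmf.eventually_lt h2 h4, self_mem_nhdsWithin]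
      with s hs1 hs2 hs0
    have hs0 : 0 < s := hs0
    have ham := ha (m s)
    have hm0 : (0 : ℝ) ≤ m s := Nat.cast_nonneg _
    constructor
    · by_contra hcon
      push Not at hcon
      exact hs1.not_ge (mul_le_mul_of_nonneg_left (hmono _ _ hs0 hcon.le) hm0)
    · by_contra hcon
      push Not at hcon
      have : 0 < (1 + ε) / a (m s) := by positivity
      exact hs2.not_ge (mul_le_mul_of_nonneg_left (hmono _ _ this hcon.le) hm0)
  intro l hl
  have hup : ∀ ε, 0 < ε → ε < 1 →
      Tendsto (fun s => (m s * f (l * (1 + ε) / a (m s))) / (m s * f s))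
      (𝓝[>] 0) (𝓝 ((l * (1 + ε)) ^ b)) := by
    intro ε hε _
    have h1 := (((h (l * (1 + ε)) (by positivity)).comp hm).div hmf hC.ne')
    rw [mul_div_cancel_left₀ _ hC.ne'] at h1
    exact h1
  have hlow : ∀ ε, 0 < ε → ε < 1 →
      Tendsto (fun s => (m s * f (l * (1 - ε) / a (m s))) / (m s * f s))
      (𝓝[>] 0) (𝓝 ((l * (1 - ε)) ^ b)) := by
    intro ε hε hε1
    have h1 := (((h (l * (1 - ε)) (mul_pos hl (by linarith))).comp hm).div hmf hC.ne')
    rw [mul_div_cancel_left₀ _ hC.ne'] at h1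
    exact h1
  have hlim1 : Tendsto (fun ε : ℝ => (l * (1 + ε)) ^ b) (𝓝[>] 0) (𝓝 (l ^ b)) := by
    have h1 : ContinuousAt (fun ε : ℝ => (l * (1 + ε)) ^ b) 0 :=
      ContinuousAt.rpow_const (by fun_prop) (Or.inr hb.le)
    have h2 := h1.tendsto
    simp only [add_zero, mul_one] at h2
    exact h2.mono_left nhdsWithin_le_nhds
  have hlim2 : Tendsto (fun ε : ℝ => (l * (1 - ε)) ^ b) (𝓝[>] 0) (𝓝 (l ^ b)) := by
    have h1 : ContinuousAt (fun ε : ℝ => (l * (1 - ε)) ^ b) 0 :=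
      ContinuousAt.rpow_const (by fun_prop) (Or.inr hb.le)
    have h2 := h1.tendsto
    simp only [sub_zero, mul_one] at h2
    exact h2.mono_left nhdsWithin_le_nhds
  have hone : ∀ᶠ ε : ℝ in 𝓝[>] 0, 0 < ε ∧ ε < 1 := Ioo_mem_nhdsGT one_pos
  have hm0 := hm.eventually (eventually_gt_atTop 0)
  rw [tendsto_order]
  refine ⟨fun c hc => ?_, fun c hc => ?_⟩
  · obtain ⟨ε, hεc, hε, hε1⟩ := ((hlim2.eventually (eventually_gt_nhds hc)).and hone).exists
    filter_upwards [(hlow ε hε hε1).eventually (eventually_gt_nhds hεc), hcmp ε hε hε1, hm0,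
      self_mem_nhdsWithin] with s hs hs1 hsm hs0
    have hs0 : 0 < s := hs0
    have hsm' : (0 : ℝ) < m s := by exact_mod_cast hsm
    rw [mul_div_mul_left _ _ hsm'.ne'] at hs
    refine hs.trans_le (div_le_div_of_nonneg_right (hmono _ _ ?_ ?_) (hpos s hs0).le)
    · exact div_pos (mul_pos hl (by linarith)) (ha _)
    · rw [mul_div_assoc]
      exact mul_le_mul_of_nonneg_left hs1.1 hl.le
  · obtain ⟨ε, hεc, hε, hε1⟩ := ((hlim1.eventually (eventually_lt_nhds hc)).and hone).exists
    filter_upwards [(hup ε hε hε1).eventually (eventually_lt_nhds hεc), hcmp ε hε hε1, hm0,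
      self_mem_nhdsWithin] with s hs hs1 hsm hs0
    have hs0 : 0 < s := hs0
    have hsm' : (0 : ℝ) < m s := by exact_mod_cast hsm
    rw [mul_div_mul_left _ _ hsm'.ne'] at hs
    refine lt_of_le_of_lt (div_le_div_of_nonneg_right (hmono _ _ (by positivity) ?_)
      (hpos s hs0).le) hs
    rw [mul_div_assoc]
    exact mul_le_mul_of_nonneg_left hs1.2 hl.le

section

variable {μ : Measure ℝ} [IsProbabilityMeasure μ]

/-- Passing to the limit in a mixture of rescaled exponents. -/
lemma tendsto_mul_integral_cosExponent {ι : Type*} {l : Filter ι} [l.IsCountablyGenerated]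
    {N σ : ι → ℝ} {k b g : ℝ → ℝ} (hN : ∀ i, 0 ≤ N i) (hk : Measurable k)
    (hkb : IntegrableOn (fun y => |k y| * b y) (Set.Ioi 0))
    (hle : ∀ᶠ i in l, ∀ y, 0 < y → N i * cosExponent μ (y * σ i) ≤ b y)
    (hlim : ∀ y, 0 < y → Tendsto (fun i => N i * cosExponent μ (y * σ i)) l (𝓝 (g y))) :
    Tendsto (fun i => N i * ∫ y in Set.Ioi 0, k y * cosExponent μ (y * σ i)) l
      (𝓝 (∫ y in Set.Ioi 0, k y * g y)) := by
  have hc := continuous_cosExponent μ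
  have h1 : Tendsto (fun i => ∫ y in Set.Ioi 0, k y * (N i * cosExponent μ (y * σ i))) l
      (𝓝 (∫ y in Set.Ioi 0, k y * g y)) := by
    refine tendsto_integral_filter_of_dominated_convergence _ ?_ ?_ hkb ?_
    · exact Eventually.of_forall fun i => hk.aestronglyMeasurable.mul
        (Continuous.aestronglyMeasurable (by fun_prop))
    · filter_upwards [hle] with i hi
      filter_upwards [ae_restrict_mem measurableSet_Ioi] with y hy
      rw [norm_mul, Real.norm_eq_abs,
        Real.norm_of_nonneg (mul_nonneg (hN i) (cosExponent_nonneg _ _))]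
      exact mul_le_mul_of_nonneg_left (hi y hy) (abs_nonneg _)
    · filter_upwards [ae_restrict_mem measurableSet_Ioi] with y hy
      exact (hlim y hy).const_mul _
  refine h1.congr fun i => ?_
  rw [← integral_const_mul]
  simp_rw [mul_left_comm]

lemma integrable_trunc (s : ℝ) : Integrable (fun x => (s * x) ^ 2 / (1 + (s * x) ^ 2)) μ := by
  refine Integrable.of_bound (Measurable.aestronglyMeasurable (by fun_prop)) 1
    (ae_of_all _ fun x => ?_)
  rw [Real.norm_of_nonneg (by positivity), div_le_one (by positivity)]
  linarith

lemma truncExponent_le_one (s : ℝ) : truncExponent μ s ≤ 1 := by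
  have h : ∀ x, (s * x) ^ 2 / (1 + (s * x) ^ 2) ≤ 1 := fun x => by
    rw [div_le_one (by positivity)]
    linarith
  simpa [truncExponent] using integral_mono (μ := μ) (integrable_trunc s) (integrable_const 1) h

lemma truncExponent_mono {s t : ℝ} (hs : 0 ≤ s) (hst : s ≤ t) :
    truncExponent μ s ≤ truncExponent μ t := by
  refine integral_mono (integrable_trunc s) (integrable_trunc t) fun x => ?_
  have h1 : (s * x) ^ 2 ≤ (t * x) ^ 2 := by
    rw [mul_pow, mul_pow]
    gcongr
  simp only
  rw [div_le_div_iff₀ (by positivity) (by positivity)]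
  linarith

lemma truncExponent_pos (hnd : ¬ ∀ᵐ x ∂μ, x = 0) {s : ℝ} (hs : 0 < s) : 0 < truncExponent μ s := by
  have hnn : ∀ x : ℝ, 0 ≤ (s * x) ^ 2 / (1 + (s * x) ^ 2) := fun x => by positivity
  refine lt_of_le_of_ne (integral_nonneg hnn) fun h => hnd ?_
  have h0 := (integral_eq_zero_iff_of_nonneg hnn (integrable_trunc s)).1 h.symm
  filter_upwards [h0] with x hx
  have h1 : (1 + (s * x) ^ 2) ≠ 0 := by positivity
  simp only [Pi.zero_apply, div_eq_zero_iff, h1, or_false] at hx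
  simpa [hs.ne'] using hx

lemma cosExponent_le_truncExponent (s : ℝ) : cosExponent μ s ≤ 4 * truncExponent μ s := by
  rw [cosExponent, truncExponent, ← integral_const_mul]
  refine integral_mono ((integrable_const _).sub (integrable_cos_mul μ s))
    ((integrable_trunc s).const_mul 4) fun x => ?_
  have h1 := Real.one_sub_sq_div_two_le_cos (x := s * x)
  have h2 := Real.neg_one_le_cos (s * x)
  simp only
  rw [← mul_div_assoc, le_div_iff₀ (by positivity)]
  nlinarith [sq_nonneg (s * x)]

/-- The truncated second moment of a symmetric law in the domain of attraction of a `β`-stable law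
is regularly varying. -/
lemma regularlyVarying_truncExponent {β : ℝ} (hβ : 0 < β) (hnd : ¬ ∀ᵐ x ∂μ, x = 0) {a : ℕ → ℝ}
    (ha : ∀ n, 0 < a n) {c K : ℝ} (hc : 0 < c)
    (hlim : ∀ t, 0 ≤ t →
      Tendsto (fun n : ℕ => n * cosExponent μ (t / a n)) atTop (𝓝 (c * t ^ β)))
    (hle : ∀ᶠ n : ℕ in atTop, ∀ t, 0 ≤ t → n * cosExponent μ (t / a n) ≤ K * (1 + t ^ 2)) :
    (∀ t, 0 < t → Tendsto (fun n : ℕ => n * truncExponent μ (t / a n)) atTop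
      (𝓝 (c * Real.Gamma (β + 1) * t ^ β))) ∧
    RegularlyVarying (truncExponent μ) β := by
  have h1 : ∀ t, 0 < t → Tendsto (fun n : ℕ => n * truncExponent μ (t / a n)) atTop
      (𝓝 (c * Real.Gamma (β + 1) * t ^ β)) := by
    intro t ht
    have hg : c * Real.Gamma (β + 1) * t ^ β
        = ∫ y in Set.Ioi 0, Real.exp (-y) * (c * (y * t) ^ β) := by
      rw [Real.Gamma_eq_integral (by linarith), mul_right_comm, ← integral_const_mul]
      refine setIntegral_congr_fun measurableSet_Ioi fun y hy => ?_
      rw [Real.mul_rpow (le_of_lt hy) ht.le, add_sub_cancel_right]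
      ring
    rw [hg]
    simp_rw [truncExponent_eq]
    refine tendsto_mul_integral_cosExponent (b := fun y => K * (1 + (y * t) ^ 2))
      (fun n => Nat.cast_nonneg n) (by fun_prop) ?_ ?_ ?_
    · have h2 : IntegrableOn (fun y : ℝ => K * Real.exp (-y)
          + K * t ^ 2 * (Real.exp (-y) * y ^ ((3 : ℝ) - 1))) (Set.Ioi 0) :=
        ((integrableOn_exp_neg_Ioi 0).const_mul K).add
          ((Real.GammaIntegral_convergent (by norm_num)).const_mul _)
      refine IntegrableOn.congr_fun h2 (fun y _ => ?_) measurableSet_Ioi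
      norm_num
      ring
    · filter_upwards [hle] with n hn y hy
      have := hn (y * t) (by positivity)
      rwa [mul_div_assoc] at this
    · intro y hy
      have := hlim (y * t) (by positivity)
      simp_rw [mul_div_assoc] at this
      exact this
  refine ⟨h1, regularlyVarying_of_tendsto (fun s t hs hst => truncExponent_mono hs.le hst)
    (fun s hs => truncExponent_pos hnd hs) ha ?_ hβ h1⟩
  exact mul_pos hc (Real.Gamma_pos_of_pos (by linarith))

end

/-! ### Regular variation of the expected discounted step length -/

lemma tendsto_const_mul_nhdsGT_zero {l : ℝ} (hl : 0 < l) :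
    Tendsto (fun s => l * s) (𝓝[>] 0) (𝓝[>] 0) := by
  refine tendsto_nhdsWithin_iff.2 ⟨?_, ?_⟩
  · have : Tendsto (fun s => l * s) (𝓝 0) (𝓝 (l * 0)) := tendsto_id.const_mul l
    rw [mul_zero] at this
    exact this.mono_left nhdsWithin_le_nhds
  · filter_upwards [self_mem_nhdsWithin] with s hs
    exact mul_pos hl hs

section

variable {μ : Measure ℝ} [IsProbabilityMeasure μ]

/-- A Potter-type bound for the truncated second moment. -/
lemma exists_truncExponent_mul_le (hnd : ¬ ∀ᵐ x ∂μ, x = 0) {β β' : ℝ} (hβ' : 0 < β')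
    (hlt : β < β') (hrv : RegularlyVarying (truncExponent μ) β) :
    ∃ K, 0 ≤ K ∧ ∀ s, 0 < s → ∀ y, 0 < y →
      truncExponent μ (y * s) ≤ K * (1 + y ^ β') * truncExponent μ s := by
  have hpos : ∀ s, 0 < s → 0 < truncExponent μ s := fun s hs => truncExponent_pos hnd hs
  have hq : (2 : ℝ) ^ β < 2 ^ β' := Real.rpow_lt_rpow_of_exponent_lt one_lt_two hlt
  obtain ⟨s₁, hs₁, hstep⟩ := mem_nhdsGT_iff_exists_Ioc_subset.1
    ((hrv 2 two_pos).eventually (eventually_lt_nhds hq))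
  have hs₁ : 0 < s₁ := hs₁
  set q : ℝ := 2 ^ β' with hqdef
  have hq1 : 1 ≤ q := Real.one_le_rpow one_le_two hβ'.le
  have hK0 : 0 < 1 / truncExponent μ s₁ := one_div_pos.2 (hpos _ hs₁)
  have hK1 : 1 ≤ 1 / truncExponent μ s₁ :=
    (one_le_div (hpos _ hs₁)).2 (truncExponent_le_one s₁)
  have hdy : ∀ k : ℕ, ∀ s, 0 < s →
      truncExponent μ (2 ^ k * s) ≤ 1 / truncExponent μ s₁ * q ^ k * truncExponent μ s := by
    intro k
    induction k with
    | zero =>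
      intro s hs
      simpa using le_mul_of_one_le_left (hpos s hs).le hK1
    | succ k ih =>
      intro s hs
      rcases le_total s s₁ with h | h
      · have h1 := hstep ⟨hs, h⟩
        simp only [Set.mem_ofPred_eq] at h1
        rw [div_lt_iff₀ (hpos s hs)] at h1
        rw [pow_succ, mul_assoc, pow_succ]
        calc _ ≤ 1 / truncExponent μ s₁ * q ^ k * truncExponent μ (2 * s) := ih _ (by positivity)
          _ ≤ 1 / truncExponent μ s₁ * q ^ k * (q * truncExponent μ s) := by gcongr
          _ = _ := by ring
      · calc _ ≤ 1 := truncExponent_le_one _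
          _ = 1 / truncExponent μ s₁ * 1 * truncExponent μ s₁ := by
              have := hpos s₁ hs₁
              field_simp
          _ ≤ 1 / truncExponent μ s₁ * q ^ (k + 1) * truncExponent μ s := by
              have h2 := one_le_pow₀ hq1 (n := k + 1)
              have h3 := truncExponent_mono (μ := μ) hs₁.le h
              have h4 := (hpos s₁ hs₁).le
              gcongr
  refine ⟨1 / truncExponent μ s₁ * q, by positivity, fun s hs y hy => ?_⟩
  have hus := (hpos s hs).le
  rcases le_total y 1 with h | h
  · have h1 : truncExponent μ (y * s) ≤ truncExponent μ s :=
      truncExponent_mono (by positivity) (mul_le_of_le_one_left hs.le h)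
    refine h1.trans (le_mul_of_one_le_left hus ?_)
    have : 0 ≤ y ^ β' := by positivity
    have h2 : 1 ≤ 1 / truncExponent μ s₁ * q := one_le_mul_of_one_le_of_one_le hK1 hq1
    exact one_le_mul_of_one_le_of_one_le h2 (by linarith)
  · obtain ⟨k, hk1, hk2⟩ := exists_nat_pow_near h one_lt_two
    have h1 : q ^ k ≤ 1 + y ^ β' := by
      have : q ^ k = ((2 : ℝ) ^ k) ^ β' := by
        rw [hqdef, ← Real.rpow_natCast, ← Real.rpow_natCast, ← Real.rpow_mul two_pos.le,
          ← Real.rpow_mul two_pos.le, mul_comm]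
      rw [this]
      have := Real.rpow_le_rpow (by positivity) hk1 hβ'.le
      linarith
    calc _ ≤ truncExponent μ (2 ^ (k + 1) * s) := truncExponent_mono (by positivity) (by gcongr)
      _ ≤ 1 / truncExponent μ s₁ * q ^ (k + 1) * truncExponent μ s := hdy _ s hs
      _ = 1 / truncExponent μ s₁ * q * q ^ k * truncExponent μ s := by ring
      _ ≤ _ := by gcongr

/-- Rescaled limits of `cosExponent` with index less than one carry over to `absExponent`. -/
lemma tendsto_mul_absExponent {ι : Type*} {l : Filter ι} [l.IsCountablyGenerated]
    {N σ : ι → ℝ} (hN : ∀ i, 0 ≤ N i) (hσ : ∀ᶠ i in l, 0 < σ i) {β β' C K : ℝ} (hβ : 0 < β)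
    (hβ1 : β < 1) (hβ' : 0 < β') (hβ'1 : β' < 1)
    (hle : ∀ᶠ i in l, ∀ y, 0 < y → N i * cosExponent μ (y * σ i) ≤ K * (1 + y ^ β'))
    (hlim : ∀ y, 0 < y → Tendsto (fun i => N i * cosExponent μ (y * σ i)) l (𝓝 (C * y ^ β))) :
    Tendsto (fun i => N i * absExponent μ (σ i)) l (𝓝 (C / Real.cos (Real.pi * β / 2))) := by
  have hkb : IntegrableOn (fun y : ℝ => |(1 + y ^ 2)⁻¹| * (K * (1 + y ^ β'))) (Set.Ioi 0) := by
    have h1 : IntegrableOn (fun y : ℝ => K * (1 + y ^ 2)⁻¹ + K * ((1 + y ^ 2)⁻¹ * y ^ β'))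
        (Set.Ioi 0) := (integrable_inv_one_add_sq.integrableOn.const_mul K).add
      ((integral_rpow_div_one_add_sq (by linarith) hβ'1).1.const_mul K)
    refine IntegrableOn.congr_fun h1 (fun y _ => ?_) measurableSet_Ioi
    rw [abs_of_pos (by positivity)]
    ring
  have h1 := (tendsto_mul_integral_cosExponent hN (by fun_prop) hkb hle hlim).const_mul
    (2 / Real.pi)
  have h2 : 2 / Real.pi * ∫ y in Set.Ioi 0, (1 + y ^ 2)⁻¹ * (C * y ^ β)
      = C / Real.cos (Real.pi * β / 2) := by
    simp_rw [mul_left_comm _ C]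
    rw [integral_const_mul, (integral_rpow_div_one_add_sq (by linarith) hβ1).2]
    have hπ := Real.pi_pos
    have : 0 < Real.cos (Real.pi * β / 2) :=
      Real.cos_pos_of_mem_Ioo ⟨by nlinarith, by nlinarith⟩
    field_simp
  rw [h2] at h1
  refine h1.congr' ?_
  filter_upwards [hσ] with i hi
  rw [absExponent_eq μ hi.le]
  ring

lemma integrable_one_sub_exp {s : ℝ} (hs : 0 ≤ s) :
    Integrable (fun x => 1 - Real.exp (-(s * |x|))) μ :=
  (integrable_const _).sub (integrable_exp_neg_abs μ hs)

lemma absExponent_mono {s t : ℝ} (hs : 0 ≤ s) (hst : s ≤ t) :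
    absExponent μ s ≤ absExponent μ t := by
  refine integral_mono (integrable_one_sub_exp hs) (integrable_one_sub_exp (hs.trans hst))
    fun x => ?_
  have : Real.exp (-(t * |x|)) ≤ Real.exp (-(s * |x|)) := by gcongr
  simp only
  linarith

lemma mul_one_sub_exp_sub_nonneg {l y : ℝ} (hl : 1 ≤ l) :
    0 ≤ l * (1 - Real.exp (-y)) - (1 - Real.exp (-(l * y))) := by
  have h1 := one_add_mul_self_le_rpow_one_add (s := Real.exp (-y) - 1)
    (by linarith [Real.exp_pos (-y)]) hl
  rw [add_sub_cancel, ← Real.exp_mul] at h1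
  rw [show -(l * y) = -y * l by ring]
  linarith

lemma div_one_add_le_one_sub_exp {y : ℝ} (hy : 0 ≤ y) : y / (1 + y) ≤ 1 - Real.exp (-y) := by
  have h1 : Real.exp (-y) ≤ 1 / (1 + y) := by
    rw [Real.exp_neg, ← one_div]
    exact one_div_le_one_div_of_le (by linarith) (by linarith [Real.add_one_le_exp y])
  have h2 : y / (1 + y) = 1 - 1 / (1 + y) := by field_simp; ring
  linarith

lemma mul_one_sub_exp_sub_le {l y : ℝ} (hl : 1 ≤ l) (hy : 0 ≤ y) :
    l * (1 - Real.exp (-y)) - (1 - Real.exp (-(l * y))) ≤ 2 * l ^ 2 * (y ^ 2 / (1 + y ^ 2)) := by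
  have h1 := Real.add_one_le_exp (-y)
  have hly : 0 ≤ l * y := by positivity
  have h2 := div_one_add_le_one_sub_exp hly
  have h3 : l * y - l * y / (1 + l * y) ≤ (l * y) ^ 2 := by
    have : l * y - l * y / (1 + l * y) = (l * y) ^ 2 / (1 + l * y) := by field_simp; ring
    rw [this]
    exact div_le_self (sq_nonneg _) (by linarith)
  have h4 := (one_sub_exp_mem hly).1
  have h5 := Real.exp_pos (-y)
  have h6 : l * (1 - Real.exp (-y)) - (1 - Real.exp (-(l * y))) ≤ l ^ 2 * y ^ 2 := by
    have : l * (1 - Real.exp (-y)) ≤ l * y := by gcongr; linarith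
    nlinarith
  have h7 : l * (1 - Real.exp (-y)) - (1 - Real.exp (-(l * y))) ≤ l ^ 2 := by nlinarith
  rw [← mul_div_assoc, le_div_iff₀ (by positivity)]
  nlinarith [mul_le_mul_of_nonneg_right h7 (sq_nonneg y)]

/-- The defect of homogeneity of `absExponent` is controlled by the truncated second moment. -/
lemma mul_absExponent_sub {l s : ℝ} (hl : 1 ≤ l) (hs : 0 ≤ s) :
    0 ≤ l * absExponent μ s - absExponent μ (l * s) ∧
    l * absExponent μ s - absExponent μ (l * s) ≤ 2 * l ^ 2 * truncExponent μ s := by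
  have hls : 0 ≤ l * s := by positivity
  have h1 : l * absExponent μ s - absExponent μ (l * s)
      = ∫ x, (l * (1 - Real.exp (-(s * |x|))) - (1 - Real.exp (-(l * (s * |x|))))) ∂μ := by
    simp_rw [← mul_assoc l s]
    rw [integral_sub ((integrable_one_sub_exp hs).const_mul l) (integrable_one_sub_exp hls),
      integral_const_mul]
    rfl
  rw [h1]
  constructor
  · exact integral_nonneg fun x => mul_one_sub_exp_sub_nonneg hl
  · rw [truncExponent, ← integral_const_mul]
    refine integral_mono ?_ ((integrable_trunc s).const_mul _) fun x => ?_
    · simp_rw [← mul_assoc l s]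
      exact ((integrable_one_sub_exp hs).const_mul l).sub (integrable_one_sub_exp hls)
    · have := mul_one_sub_exp_sub_le hl (mul_nonneg hs (abs_nonneg x))
      simpa only [mul_pow, sq_abs] using this

lemma sum_trunc_le (n : ℕ) {y : ℝ} (hy : 0 ≤ y) :
    ∑ k ∈ Finset.range n, (1 / 2 : ℝ) ^ k * ((2 ^ k * y) ^ 2 / (1 + (2 ^ k * y) ^ 2))
      ≤ 4 * (y / (1 + y)) := by
  induction n generalizing y with
  | zero => simp; positivity
  | succ n ih =>
    rw [Finset.sum_range_succ']
    have h1 := ih (y := 2 * y) (by positivity)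
    have h2 : ∑ k ∈ Finset.range n, (1 / 2 : ℝ) ^ (k + 1)
          * ((2 ^ (k + 1) * y) ^ 2 / (1 + (2 ^ (k + 1) * y) ^ 2))
        = 1 / 2 * ∑ k ∈ Finset.range n, (1 / 2 : ℝ) ^ k
          * ((2 ^ k * (2 * y)) ^ 2 / (1 + (2 ^ k * (2 * y)) ^ 2)) := by
      rw [Finset.mul_sum]
      refine Finset.sum_congr rfl fun k _ => ?_
      ring_nf
    rw [h2]
    have h3 : y ^ 2 / (1 + y ^ 2) ≤ 4 * (y / (1 + y)) - 1 / 2 * (4 * (2 * y / (1 + 2 * y))) := by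
      have : 4 * (y / (1 + y)) - 1 / 2 * (4 * (2 * y / (1 + 2 * y)))
          = 4 * y ^ 2 / ((1 + y) * (1 + 2 * y)) := by field_simp; ring
      rw [this, div_le_div_iff₀ (by positivity) (by positivity)]
      nlinarith [mul_nonneg (sq_nonneg y) (sq_nonneg (4 * y - 3)), sq_nonneg y]
    simp only [pow_zero, one_mul]
    linarith

/-- The dyadic sums of the truncated second moment stay below `absExponent`. For
regular variation with index at least `1`, each summand is asymptotically at least the first one, so
the truncated second moment is negligible with respect to `absExponent`. -/
lemma sum_truncExponent_le (n : ℕ) {s : ℝ} (hs : 0 ≤ s) :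
    ∑ k ∈ Finset.range n, (1 / 2 : ℝ) ^ k * truncExponent μ (2 ^ k * s)
      ≤ 4 * absExponent μ s := by
  simp only [truncExponent, absExponent, ← integral_const_mul]
  rw [← integral_finsetSum _ fun k _ => (integrable_trunc _).const_mul _]
  refine integral_mono (integrable_finsetSum _ fun k _ => (integrable_trunc _).const_mul _)
    ((integrable_one_sub_exp hs).const_mul 4) fun x => ?_
  have h1 := sum_trunc_le n (mul_nonneg hs (abs_nonneg x))
  have h2 := div_one_add_le_one_sub_exp (mul_nonneg hs (abs_nonneg x))
  have h3 : ∀ k : ℕ, (2 ^ k * (s * |x|)) ^ 2 = ((2 : ℝ) ^ k * s * x) ^ 2 := fun k => by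
    rw [← mul_assoc, mul_pow _ |x|, sq_abs, ← mul_pow]
  simp_rw [h3] at h1
  simp only
  linarith

/-- If the truncated second moment is regularly varying with index at least one, it is negligible
with respect to `absExponent`. -/
lemma tendsto_truncExponent_div (hnd : ¬ ∀ᵐ x ∂μ, x = 0) {β : ℝ} (hβ : 1 ≤ β)
    (hrv : RegularlyVarying (truncExponent μ) β) :
    Tendsto (fun s => truncExponent μ s / absExponent μ s) (𝓝[>] 0) (𝓝 0) := by
  rw [tendsto_order]
  refine ⟨fun c hc => ?_, fun c hc => ?_⟩
  · filter_upwards [self_mem_nhdsWithin] with s hs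
    exact hc.trans (div_pos (truncExponent_pos hnd hs) (absExponent_pos hnd hs))
  · obtain ⟨n, hn⟩ := exists_nat_gt (8 / c)
    have hn0 : (0 : ℝ) < n := lt_trans (by positivity) hn
    have h1 : Tendsto (fun s => ∑ k ∈ Finset.range n, (1 / 2 : ℝ) ^ k *
        (truncExponent μ (2 ^ k * s) / truncExponent μ s)) (𝓝[>] 0)
        (𝓝 (∑ k ∈ Finset.range n, (1 / 2 : ℝ) ^ k * ((2 : ℝ) ^ k) ^ β)) :=
      tendsto_finsetSum _ fun k _ => (hrv (2 ^ k) (by positivity)).const_mul _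
    have h2 : (n : ℝ) ≤ ∑ k ∈ Finset.range n, (1 / 2 : ℝ) ^ k * ((2 : ℝ) ^ k) ^ β := by
      calc (n : ℝ) = ∑ k ∈ Finset.range n, 1 := by simp
        _ ≤ _ := by
          refine Finset.sum_le_sum fun k _ => ?_
          have h3 : (2 : ℝ) ^ k ≤ ((2 : ℝ) ^ k) ^ β := by
            conv_lhs => rw [← Real.rpow_one ((2 : ℝ) ^ k)]
            exact Real.rpow_le_rpow_of_exponent_le (one_le_pow₀ one_le_two) hβ
          calc (1 : ℝ) = (1 / 2) ^ k * 2 ^ k := by rw [← mul_pow]; norm_num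
            _ ≤ _ := by gcongr
    filter_upwards [h1.eventually (eventually_gt_nhds (show (n : ℝ) / 2 < _ by linarith)),
      self_mem_nhdsWithin] with s hs hs0
    have hs0 : 0 < s := hs0
    have hu := truncExponent_pos hnd hs0
    have hw := absExponent_pos hnd hs0
    have h4 := sum_truncExponent_le (μ := μ) n hs0.le
    have h5 : ∑ k ∈ Finset.range n, (1 / 2 : ℝ) ^ k *
        (truncExponent μ (2 ^ k * s) / truncExponent μ s)
        = (∑ k ∈ Finset.range n, (1 / 2 : ℝ) ^ k * truncExponent μ (2 ^ k * s))
          / truncExponent μ s := by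
      rw [Finset.sum_div]
      simp_rw [mul_div_assoc]
    rw [h5, lt_div_iff₀ hu] at hs
    rw [div_lt_iff₀ hw]
    rw [div_lt_iff₀ hc] at hn
    nlinarith

lemma regularlyVarying_absExponent_of_one_le (hnd : ¬ ∀ᵐ x ∂μ, x = 0) {β : ℝ} (hβ : 1 ≤ β)
    (hrv : RegularlyVarying (truncExponent μ) β) : RegularlyVarying (absExponent μ) 1 := by
  have h1 : ∀ l, 1 ≤ l →
      Tendsto (fun s => absExponent μ (l * s) / absExponent μ s) (𝓝[>] 0) (𝓝 l) := by
    intro l hl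
    have h2 := ((tendsto_truncExponent_div hnd hβ hrv).const_mul (2 * l ^ 2)).const_sub l
    rw [mul_zero, sub_zero] at h2
    refine tendsto_of_tendsto_of_tendsto_of_le_of_le' h2 tendsto_const_nhds ?_ ?_
    · filter_upwards [self_mem_nhdsWithin] with s hs
      have hs : 0 < s := hs
      have hw := absExponent_pos hnd hs
      have h3 := (mul_absExponent_sub (μ := μ) hl hs.le).2
      rw [le_div_iff₀ hw, sub_mul, ← mul_div_assoc, div_mul_cancel₀ _ hw.ne']
      linarith
    · filter_upwards [self_mem_nhdsWithin] with s hs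
      have hs : 0 < s := hs
      have hw := absExponent_pos hnd hs
      have h3 := (mul_absExponent_sub (μ := μ) hl hs.le).1
      rw [div_le_iff₀ hw]
      linarith
  intro l hl
  rw [Real.rpow_one]
  rcases le_total 1 l with h | h
  · exact h1 l h
  · have hl' : 1 ≤ l⁻¹ := (one_le_inv₀ hl).2 h
    have h2 := tendsto_const_mul_nhdsGT_zero hl
    have h3 := ((h1 l⁻¹ hl').comp h2).inv₀ (by positivity)
    rw [inv_inv] at h3
    refine h3.congr fun s => ?_
    simp only [Function.comp_apply]
    rw [inv_mul_cancel_left₀ hl.ne', inv_div]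

/-- If the truncated second moment is regularly varying with index greater than one, the law has a
finite first moment. -/
lemma integrable_of_regularlyVarying (hnd : ¬ ∀ᵐ x ∂μ, x = 0) {β : ℝ} (hβ : 1 < β)
    (hrv : RegularlyVarying (truncExponent μ) β) : Integrable (fun x => x) μ := by
  let d : ℕ → ℝ := fun k => 2 ^ k * truncExponent μ ((1 / 2) ^ (k + 1))
  have hd0 : ∀ k, 0 < d k := fun k =>
    mul_pos (by positivity) (truncExponent_pos hnd (by positivity))
  have hseq : Tendsto (fun k : ℕ => (1 / 2 : ℝ) ^ (k + 1)) atTop (𝓝[>] 0) := by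
    refine tendsto_nhdsWithin_iff.2 ⟨?_, Eventually.of_forall fun k => ?_⟩
    · exact (tendsto_add_atTop_iff_nat 1).2
        (tendsto_pow_atTop_nhds_zero_of_lt_one (by norm_num) (by norm_num))
    · exact Set.mem_Ioi.2 (by positivity)
  have hsum : Summable d := by
    have h1 : (2 : ℝ) * (1 / 2) ^ β < 1 := by
      have : (1 / 2 : ℝ) ^ β < (1 / 2) ^ (1 : ℝ) :=
        Real.rpow_lt_rpow_of_exponent_gt (by norm_num) (by norm_num) hβ
      rw [Real.rpow_one] at this
      linarith
    refine summable_of_ratio_test_tendsto_lt_one h1 (Eventually.of_forall fun k => (hd0 k).ne') ?_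
    refine (((hrv (1 / 2) (by norm_num)).comp hseq).const_mul 2).congr fun k => ?_
    rw [Real.norm_of_nonneg (hd0 _).le, Real.norm_of_nonneg (hd0 _).le]
    simp only [d, Function.comp_apply]
    rw [← pow_succ', pow_succ 2, mul_assoc, mul_div_mul_left _ _ (by positivity), mul_div_assoc]
  have hw : ∀ n : ℕ, 2 ^ n * absExponent μ ((1 / 2) ^ n)
      ≤ absExponent μ 1 + 8 * ∑ k ∈ Finset.range n, d k := by
    intro n
    induction n with
    | zero => simp
    | succ n ih =>
      have h1 := (mul_absExponent_sub (μ := μ) one_le_two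
        (by positivity : (0 : ℝ) ≤ (1 / 2) ^ (n + 1))).2
      have h2 : (2 : ℝ) * (1 / 2) ^ (n + 1) = (1 / 2) ^ n := by
        rw [pow_succ]; ring
      rw [h2] at h1
      have h3 := mul_le_mul_of_nonneg_left h1 (by positivity : (0 : ℝ) ≤ 2 ^ n)
      rw [Finset.sum_range_succ, pow_succ 2]
      simp only [d] at ih ⊢
      linarith
  have hcover : AECover μ atTop fun n : ℕ => {x : ℝ | |x| ≤ 2 ^ n} := by
    refine ⟨ae_of_all _ fun x => ?_, fun n => measurableSet_le (by fun_prop) (by fun_prop)⟩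
    exact (tendsto_pow_atTop_atTop_of_one_lt one_lt_two).eventually_ge_atTop |x|
  refine hcover.integrable_of_integral_norm_bounded
    (2 * (absExponent μ 1 + 8 * ∑' k, d k)) (fun n => ?_) (Eventually.of_forall fun n => ?_)
  · refine Integrable.of_bound (by fun_prop) (2 ^ n) ?_
    filter_upwards [ae_restrict_mem (hcover.measurableSet n)] with x hx using hx
  · have h1 : (2 : ℝ) ^ n * absExponent μ ((1 / 2) ^ n)
        = ∫ x, 2 ^ n * (1 - Real.exp (-((1 / 2) ^ n * |x|))) ∂μ := by
      rw [integral_const_mul]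
      rfl
    have hi : Integrable (fun x => 2 ^ n * (1 - Real.exp (-((1 / 2 : ℝ) ^ n * |x|)))) μ :=
      (integrable_one_sub_exp (by positivity)).const_mul _
    have hnn : ∀ x : ℝ, 0 ≤ 2 ^ n * (1 - Real.exp (-((1 / 2 : ℝ) ^ n * |x|))) := fun x =>
      mul_nonneg (by positivity) (one_sub_exp_mem (by positivity)).1
    calc ∫ x in {x : ℝ | |x| ≤ 2 ^ n}, ‖x‖ ∂μ
        ≤ ∫ x in {x : ℝ | |x| ≤ 2 ^ n}, 2 * (2 ^ n * (1 - Real.exp (-((1 / 2) ^ n * |x|)))) ∂μ := by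
          refine setIntegral_mono_on ?_ (hi.const_mul 2).integrableOn (hcover.measurableSet n)
            fun x hx => ?_
          · refine Integrable.of_bound (by fun_prop) (2 ^ n) ?_
            filter_upwards [ae_restrict_mem (hcover.measurableSet n)] with x hx
            rw [norm_norm]
            exact hx
          · have hx' : |x| ≤ 2 ^ n := hx
            have h2 := div_one_add_le_one_sub_exp
              (by positivity : (0 : ℝ) ≤ (1 / 2) ^ n * |x|)
            have h3 : (1 / 2 : ℝ) ^ n * |x| ≤ 1 := by
              calc (1 / 2 : ℝ) ^ n * |x| ≤ (1 / 2) ^ n * 2 ^ n := by gcongr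
                _ = 1 := by rw [← mul_pow]; norm_num
            have h4 : (1 / 2 : ℝ) ^ n * |x| / 2 ≤ 1 - Real.exp (-((1 / 2) ^ n * |x|)) := by
              refine le_trans ?_ h2
              gcongr
              linarith
            rw [Real.norm_eq_abs]
            calc |x| = 2 * (2 ^ n * ((1 / 2 : ℝ) ^ n * |x| / 2)) := by
                  have : (2 : ℝ) ^ n * (1 / 2) ^ n = 1 := by rw [← mul_pow]; norm_num
                  linear_combination (-|x|) * this
              _ ≤ _ := by gcongr
      _ ≤ ∫ x, 2 * (2 ^ n * (1 - Real.exp (-((1 / 2) ^ n * |x|)))) ∂μ :=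
          setIntegral_le_integral (hi.const_mul 2)
            (ae_of_all _ fun x => mul_nonneg two_pos.le (hnn x))
      _ = 2 * (2 ^ n * absExponent μ ((1 / 2) ^ n)) := by rw [integral_const_mul, ← h1]
      _ ≤ _ := by
          have h5 := hsum.sum_le_tsum (Finset.range n) fun k _ => (hd0 k).le
          have h6 := hw n
          linarith

end

/-- For a symmetric law in the domain of attraction of a `β`-stable law, `absExponent` is
regularly varying with index `min 1 β`, and the first moment is finite if `β > 1`. -/
lemma regularlyVarying_absExponent {μ : Measure ℝ} [IsProbabilityMeasure μ] {β : ℝ} (hβ : 0 < β)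
    (hsymm : μ.map (fun x => -x) = μ) (hDA : InDomainOfAttraction β μ) :
    (¬ ∀ᵐ x ∂μ, x = 0) ∧ RegularlyVarying (absExponent μ) (min 1 β) ∧
      (1 < β → Integrable (fun x => x) μ) := by
  obtain ⟨a, ha, c, hc, K, hlim, hle⟩ := exists_normalization hβ hsymm hDA
  have hnd : ¬ ∀ᵐ x ∂μ, x = 0 := by
    intro h0
    have h2 : ∀ t, cosExponent μ t = 0 := fun t => by
      refine integral_eq_zero_of_ae ?_
      filter_upwards [h0] with x hx
      simp [hx]
    have h3 := hlim 1 zero_le_one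
    simp only [h2, mul_zero, Real.one_rpow, mul_one] at h3
    exact hc.ne (tendsto_nhds_unique tendsto_const_nhds h3)
  obtain ⟨hU, hrv⟩ := regularlyVarying_truncExponent hβ hnd ha hc hlim hle
  refine ⟨hnd, ?_, fun h => integrable_of_regularlyVarying hnd h hrv⟩
  rcases lt_or_ge β 1 with h1 | h1
  · rw [min_eq_right h1.le]
    have hcos : 0 < Real.cos (Real.pi * β / 2) := by
      have hπ := Real.pi_pos
      exact Real.cos_pos_of_mem_Ioo ⟨by nlinarith, by nlinarith⟩
    obtain ⟨K', hK', hPot⟩ := exists_truncExponent_mul_le hnd (β' := (β + 1) / 2) (by linarith)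
      (by linarith) hrv
    refine regularlyVarying_of_tendsto (fun s t hs hst => absExponent_mono hs.le hst)
      (fun s hs => absExponent_pos hnd hs) ha (C := c / Real.cos (Real.pi * β / 2))
      (div_pos hc hcos) hβ fun t ht => ?_
    rw [div_mul_eq_mul_div]
    refine tendsto_mul_absExponent (β' := (β + 1) / 2)
      (K := 4 * K' * (c * Real.Gamma (β + 1) * t ^ β + 1)) (fun n => Nat.cast_nonneg n)
      (Eventually.of_forall fun n => div_pos ht (ha n)) hβ h1 (by linarith) (by linarith) ?_ ?_
    · filter_upwards [(hU t ht).eventually (eventually_le_nhds (lt_add_one _))] with n hn y hy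
      have h2 := hPot (t / a n) (div_pos ht (ha n)) y hy
      have h3 := cosExponent_le_truncExponent (μ := μ) (y * (t / a n))
      calc _ ≤ n * (4 * (K' * (1 + y ^ ((β + 1) / 2)) * truncExponent μ (t / a n))) := by
            gcongr
            linarith
        _ = 4 * K' * (n * truncExponent μ (t / a n)) * (1 + y ^ ((β + 1) / 2)) := by ring
        _ ≤ _ := by gcongr
    · intro y hy
      have h2 := hlim (y * t) (by positivity)
      rw [Real.mul_rpow hy.le ht.le, mul_comm (y ^ β), ← mul_assoc] at h2
      simp_rw [mul_div_assoc] at h2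
      exact h2
  · rw [min_eq_left h1]
    exact regularlyVarying_absExponent_of_one_le hnd h1 hrv

/-! ### The precise behaviour of the expected discounted step length -/

lemma tendsto_absExponent_div_of_integrable {μ : Measure ℝ}
    (hint : Integrable (fun x => x) μ) :
    Tendsto (fun s => absExponent μ s / s) (𝓝[>] 0) (𝓝 (∫ x, |x| ∂μ)) := by
  have h1 : Tendsto (fun s => ∫ x, (1 - Real.exp (-(s * |x|))) / s ∂μ) (𝓝[>] 0)
      (𝓝 (∫ x, |x| ∂μ)) := by
    refine tendsto_integral_filter_of_dominated_convergence (fun x => |x|)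
      (Eventually.of_forall fun s => by fun_prop) ?_ hint.abs (ae_of_all _ fun x => ?_)
    · filter_upwards [self_mem_nhdsWithin] with s hs
      have hs : 0 < s := hs
      refine ae_of_all _ fun x => ?_
      have h2 := (one_sub_exp_mem (a := s * |x|) (by positivity)).1
      have h3 := Real.add_one_le_exp (-(s * |x|))
      rw [Real.norm_of_nonneg (div_nonneg h2 hs.le), div_le_iff₀ hs]
      linarith
    · have h2 : HasDerivAt (fun s : ℝ => 1 - Real.exp (-(s * |x|))) |x| 0 := by
        have h3 : HasDerivAt (fun s : ℝ => -(s * |x|)) (-|x|) 0 := by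
          simpa using! ((hasDerivAt_id (0 : ℝ)).mul_const |x|).neg
        simpa using h3.exp.const_sub 1
      have h4 := h2.tendsto_slope.mono_left
        (nhdsWithin_mono 0 (fun s (hs : 0 < s) => hs.ne') : 𝓝[>] (0 : ℝ) ≤ 𝓝[≠] 0)
      refine h4.congr fun s => ?_
      simp [slope_def_field]
  refine h1.congr fun s => ?_
  rw [integral_div]
  rfl

section

variable {μ : Measure ℝ} [IsProbabilityMeasure μ]

/-- A power-like behaviour of `cosExponent` at `0+` gives a global upper bound, because
`cosExponent` is bounded. -/
lemma exists_cosExponent_le_rpow {β ν : ℝ} (hβ : 0 < β)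
    (h : Tendsto (fun s => cosExponent μ s / s ^ β) (𝓝[>] 0) (𝓝 ν)) :
    ∃ K, 0 ≤ K ∧ ∀ s, 0 < s → cosExponent μ s ≤ K * s ^ β := by
  obtain ⟨δ, hδ, hb⟩ := mem_nhdsGT_iff_exists_Ioc_subset.1
    (h.eventually (eventually_le_nhds (lt_add_one ν)))
  have hδ : 0 < δ := hδ
  have hδβ : 0 < δ ^ β := Real.rpow_pos_of_pos hδ β
  refine ⟨max (ν + 1) (2 / δ ^ β), le_max_of_le_right (by positivity), fun s hs => ?_⟩
  have hsβ : 0 < s ^ β := Real.rpow_pos_of_pos hs β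
  rcases le_total s δ with hsd | hsd
  · have h1 := hb ⟨hs, hsd⟩
    simp only [Set.mem_ofPred_eq] at h1
    rw [div_le_iff₀ hsβ] at h1
    exact h1.trans (by gcongr; exact le_max_left _ _)
  · calc cosExponent μ s ≤ 2 := cosExponent_le_two μ s
      _ = 2 / δ ^ β * δ ^ β := by field_simp
      _ ≤ 2 / δ ^ β * s ^ β := by gcongr
      _ ≤ _ := by gcongr; exact le_max_right _ _

/-- Index below `1`: the Cauchy mixture converges by dominated convergence. -/
lemma tendsto_absExponent_div_rpow {β ν : ℝ} (hβ : 0 < β) (hβ1 : β < 1)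
    (h : Tendsto (fun s => cosExponent μ s / s ^ β) (𝓝[>] 0) (𝓝 ν)) :
    Tendsto (fun s => absExponent μ s / s ^ β) (𝓝[>] 0)
      (𝓝 (ν / Real.cos (Real.pi * β / 2))) := by
  obtain ⟨K, hK, hle⟩ := exists_cosExponent_le_rpow hβ h
  have h1 : Tendsto (fun s => |s ^ β|⁻¹ * absExponent μ s) (𝓝[>] 0)
      (𝓝 (ν / Real.cos (Real.pi * β / 2))) := by
    refine tendsto_mul_absExponent (β' := β) (K := K) (fun s => by positivity)
      self_mem_nhdsWithin hβ hβ1 hβ hβ1 ?_ fun y hy => ?_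
    · filter_upwards [self_mem_nhdsWithin] with s hs y hy
      have hs : 0 < s := hs
      have hsβ : 0 < s ^ β := Real.rpow_pos_of_pos hs β
      have h2 := hle (y * s) (by positivity)
      rw [Real.mul_rpow hy.le hs.le] at h2
      rw [abs_of_pos hsβ, inv_mul_eq_div, div_le_iff₀ hsβ]
      nlinarith [mul_nonneg hK hsβ.le]
    · have h2 : Tendsto (fun s => y * s) (𝓝[>] 0) (𝓝[>] 0) := by
        refine tendsto_nhdsWithin_iff.2 ⟨?_, ?_⟩
        · have : Tendsto (fun s => y * s) (𝓝 0) (𝓝 (y * 0)) := tendsto_id.const_mul y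
          rw [mul_zero] at this
          exact this.mono_left nhdsWithin_le_nhds
        · filter_upwards [self_mem_nhdsWithin] with s hs
          exact mul_pos hy hs
      refine ((h.comp h2).mul_const (y ^ β)).congr' ?_
      filter_upwards [self_mem_nhdsWithin] with s hs
      have hs : 0 < s := hs
      have hsβ : 0 < s ^ β := Real.rpow_pos_of_pos hs β
      have hyβ : 0 < y ^ β := Real.rpow_pos_of_pos hy β
      simp only [Function.comp_apply]
      rw [abs_of_pos hsβ, Real.mul_rpow hy.le hs.le]
      field_simp
  refine h1.congr' ?_
  filter_upwards [self_mem_nhdsWithin] with s hs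
  have hs : 0 < s := hs
  rw [abs_of_pos (Real.rpow_pos_of_pos hs β), inv_mul_eq_div]

lemma integral_mul_inv_one_add_sq {b : ℝ} :
    ∫ y in (0 : ℝ)..b, (1 + y ^ 2)⁻¹ * y = Real.log (1 + b ^ 2) / 2 := by
  have hd : ∀ y ∈ Set.uIcc 0 b, HasDerivAt (fun y : ℝ => Real.log (1 + y ^ 2) / 2)
      ((1 + y ^ 2)⁻¹ * y) y := by
    intro y _
    have h1 : HasDerivAt (fun y : ℝ => 1 + y ^ 2) (2 * y) y := by
      simpa using (hasDerivAt_pow 2 y).const_add 1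
    have h2 := (h1.log (by positivity)).div_const 2
    convert! h2 using 1
    field_simp
  rw [intervalIntegral.integral_eq_sub_of_hasDerivAt hd]
  · simp
  · refine Continuous.intervalIntegrable (Continuous.mul (Continuous.inv₀ (by fun_prop) ?_)
      continuous_id) _ _
    intro y
    positivity

/-- In the critical case `β = 1` the expected discounted step length has a logarithmic
correction. It comes from the range `u ≤ δ` in `∫ (1 - φ u) s / (s² + u²) du`; the rest is
`O(s)`. -/
lemma tendsto_absExponent_div_mul_log {ν : ℝ}
    (h : Tendsto (fun s => cosExponent μ s / s) (𝓝[>] 0) (𝓝 ν)) :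
    Tendsto (fun s => absExponent μ s / (s * Real.log (1 / s))) (𝓝[>] 0)
      (𝓝 (2 * ν / Real.pi)) := by
  have hπ := Real.pi_pos
  have hlog : Tendsto (fun s : ℝ => Real.log (1 / s)) (𝓝[>] 0) atTop := by
    simp_rw [one_div]
    exact Real.tendsto_log_atTop.comp tendsto_inv_nhdsGT_zero
  -- the main part of the integral, for a fixed `δ`
  have hmain : ∀ δ, 0 < δ → Tendsto (fun s : ℝ => Real.log (1 + (δ / s) ^ 2) / 2
      / Real.log (1 / s)) (𝓝[>] 0) (𝓝 1) := by
    intro δ hδ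
    have h1 : Tendsto (fun s : ℝ => Real.log (s ^ 2 + δ ^ 2) / 2 / Real.log (1 / s) + 1)
        (𝓝[>] 0) (𝓝 (0 + 1)) := by
      refine Tendsto.add_const 1 ?_
      have h2 : ContinuousAt (fun s : ℝ => Real.log (s ^ 2 + δ ^ 2) / 2) 0 :=
        ContinuousAt.div_const (ContinuousAt.log (by fun_prop) (by positivity)) 2
      exact (h2.tendsto.mono_left nhdsWithin_le_nhds).div_atTop hlog
    rw [zero_add] at h1
    refine h1.congr' ?_
    filter_upwards [self_mem_nhdsWithin, hlog.eventually (eventually_gt_atTop 0)] with s hs hl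
    have hs : 0 < s := hs
    have h3 : 1 + (δ / s) ^ 2 = (s ^ 2 + δ ^ 2) * (1 / s) ^ 2 := by
      field_simp
    rw [h3, Real.log_mul (by positivity) (by positivity), Real.log_pow]
    field_simp
    push_cast
    ring
  -- splitting the integral at `δ / s`
  have hsplit : ∀ δ, 0 < δ → ∀ s, 0 < s → ∃ R, 0 ≤ R ∧ R ≤ 2 * s / δ ∧ absExponent μ s
      = 2 / Real.pi * ((∫ y in (0 : ℝ)..(δ / s), (1 + y ^ 2)⁻¹ * cosExponent μ (y * s)) + R) := by
    intro δ hδ s hs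
    have hb : 0 < δ / s := by positivity
    have hi := integrableOn_mul_cosExponent μ integrable_inv_one_add_sq.integrableOn s
    refine ⟨∫ y in Set.Ioi (δ / s), (1 + y ^ 2)⁻¹ * cosExponent μ (y * s), ?_, ?_, ?_⟩
    · exact integral_nonneg fun y => mul_nonneg (by positivity) (cosExponent_nonneg _ _)
    · have h1 : ∫ y in Set.Ioi (δ / s), (2 : ℝ) * y ^ (-2 : ℝ) = 2 * s / δ := by
        rw [integral_const_mul, integral_Ioi_rpow_of_lt (by norm_num) hb]
        norm_num
        rw [Real.rpow_neg_one]
        field_simp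
      rw [← h1]
      refine setIntegral_mono_on (hi.mono_set (Set.Ioi_subset_Ioi hb.le))
        ((integrableOn_Ioi_rpow_of_lt (by norm_num) hb).const_mul 2) measurableSet_Ioi
        fun y hy => ?_
      have hy : 0 < y := hb.trans hy
      have h2 := cosExponent_le_two μ (y * s)
      rw [mul_comm, Real.rpow_neg hy.le, Real.rpow_two]
      gcongr
      linarith
    · rw [absExponent_eq μ hs.le, intervalIntegral.integral_of_le hb.le,
        ← setIntegral_union Set.Ioc_disjoint_Ioi_same measurableSet_Ioi
          (hi.mono_set Set.Ioc_subset_Ioi_self) (hi.mono_set (Set.Ioi_subset_Ioi hb.le)),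
        Set.Ioc_union_Ioi_eq_Ioi hb.le]
  have hc := continuous_cosExponent μ
  have hci : ∀ s b : ℝ, IntervalIntegrable (fun y : ℝ => (1 + y ^ 2)⁻¹ * cosExponent μ (y * s))
      volume 0 b := fun s b =>
    Continuous.intervalIntegrable (Continuous.mul (Continuous.inv₀ (by fun_prop)
      fun y => by positivity) (by fun_prop)) _ _
  have hci' : ∀ s b : ℝ, IntervalIntegrable (fun y : ℝ => s * ((1 + y ^ 2)⁻¹ * y))
      volume 0 b := fun s b =>
    Continuous.intervalIntegrable (continuous_const.mul (Continuous.mul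
      (Continuous.inv₀ (by fun_prop) fun y => by positivity) (by fun_prop))) _ _
  rw [tendsto_order]
  constructor
  · intro c hc'
    obtain ⟨κ, hκ1, hκ2⟩ := exists_between (show c * Real.pi / 2 < ν by
      rw [div_lt_iff₀ two_pos]
      rw [lt_div_iff₀ hπ] at hc'
      linarith)
    obtain ⟨δ, hδ, hb⟩ := mem_nhdsGT_iff_exists_Ioc_subset.1
      (h.eventually (eventually_gt_nhds hκ2))
    have hδ : 0 < δ := hδ
    have h1 := (hmain δ hδ).const_mul (2 / Real.pi * κ)
    have h2 : c < 2 / Real.pi * κ * 1 := by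
      rw [mul_one, div_mul_eq_mul_div, lt_div_iff₀ hπ]
      linarith
    filter_upwards [h1.eventually (eventually_gt_nhds h2), self_mem_nhdsWithin,
      hlog.eventually (eventually_gt_atTop 0)] with s hs hs0 hl
    have hs0 : 0 < s := hs0
    refine hs.trans_le ?_
    obtain ⟨R, hR, -, heq⟩ := hsplit δ hδ s hs0
    rw [heq, le_div_iff₀ (by positivity)]
    have h3 : κ * s * (Real.log (1 + (δ / s) ^ 2) / 2)
        ≤ ∫ y in (0 : ℝ)..(δ / s), (1 + y ^ 2)⁻¹ * cosExponent μ (y * s) := by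
      rw [← integral_mul_inv_one_add_sq, ← intervalIntegral.integral_const_mul]
      refine intervalIntegral.integral_mono_on (by positivity) (hci' _ _) (hci _ _) fun y hy => ?_
      rcases hy.1.eq_or_lt with h0 | h0
      · simp [← h0]
      · have h4 := hb ⟨mul_pos h0 hs0, by
          have := mul_le_mul_of_nonneg_right hy.2 hs0.le
          rwa [div_mul_cancel₀ _ hs0.ne'] at this⟩
        simp only [Set.mem_ofPred_eq] at h4
        rw [lt_div_iff₀ (mul_pos h0 hs0)] at h4
        calc κ * s * ((1 + y ^ 2)⁻¹ * y) = (1 + y ^ 2)⁻¹ * (κ * (y * s)) := by ring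
          _ ≤ _ := by gcongr
    calc 2 / Real.pi * κ * (Real.log (1 + (δ / s) ^ 2) / 2 / Real.log (1 / s))
          * (s * Real.log (1 / s))
        = 2 / Real.pi * (κ * s * (Real.log (1 + (δ / s) ^ 2) / 2)) := by field_simp
      _ ≤ _ := by gcongr; linarith
  · intro c hc'
    obtain ⟨κ, hκ1, hκ2⟩ := exists_between (show ν < c * Real.pi / 2 by
      rw [lt_div_iff₀ two_pos]
      rw [gt_iff_lt, div_lt_iff₀ hπ] at hc'
      linarith)
    obtain ⟨δ, hδ, hb⟩ := mem_nhdsGT_iff_exists_Ioc_subset.1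
      (h.eventually (eventually_lt_nhds hκ1))
    have hδ : 0 < δ := hδ
    have h1 := ((hmain δ hδ).const_mul (2 / Real.pi * κ)).add
      (tendsto_const_nhds (x := 2 / Real.pi * (2 / δ)).div_atTop hlog)
    have h2 : 2 / Real.pi * κ * 1 + 0 < c := by
      rw [mul_one, add_zero, div_mul_eq_mul_div, div_lt_iff₀ hπ]
      linarith
    filter_upwards [h1.eventually (eventually_lt_nhds h2), self_mem_nhdsWithin,
      hlog.eventually (eventually_gt_atTop 0)] with s hs hs0 hl
    have hs0 : 0 < s := hs0
    refine lt_of_le_of_lt ?_ hs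
    obtain ⟨R, -, hR, heq⟩ := hsplit δ hδ s hs0
    rw [heq, div_le_iff₀ (by positivity)]
    have h3 : ∫ y in (0 : ℝ)..(δ / s), (1 + y ^ 2)⁻¹ * cosExponent μ (y * s)
        ≤ κ * s * (Real.log (1 + (δ / s) ^ 2) / 2) := by
      rw [← integral_mul_inv_one_add_sq, ← intervalIntegral.integral_const_mul]
      refine intervalIntegral.integral_mono_on (by positivity) (hci _ _) (hci' _ _) fun y hy => ?_
      rcases hy.1.eq_or_lt with h0 | h0
      · simp [← h0]
      · have h4 := hb ⟨mul_pos h0 hs0, by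
          have := mul_le_mul_of_nonneg_right hy.2 hs0.le
          rwa [div_mul_cancel₀ _ hs0.ne'] at this⟩
        simp only [Set.mem_ofPred_eq] at h4
        rw [div_lt_iff₀ (mul_pos h0 hs0)] at h4
        calc _ ≤ (1 + y ^ 2)⁻¹ * (κ * (y * s)) := by gcongr
          _ = κ * s * ((1 + y ^ 2)⁻¹ * y) := by ring
    calc _ ≤ 2 / Real.pi * (κ * s * (Real.log (1 + (δ / s) ^ 2) / 2) + 2 * s / δ) := by gcongr
      _ = _ := by field_simp

end

/-! ### The tail of the ladder length -/

lemma integral_abs_pos {μ : Measure ℝ} (hnd : ¬ ∀ᵐ x ∂μ, x = 0) (hint :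
    Integrable (fun x => x) μ) :
    0 < ∫ x, |x| ∂μ := by
  refine lt_of_le_of_ne (integral_nonneg fun x => abs_nonneg x) fun h => hnd ?_
  filter_upwards [(integral_eq_zero_iff_of_nonneg (fun x => abs_nonneg x) hint.abs).1 h.symm]
    with x hx
  simpa using hx

section

variable {μ : Measure ℝ} [IsProbabilityMeasure μ]

lemma tendsto_cosExponent_div_of_isLittleO (hsymm : μ.map (fun x => -x) = μ) {β ν : ℝ}
    (h : (fun s : ℝ => charFun μ s - (1 - ((ν * s ^ β : ℝ) : ℂ))) =o[𝓝[>] 0]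
      (fun s : ℝ => s ^ β)) :
    Tendsto (fun s => cosExponent μ s / s ^ β) (𝓝[>] 0) (𝓝 ν) := by
  have h1 : (fun s : ℝ => cosExponent μ s - ν * s ^ β) =o[𝓝[>] 0] (fun s : ℝ => s ^ β) := by
    refine h.norm_left.congr_left (fun s => ?_) |>.of_norm_left
    rw [charFun_eq_of_symm hsymm, ← Complex.ofReal_one, ← Complex.ofReal_sub, ← Complex.ofReal_sub,
      Complex.norm_real, Real.norm_eq_abs, Real.norm_eq_abs, ← abs_neg]
    ring_nf
  have h2 := h1.tendsto_div_nhds_zero.add_const ν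
  rw [zero_add] at h2
  refine h2.congr' ?_
  filter_upwards [self_mem_nhdsWithin] with s hs
  have : 0 < s ^ β := Real.rpow_pos_of_pos hs β
  field_simp
  ring

/-- The asymptotic behaviour of `absExponent`, in terms of the constant of the tail asymptotics. -/
lemma tendsto_absExponent_div_lengthConst (hnd : ¬ ∀ᵐ x ∂μ, x = 0) {β ν : ℝ} (hβ : 0 < β)
    (hν : 0 < ν) (hint : 1 < β → Integrable (fun x => x) μ)
    (h : Tendsto (fun s => cosExponent μ s / s ^ β) (𝓝[>] 0) (𝓝 ν)) :
    (∀ᶠ x in atTop, 0 < lengthConst β ν (∫ x, |x| ∂μ) x) ∧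
    Tendsto (fun x => absExponent μ (1 / x) /
      (lengthConst β ν (∫ x, |x| ∂μ) x * x ^ (-(min 1 β)))) atTop (𝓝 1) := by
  have hπ := Real.pi_pos
  have hinv : Tendsto (fun x : ℝ => 1 / x) atTop (𝓝[>] 0) := by
    simpa using! tendsto_inv_atTop_nhdsGT_zero (𝕜 := ℝ)
  rcases lt_trichotomy β 1 with hβ1 | hβ1 | hβ1
  · have hcos : 0 < Real.cos (Real.pi * β / 2) :=
      Real.cos_pos_of_mem_Ioo ⟨by nlinarith, by nlinarith⟩
    have hC : 0 < ν / Real.cos (Real.pi * β / 2) := div_pos hν hcos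
    simp only [lengthConst, if_pos hβ1, min_eq_right hβ1.le]
    refine ⟨Eventually.of_forall fun _ => hC, ?_⟩
    have h1 := ((tendsto_absExponent_div_rpow hβ hβ1 h).comp hinv).div_const
      (ν / Real.cos (Real.pi * β / 2))
    rw [div_self hC.ne'] at h1
    refine h1.congr' ?_
    filter_upwards [eventually_gt_atTop 0] with x hx
    simp only [Function.comp_apply]
    rw [Real.rpow_neg hx.le, one_div, Real.inv_rpow hx.le, div_div, mul_comm]
  · subst hβ1
    simp only [lengthConst, lt_irrefl, if_false, if_true, min_self]
    have hl : ∀ᶠ x : ℝ in atTop, 0 < Real.log x :=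
      Real.tendsto_log_atTop.eventually (eventually_gt_atTop 0)
    have hC : 0 < 2 * ν / Real.pi := by positivity
    refine ⟨hl.mono fun x hx => by positivity, ?_⟩
    simp only [Real.rpow_one] at h
    have h1 := ((tendsto_absExponent_div_mul_log h).comp hinv).div_const (2 * ν / Real.pi)
    rw [div_self hC.ne'] at h1
    refine h1.congr' ?_
    filter_upwards [eventually_gt_atTop 0] with x hx
    simp only [Function.comp_apply]
    rw [Real.rpow_neg_one, one_div_one_div, div_div, one_div]
    ring_nf
  · have hC : 0 < ∫ x, |x| ∂μ := integral_abs_pos hnd (hint hβ1)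
    simp only [lengthConst, if_neg hβ1.not_gt, if_neg hβ1.ne', min_eq_left hβ1.le]
    refine ⟨Eventually.of_forall fun _ => hC, ?_⟩
    have h1 := ((tendsto_absExponent_div_of_integrable (hint hβ1)).comp hinv).div_const
      (∫ x, |x| ∂μ)
    rw [div_self hC.ne'] at h1
    refine h1.congr' ?_
    filter_upwards [eventually_gt_atTop 0] with x hx
    simp only [Function.comp_apply]
    rw [Real.rpow_neg_one, one_div, div_div, mul_comm]

lemma returnFactor_pos (μ : Measure ℝ) [IsProbabilityMeasure μ] : 0 < returnFactor μ :=
  Real.exp_pos _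

lemma tendsto_ladderLaw_div (hsymm : μ.map (fun x => -x) = μ) (hnd : ¬ ∀ᵐ x ∂μ, x = 0) :
    Tendsto (fun s => laplaceExponent (ladderLaw μ) s / √(absExponent μ s)) (𝓝[>] 0)
    (𝓝 (returnFactor μ)) :=
  tendsto_laplaceExponent_ladderLaw_div hsymm (fun _ hs => absExponent_pos hnd hs)
    (summable_return hsymm hnd)

lemma laplaceExponent_ladderLaw_pos (hsymm : μ.map (fun x => -x) = μ) (hnd : ¬ ∀ᵐ x ∂μ, x = 0)
    {s : ℝ} (hs : 0 < s) :
    0 < laplaceExponent (ladderLaw μ) s := by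
  obtain ⟨r, hr, hrs⟩ := (((tendsto_ladderLaw_div hsymm hnd).eventually
    (eventually_gt_nhds (returnFactor_pos μ))).and (Ioo_mem_nhdsGT hs)).exists
  have h1 : 0 < laplaceExponent (ladderLaw μ) r := by
    have := absExponent_pos hnd hrs.1
    exact (div_pos_iff_of_pos_right (by positivity)).1 hr
  exact h1.trans_le (monotoneOn_laplaceExponent (ladderLaw_Iio μ) hrs.1.le hs.le hrs.2.le)

/-- The Laplace exponent of the ladder length is asymptotic to a multiple of the square root of
`absExponent`, which halves the index. -/
lemma regularlyVarying_ladderLaw (hsymm : μ.map (fun x => -x) = μ) (hnd : ¬ ∀ᵐ x ∂μ, x = 0)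
    {α : ℝ} (hrv : RegularlyVarying (absExponent μ) α) :
    RegularlyVarying (laplaceExponent (ladderLaw μ)) (α / 2) := by
  intro l hl
  have h1 := tendsto_ladderLaw_div hsymm hnd
  have h2 := tendsto_const_mul_nhdsGT_zero hl
  have h3 := ((h1.comp h2).mul (hrv l hl).sqrt).div h1 (returnFactor_pos μ).ne'
  rw [mul_div_cancel_left₀ _ (returnFactor_pos μ).ne'] at h3
  have h4 : √(l ^ α) = l ^ (α / 2) := by
    rw [Real.sqrt_eq_rpow, ← Real.rpow_mul hl.le]
    ring_nf
  rw [h4] at h3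
  refine h3.congr' ?_
  filter_upwards [self_mem_nhdsWithin] with s hs
  have hs : 0 < s := hs
  have hw1 := Real.sqrt_pos.2 (absExponent_pos hnd hs)
  have hw2 := Real.sqrt_pos.2 (absExponent_pos hnd (mul_pos hl hs))
  have hf := laplaceExponent_ladderLaw_pos hsymm hnd hs
  simp only [Pi.div_apply, Function.comp_apply]
  rw [Real.sqrt_div (absExponent_pos hnd (mul_pos hl hs)).le]
  field_simp

/-- The tail of the first-ladder length. -/
lemma isEquivalent_tail_ladderLaw (hsymm : μ.map (fun x => -x) = μ) (hnd : ¬ ∀ᵐ x ∂μ, x = 0)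
    {β ν : ℝ} (hβ : 0 < β) (hν : 0 < ν)
    (hrv : RegularlyVarying (absExponent μ) (min 1 β))
    (hint : 1 < β → Integrable (fun x => x) μ)
    (h : Tendsto (fun s => cosExponent μ s / s ^ β) (𝓝[>] 0) (𝓝 ν)) :
    (fun x : ℝ => (ladderLaw μ).real (Set.Ioi x)) ~[atTop]
      (fun x : ℝ => √(lengthConst β ν (∫ x, |x| ∂μ) x) / Real.Gamma (1 - min 1 β / 2)
        * returnFactor μ * x ^ (-(min 1 β / 2))) := by
  have hα0 : 0 < min 1 β / 2 := by positivity
  have hα1 : min 1 β / 2 < 1 := by linarith [min_le_left 1 β]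
  have hΓ : 0 < Real.Gamma (1 - min 1 β / 2) := Real.Gamma_pos_of_pos (by linarith)
  set g := Real.Gamma (1 - min 1 β / 2)
  have hΦ := returnFactor_pos μ
  have hinv : Tendsto (fun x : ℝ => 1 / x) atTop (𝓝[>] 0) := by
    simpa using! tendsto_inv_atTop_nhdsGT_zero (𝕜 := ℝ)
  obtain ⟨hC, hw⟩ := tendsto_absExponent_div_lengthConst hnd hβ hν hint h
  have h1 := tendsto_tail_div_laplaceExponent hα0 hα1 (ladderLaw_Iio μ)
    (fun s hs => laplaceExponent_ladderLaw_pos hsymm hnd hs)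
    (regularlyVarying_ladderLaw hsymm hnd hrv)
  have h2 := (h1.mul ((tendsto_ladderLaw_div hsymm hnd).comp hinv)).mul hw.sqrt
  have h3 := h2.mul_const (g / returnFactor μ)
  have h4 : 1 / g * returnFactor μ * √1 * (g / returnFactor μ) = 1 := by
    rw [Real.sqrt_one]
    field_simp
  rw [h4] at h3
  refine isEquivalent_of_tendsto_one (h3.congr' ?_)
  filter_upwards [hC, eventually_gt_atTop 0] with x hCx hx
  have hx' : 0 < 1 / x := one_div_pos.2 hx
  have hf := laplaceExponent_ladderLaw_pos hsymm hnd hx'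
  have hwx := absExponent_pos hnd hx'
  have hsw := Real.sqrt_pos.2 hwx
  have hsC := Real.sqrt_pos.2 hCx
  have hxp : 0 < x ^ (-(min 1 β / 2)) := Real.rpow_pos_of_pos hx _
  have h5 : √(x ^ (-(min 1 β))) = x ^ (-(min 1 β / 2)) := by
    rw [Real.sqrt_eq_rpow, ← Real.rpow_mul hx.le]
    ring_nf
  simp only [Pi.div_apply, Function.comp_apply]
  rw [Real.sqrt_div hwx.le, Real.sqrt_mul hCx.le, h5]
  field_simp

end

end LadderLength

theorem mainTheorem10 {Ω : Type*} [MeasurableSpace Ω] (P : Measure Ω) [IsProbabilityMeasure P]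
    (ξ : ℕ → Ω → ℝ) (hmeas : ∀ k, Measurable (ξ k))
    (hindep : iIndepFun ξ P) (hident : ∀ k, IdentDistrib (ξ k) (ξ 0) P P)
    (hsymm : IdentDistrib (fun ω => -ξ 0 ω) (ξ 0) P P)
    (β : ℝ) (hβ0 : 0 < β) (hβ2 : β ≤ 2)
    (hDA : LadderLength.InDomainOfAttraction β (P.map (ξ 0))) :
    -- the first-ladder time is almost surely finite
    (∀ᵐ ω ∂P, ∃ n : ℕ, 0 < n ∧ 0 < LadderLength.walk ξ n ω) ∧
    -- the first-ladder length is in the domain of attraction of a stable law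
    LadderLength.InDomainOfAttraction (min 1 β / 2) (P.map (LadderLength.ladderLength ξ)) ∧
    -- the constants below are well defined
    Summable (fun n : ℕ => P.real {ω | LadderLength.walk ξ (n + 1) ω = 0} / ((n : ℝ) + 1)) ∧
    (1 < β → Integrable (ξ 0) P) ∧
    -- for integer-valued walks, `Φ(1, 0)` is given by the integral formula
    ((∀ᵐ ω ∂P, ∃ m : ℤ, ξ 0 ω = m) →
      IntervalIntegrable (fun t : ℝ => Complex.log (1 - charFun (P.map (ξ 0)) t))
        volume 0 Real.pi ∧
      LadderLength.latticePhi P (ξ 0) (fun ω => |ξ 0 ω|) 1 0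
        = (LadderLength.phiOneZero P ξ : ℂ)) ∧
    -- for increments without atoms, `Φ(1, 0) = 1`
    ((∀ x : ℝ, P {ω | ξ 0 ω = x} = 0) → LadderLength.phiOneZero P ξ = 1) ∧
    -- the precise tail asymptotics
    (∀ ν : ℝ, 0 < ν →
      (fun s : ℝ => charFun (P.map (ξ 0)) s - (1 - ((ν * s ^ β : ℝ) : ℂ)))
        =o[𝓝[>] 0] (fun s : ℝ => s ^ β) →
      (fun x : ℝ => P.real {ω | x < LadderLength.ladderLength ξ ω}) ~[atTop]
        (fun x : ℝ => Real.sqrt (LadderLength.lengthConst β ν (∫ ω, |ξ 0 ω| ∂P) x)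
          / Real.Gamma (1 - min 1 β / 2)
          * LadderLength.phiOneZero P ξ * x ^ (-(min 1 β / 2)))) := by
  let μ : Measure ℝ := P.map (ξ 0)
  have hμ : IsProbabilityMeasure μ := Measure.isProbabilityMeasure_map (hmeas 0).aemeasurable
  have hμsymm : μ.map (fun x => -x) = μ := by
    rw [Measure.map_map measurable_neg (hmeas 0)]
    exact hsymm.map_eq
  -- the law of the whole sequence of increments
  have hseq : Measurable fun ω (k : ℕ) => ξ k ω := measurable_pi_lambda _ hmeas
  have hlaw : P.map (fun ω (k : ℕ) => ξ k ω) = LadderLength.stepLaw μ := by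
    rw [(iIndepFun_iff_map_fun_eq_infinitePi_map hmeas).1 hindep]
    simp_rw [fun k => (hident k).map_eq]
    rfl
  have hladder : P.map (LadderLength.ladderLength ξ) = LadderLength.ladderLaw μ := by
    rw [LadderLength.ladderLaw, ← hlaw,
      Measure.map_map LadderLength.measurable_ladderLength_coord hseq]
    exact congrArg (P.map ·) (funext fun ω => LadderLength.ladderLength_eq_coord ξ ω)
  have hreturn : ∀ n, P.real {ω | LadderLength.walk ξ n ω = 0}
      = (LadderLength.stepLaw μ).real {x | LadderLength.partialSum x n = 0} := by
    intro n
    have hms : MeasurableSet {x | LadderLength.partialSum x n = 0} :=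
      LadderLength.measurable_partialSum n (measurableSet_singleton 0)
    rw [← hlaw, map_measureReal_apply hseq hms]
    rfl
  have hfactor : LadderLength.phiOneZero P ξ = LadderLength.returnFactor μ := by
    simp only [LadderLength.phiOneZero, LadderLength.returnFactor, hreturn]
  obtain ⟨hnd, hrv, hint⟩ := LadderLength.regularlyVarying_absExponent hβ0 hμsymm hDA
  have hcast : ∀ t, 1 - charFun μ t = ((LadderLength.cosExponent μ t : ℝ) : ℂ) := fun t => by
    rw [LadderLength.charFun_eq_of_symm hμsymm]
    push_cast
    ring
  have hlog : ∀ t, Complex.log (1 - charFun μ t)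
      = ((Real.log (LadderLength.cosExponent μ t) : ℝ) : ℂ) := fun t => by
    rw [hcast, Complex.ofReal_log (LadderLength.cosExponent_nonneg μ t)]
  have hmean : ∫ ω, |ξ 0 ω| ∂P = ∫ x, |x| ∂μ :=
    (integral_map (hmeas 0).aemeasurable (by fun_prop)).symm
  have hα : 0 < min 1 β / 2 := by positivity
  have hα1 : min 1 β / 2 < 1 := by linarith [min_le_left 1 β]
  have hsum := LadderLength.summable_return hμsymm hnd
  refine ⟨?_, ?_, ?_, fun h => ?_, fun hint' => ?_, fun hna => ?_, fun ν hν hasym => ?_⟩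
  · have h := LadderLength.ae_exists_partialSum_pos hμsymm
      (fun s hs => LadderLength.absExponent_pos hnd hs) hsum
    rw [← hlaw] at h
    exact ae_of_ae_map hseq.aemeasurable h
  · rw [hladder]
    exact LadderLength.inDomainOfAttraction_of_regularlyVarying hα hα1
      (LadderLength.ladderLaw_Iio μ)
      (fun s hs => LadderLength.laplaceExponent_ladderLaw_pos hμsymm hnd hs)
      (LadderLength.regularlyVarying_ladderLaw hμsymm hnd hrv)
  · simpa only [hreturn] using hsum
  · exact (integrable_map_measure (by fun_prop) (hmeas 0).aemeasurable).1 (hint h)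
  · have hint'' : ∀ᵐ x : ℝ ∂μ, ∃ m : ℤ, x = m := by
      have hms : MeasurableSet {x : ℝ | ∃ m : ℤ, x = m} := by
        have : {x : ℝ | ∃ m : ℤ, x = m} = Set.range ((↑) : ℤ → ℝ) := by
          ext x
          exact exists_congr fun m => eq_comm
        rw [this]
        exact (Set.countable_range _).measurableSet
      exact (ae_map_iff (hmeas 0).aemeasurable hms).2 hint'
    obtain ⟨h1, h2⟩ := LadderLength.lattice_log_integral hμsymm hnd hint''
    constructor
    · simp only [show P.map (ξ 0) = μ from rfl, hlog]
      exact ⟨h1.1.ofReal, h1.2.ofReal⟩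
    · have h3 : ∀ t : ℝ, ∫ ω, Complex.exp (Complex.I * ((t * ξ 0 ω + 0 * |ξ 0 ω| : ℝ) : ℂ)) ∂P
          = charFun μ t := fun t => by
        rw [charFun_apply_real, integral_map (hmeas 0).aemeasurable (by fun_prop)]
        refine integral_congr_ae (ae_of_all _ fun ω => ?_)
        simp only
        push_cast
        ring_nf
      simp only [LadderLength.latticePhi, h3, Complex.ofReal_one, one_mul, hlog]
      rw [intervalIntegral.integral_ofReal, h2, hfactor, LadderLength.returnFactor,
        Complex.ofReal_exp]
      congr 1
      have hπ : (Real.pi : ℂ) ≠ 0 := by exact_mod_cast Real.pi_ne_zero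
      push_cast
      field_simp
  · have hna' : ∀ x, μ {x} = 0 := fun x => by
      rw [Measure.map_apply (hmeas 0) (measurableSet_singleton x)]
      exact hna x
    rw [hfactor, LadderLength.returnFactor]
    simp [LadderLength.return_eq_zero_of_noAtoms hna']
  · have h1 := LadderLength.isEquivalent_tail_ladderLaw hμsymm hnd hβ0 hν hrv hint
      (LadderLength.tendsto_cosExponent_div_of_isLittleO hμsymm hasym)
    rw [hmean, hfactor]
    refine h1.congr_left (Eventually.of_forall fun x => ?_)
    have hml : Measurable (LadderLength.ladderLength ξ) := by
      have h2 := LadderLength.measurable_ladderLength_coord.comp hseq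
      refine (congrArg Measurable (funext fun ω => ?_)).mp h2
      exact (LadderLength.ladderLength_eq_coord ξ ω).symm
    simp only
    rw [← hladder, map_measureReal_apply hml measurableSet_Ioi]
    rfl
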